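/- **Setting.** For a finite unweighted undirected graph $G=(V,E)$ let $\delta_v(G)$ be the degree of $v$, $\mathcal D_G$ the degree matrix, $\mathcal A_G$ the adjacency matrix, $\mathcal L_G=\mathcal D_G-\mathcal A_G$ the Laplacian, $\mathrm{Vol}(S)=\sum_{v\in S}\delta_v(G)$, and let the conductance of $G$ be $$\Phi_G=\min_{\emptyset\ne S\subsetneq V}\frac{|E(S,V\setminus S)|}{\min\{\mathrm{Vol}(S),\mathrm{Vol}(V\setminus S)\}},$$ where sets $S$ with $\min\{\mathrm{Vol}(S),\mathrm{Vol}(V\setminus S)\}=0$ are disregarded and the minimum over an empty family is $+\infty$. **SampleSketch and ExpanderEval.** Let $H$ be an unweighted undirected graph on $V(H)=\{0,\dots,n-1\}$, and let $a\ge 1$ be an integer. Let $S$ be the set of vertices of $H$ of degree at most $a$, $L=V(H)\setminus S$, and for $u\in L$ let $E_u=\{v\in L: uv\in E(H)\}$ and $\delta^L_u=|E_u|$. $\mathrm{SampleSketch}(H,a)$ is the random data $\mathrm{dat}$ consisting of $S$, $L$, $a$, all degrees $\delta_u=\delta_u(H)$, all edges of $H$ with an endpoint in $S$, and, for every $u\in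 L$, the number $\delta^L_u$ and $a$ independent uniform samples (with replacement) from $E_u$ (no samples if $E_u=\emptyset$); the samples for different $u$ are independent. Let $Y^u_v$ be the number of times $v$ is sampled for $u$. For $x\in\mathbb R^n$ put $y=x-c\mathbf 1$ with $c=\frac{\mathbf 1^\top\mathcal D_Hx}{\mathbf 1^\top\mathcal D_H\mathbf 1}$ ($c=0$ if $H$ has no edges), and let $$\mathrm{ExpanderEval}(\mathrm{dat},x)=\sum_{u\in V(H)}y_u^2\delta_u-\sum_{u\in S}\ \sum_{v:\,uv\in E(H)}y_uy_v-\sum_{u\in L}\ \sum_{v\in S:\,uv\in E(H)}y_uy_v-\sum_{u\in L}\frac{\delta^L_u}{a}\sum_{v\in L}y_uy_vY^u_v .$$ **Lemma (Sketching Subgraphs of Expanders).** There are a randomized construction program, a query program, a constant $C$ and an integer $k$ such that the following holds for every $n\ge1$, every unweighted undirected graph $H$ on $\{0,\dots,n-1\}$ with $m$ edges, and every real $\alpha\ge1$. Let $a=\lceil\alpha\rceil$ (so $a=\alpha$ if $\alpha$ is an integer) and $\Lambda=\log(n+\alpha+2)^k$. The programs run on a random access machine with real registers, zero-initialized memory and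 uniform random integers as a primitive, with logarithmic cost for integer operations and unit cost for real operations. 1. Given $a$, $n$, $m$ and any list of the edges of $H$, the construction program always stops within time $C(m+1)\Lambda$, and it stores a (random) sketch of at most $Cn\alpha\Lambda$ bits. 2. Given the stored sketch and any $x\in\mathbb R^n$, the query program returns within time $Cn\alpha\Lambda$ a value $f(x)$ that is determined by the stored sketch and $x$. 3. The random function $f$ has the same distribution as $x\mapsto\mathrm{ExpanderEval}(\mathrm{SampleSketch}(H,a),x)$. 4. For every $x\in\mathbb R^n$, $\mathbb E[f(x)]=x^\top\mathcal L_Hx$. 5. For every unweighted graph $T$ on $n'$ vertices that contains $H$ as an induced subgraph and has conductance at least $h>0$, and all $x\in\mathbb R^n$ and $z\in\mathbb R^{n'}$ with $x_u=z_u$ for every vertex $u$ of $H$, $$\mathrm{Var}[f(x)]\le 4\alpha^{-2}h^{-4}\,(z^\top\mathcal L_Tz)^2 .$$ -/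

import Mathlib

namespace ExpanderSketch

open Finset

/-! ### Conductance -/

/-- `Vol(S)`: the sum of the degrees of the vertices of `S`. -/
def vol {V : Type*} [Fintype V] (G : SimpleGraph V) [DecidableRel G.Adj] (S : Finset V) : ℕ :=
  ∑ v ∈ S, G.degree v

/-- The conductance `min_{∅ ≠ S ≠ V} w(S, V∖S) / min(Vol S, Vol (V∖S))` of an unweighted graph.
Sets for which the quotient is the undefined `0 / 0` are left out, and the minimum of the empty
family (a graph without edges) is `⊤`. -/
noncomputable def conductance {V : Type*} [Fintype V] [DecidableEq V] (G : SimpleGraph V)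
    [DecidableRel G.Adj] : ENNReal :=
  ⨅ (S : Finset V) (_ : S ≠ ∅) (_ : S ≠ univ) (_ : 0 < min (vol G S) (vol G Sᶜ)),
    ((G.interedges S Sᶜ).card : ENNReal) / ((min (vol G S) (vol G Sᶜ) : ℕ) : ENNReal)

/-! ### The sketch and its evaluation, as mathematical objects -/

/-- The data `dat(H)` of a sketch of a graph on the vertices `0, …, n-1`. -/
structure SketchData (n : ℕ) where
  /-- the low-degree vertices -/
  S : Finset (Fin n)
  /-- the high-degree vertices -/
  L : Finset (Fin n)
  /-- the threshold -/
  a : ℕ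
  /-- the degrees -/
  deg : Fin n → ℕ
  /-- the stored edges: all the edges incident to a vertex of `S` -/
  edges : Finset (Sym2 (Fin n))
  /-- for `u ∈ L`, the degree of `u` in the graph induced on `L` -/
  degL : Fin n → ℕ
  /-- for `u ∈ L`, the endpoints `v` of the sampled edges `(u, v)`, with repetitions -/
  samples : Fin n → Multiset (Fin n)

section Sample

variable {n : ℕ} (H : SimpleGraph (Fin n)) [DecidableRel H.Adj] (a : ℕ)

/-- The vertices of degree at most `a`. -/
def lowSet : Finset (Fin n) := univ.filter fun u => H.degree u ≤ a

/-- The vertices of degree greater than `a`. -/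
def highSet : Finset (Fin n) := univ \ lowSet H a

/-- The neighbours of `u` among the vertices of high degree. -/
def highNbrs (u : Fin n) : Finset (Fin n) := (highSet H a).filter fun v => H.Adj u v

/-- The random choices: `a` draws with replacement from `highNbrs u`, for every high-degree `u`
that has something to draw from. -/
abbrev Draws : Type :=
  (u : {u : Fin n // u ∈ highSet H a ∧ (highNbrs H a u).Nonempty}) →
    Fin a → {v : Fin n // v ∈ highNbrs H a u}

instance drawsNonempty : Nonempty (Draws H a) :=
  ⟨fun u _ => ⟨u.2.2.choose, u.2.2.choose_spec⟩⟩

/-- The sketch determined by the random choices. -/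
def sketchOf (ω : Draws H a) : SketchData n where
  S := lowSet H a
  L := highSet H a
  a := a
  deg := fun u => H.degree u
  edges := H.edgeFinset.filter fun e => ∃ u ∈ lowSet H a, u ∈ e
  degL := fun u => if u ∈ highSet H a then (highNbrs H a u).card else 0
  samples := fun u =>
    if h : u ∈ highSet H a ∧ (highNbrs H a u).Nonempty then
      (univ : Finset (Fin a)).val.map fun j => (ω ⟨u, h⟩ j : Fin n)
    else 0

/-- `SampleSketch(H, a)`: all the draws are independent and uniform. -/
noncomputable def sampleSketch : PMF (SketchData n) :=
  (PMF.uniformOfFintype (Draws H a)).map (sketchOf H a)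

end Sample

/-- `ExpanderEval(dat, x)`. -/
noncomputable def expanderEval {n : ℕ} (d : SketchData n) (x : Fin n → ℝ) : ℝ :=
  let c : ℝ := (∑ u, (d.deg u : ℝ) * x u) / ∑ u, (d.deg u : ℝ)
  let y : Fin n → ℝ := fun u => x u - c
  (∑ u, y u ^ 2 * (d.deg u : ℝ))
    - (∑ u ∈ d.S, ∑ v ∈ univ.filter (fun v => s(u, v) ∈ d.edges), y u * y v)
    - (∑ u ∈ d.L, ∑ v ∈ d.S.filter (fun v => s(u, v) ∈ d.edges), y u * y v)
    - ∑ u ∈ d.L, (d.degL u : ℝ) / (d.a : ℝ) *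
        ∑ v ∈ d.L, y u * y v * ((d.samples u).count v : ℝ)

/-! ### The machine: a randomized random access machine with real registers

A machine has finitely many (as many as its program mentions) integer arrays with cells in `ℕ` and
real arrays with cells in `ℝ`, all of them indexed by `ℕ`. Programs are finite texts built from
assignments with indirect addressing, conditionals, counted loops and draws of uniform random
integers, hence a fragment of the usual random access machine with real registers. Integer
operations are charged at logarithmic cost (the number of bits of the addresses and numbers
involved), real operations at unit cost. Nothing flows from the reals to the integers. -/

/-- Integer expressions. -/
inductive NExpr : Type
  /-- a constant -/
  | const (k : ℕ)
  /-- the cell of array `arr` at a computed index -/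
  | cell (arr : ℕ) (idx : NExpr)
  | add (e₁ e₂ : NExpr)
  /-- truncated subtraction -/
  | sub (e₁ e₂ : NExpr)

/-- Real expressions. -/
inductive RExpr : Type
  /-- the cell of real array `arr` at a computed index -/
  | cell (arr : ℕ) (idx : NExpr)
  | ofNat (e : NExpr)
  | add (e₁ e₂ : RExpr)
  | sub (e₁ e₂ : RExpr)
  | mul (e₁ e₂ : RExpr)
  | div (e₁ e₂ : RExpr)

/-- Programs. -/
inductive Prog : Type
  | skip
  /-- write an integer to a cell -/
  | assign (arr : ℕ) (idx val : NExpr)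
  /-- write a real to a cell -/
  | rassign (arr : ℕ) (idx : NExpr) (val : RExpr)
  /-- write a uniformly random element of `{0, …, N-1}` to a cell, `N` the value of `bound` -/
  | sample (arr : ℕ) (idx bound : NExpr)
  | seq (p q : Prog)
  /-- run `p` if `e₁ ≤ e₂`, and `q` otherwise -/
  | ifLe (e₁ e₂ : NExpr) (p q : Prog)
  /-- run `p` as many times as the value of `e` at the start says -/
  | loop (e : NExpr) (p : Prog)

/-- The contents of all cells, and the time consumed so far. -/
structure State where
  nat : ℕ → ℕ → ℕ
  real : ℕ → ℕ → ℝ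
  time : ℕ

namespace NExpr

/-- The value of an integer expression. -/
def eval (s : State) : NExpr → ℕ
  | const k => k
  | cell arr idx => s.nat arr (idx.eval s)
  | add e₁ e₂ => e₁.eval s + e₂.eval s
  | sub e₁ e₂ => e₁.eval s - e₂.eval s

/-- The time to evaluate an integer expression. -/
def cost (s : State) : NExpr → ℕ
  | const k => 1 + Nat.size k
  | cell arr idx => idx.cost s + 1 + Nat.size (idx.eval s) + Nat.size (s.nat arr (idx.eval s))
  | add e₁ e₂ => e₁.cost s + e₂.cost s + 1 + Nat.size (e₁.eval s) + Nat.size (e₂.eval s)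
  | sub e₁ e₂ => e₁.cost s + e₂.cost s + 1 + Nat.size (e₁.eval s) + Nat.size (e₂.eval s)

end NExpr

namespace RExpr

/-- The value of a real expression. -/
noncomputable def eval (s : State) : RExpr → ℝ
  | cell arr idx => s.real arr (idx.eval s)
  | ofNat e => (e.eval s : ℝ)
  | add e₁ e₂ => e₁.eval s + e₂.eval s
  | sub e₁ e₂ => e₁.eval s - e₂.eval s
  | mul e₁ e₂ => e₁.eval s * e₂.eval s
  | div e₁ e₂ => e₁.eval s / e₂.eval s

/-- The time to evaluate a real expression. -/
def cost (s : State) : RExpr → ℕ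
  | cell _ idx => idx.cost s + 1 + Nat.size (idx.eval s)
  | ofNat e => e.cost s + 1 + Nat.size (e.eval s)
  | add e₁ e₂ => e₁.cost s + e₂.cost s + 1
  | sub e₁ e₂ => e₁.cost s + e₂.cost s + 1
  | mul e₁ e₂ => e₁.cost s + e₂.cost s + 1
  | div e₁ e₂ => e₁.cost s + e₂.cost s + 1

end RExpr

namespace State

/-- Let `t` units of time pass. -/
def tick (s : State) (t : ℕ) : State := { s with time := s.time + t }

/-- Write an integer. -/
def write (s : State) (arr i v : ℕ) : State :=
  { s with nat := Function.update s.nat arr (Function.update (s.nat arr) i v) }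

/-- Write a real. -/
def rwrite (s : State) (arr i : ℕ) (v : ℝ) : State :=
  { s with real := Function.update s.real arr (Function.update (s.real arr) i v) }

end State

/-- The uniform distribution on `{0, …, N-1}`; the point mass at `0` if `N = 0`. -/
noncomputable def uniformBelow (N : ℕ) : PMF ℕ :=
  if h : (range N).Nonempty then PMF.uniformOfFinset (range N) h else PMF.pure 0

/-- The distribution of the final state. -/
noncomputable def Prog.exec : Prog → State → PMF State
  | .skip, s => PMF.pure (s.tick 1)
  | .assign arr idx val, s =>
      PMF.pure ((s.write arr (idx.eval s) (val.eval s)).tick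
        (idx.cost s + val.cost s + 1 + Nat.size (idx.eval s) + Nat.size (val.eval s)))
  | .rassign arr idx val, s =>
      PMF.pure ((s.rwrite arr (idx.eval s) (val.eval s)).tick
        (idx.cost s + val.cost s + 1 + Nat.size (idx.eval s)))
  | .sample arr idx bound, s =>
      (uniformBelow (bound.eval s)).map fun v =>
        (s.write arr (idx.eval s) v).tick
          (idx.cost s + bound.cost s + 1 + Nat.size (idx.eval s) + Nat.size (bound.eval s))
  | .seq p q, s => (p.exec s).bind q.exec
  | .ifLe e₁ e₂ p q, s =>
      let s' := s.tick (e₁.cost s + e₂.cost s + 1 + Nat.size (e₁.eval s) + Nat.size (e₂.eval s))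
      if e₁.eval s ≤ e₂.eval s then p.exec s' else q.exec s'
  | .loop e p, s =>
      (fun μ : PMF State => μ.bind fun t => p.exec (t.tick 1))^[e.eval s]
        (PMF.pure (s.tick (e.cost s + 1 + Nat.size (e.eval s))))

/-! ### Input and output conventions -/

/-- `l` lists every edge of `H` exactly once, as a pair of endpoints in some order. -/
def IsEdgeList {n : ℕ} (H : SimpleGraph (Fin n)) (l : List (Fin n × Fin n)) : Prop :=
  (l.map fun p => s(p.1, p.2)).Nodup ∧
    ∀ e : Sym2 (Fin n), e ∈ l.map (fun p => s(p.1, p.2)) ↔ e ∈ H.edgeSet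

/-- The start state of the construction: array `1` holds the number of vertices, the number of edges
and the threshold, arrays `2` and `3` hold the two endpoints of each edge; all else is zero. -/
def buildInput {n : ℕ} (l : List (Fin n × Fin n)) (a : ℕ) : State where
  nat := fun arr i =>
    match arr with
    | 1 => [n, l.length, a].getD i 0
    | 2 => (l.map fun p => (p.1 : ℕ)).getD i 0
    | 3 => (l.map fun p => (p.2 : ℕ)).getD i 0
    | _ => 0
  real := fun _ _ => 0
  time := 0

/-- The stored sketch: array `0` holds its length followed by its entries. Everything else in
memory is discarded. -/
def State.stored (s : State) : List ℕ :=
  (List.range (s.nat 0 0)).map fun i => s.nat 0 (i + 1)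

/-- The number of bits of a self-delimiting binary code of a list of integers. -/
def bitLength (dat : List ℕ) : ℕ := (dat.map fun w => 2 * Nat.size w + 2).sum

/-- The distribution of the stored sketch. -/
noncomputable def Prog.storedLaw (build : Prog) {n : ℕ} (l : List (Fin n × Fin n)) (a : ℕ) :
    PMF (List ℕ) :=
  (build.exec (buildInput l a)).map State.stored

/-- The distribution of `f dat x`, where `dat` is the stored sketch. -/
noncomputable def Prog.valueLaw (build : Prog) {n : ℕ} (l : List (Fin n × Fin n)) (a : ℕ)
    (f : List ℕ → (Fin n → ℝ) → ℝ) (x : Fin n → ℝ) : MeasureTheory.Measure ℝ :=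
  ((build.storedLaw l a).map fun dat => f dat x).toMeasure

/-- The start state of a query: integer array `0` holds the length of the stored sketch followed by
its entries, real array `0` holds the query vector; all else is zero. -/
noncomputable def queryInput {n : ℕ} (dat : List ℕ) (x : Fin n → ℝ) : State where
  nat := fun arr i => if arr = 0 then (dat.length :: dat).getD i 0 else 0
  real := fun arr i => if arr = 0 then (if h : i < n then x ⟨i, h⟩ else 0) else 0
  time := 0

/-- The answer to a query is cell `0` of real array `1`. -/
def State.answer (s : State) : ℝ := s.real 1 0

end ExpanderSketch

/-! Expectation. Only the edges inside `L` are estimated; all other terms of the evaluation are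
exact. With `d` high neighbours of `u`, a draw of `v` contributes `(d/a) y_u y_v`, whose mean is
`1/a` times the sum of `y_u y_v` over the high neighbours `v`. The `a` draws of every `u` thus
restore the missing pairs on average, and `yᵀLy = xᵀLx` because the Laplacian kills constants
(`integral_expanderEval`).

Variance. Draws are independent, so variances add, and each is at most a second moment. For one `u`
this gives `(d/a) y_u²` times the sum of `y_v²` over its high neighbours. These have degree above
`a`, so `a` times that sum is at most `Z`, the sum of `δ_v y_v²` over all vertices; as `d ≤ δ_u`,
the total is at most `a⁻² Z²` (`variance_expanderEval_le`). The shift by the weighted mean minimizes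
`Z` over all shifts, degrees in `H` are at most those in `T`, and Cheeger's inequality in `T`
(`cheeger`) bounds the resulting sum by `2 h⁻² zᵀLz`. Squaring gives `4 α⁻² h⁻⁴`.

Construction. Time proportional to `m + 1` forbids loops over vertices, so every loop runs over the
edges, over the `2m` darts (edges with a direction) or over a queue of at most `2m` entries;
zero-initialized memory serves as empty tables. Degrees are counted; a dart with a low end becomes a
record `(u, v, a)`; any other dart enters the neighbour table of its tail. A further pass over the
darts puts each vertex with a nonempty table into the queue until it is there `a` times, which
succeeds because more than `a` darts leave it. Each queue entry then causes one uniform draw and a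
record `(u, v, d)`. The stored array holds its length, `n`, `a`, the number of records, the degrees
and the records. A query divides the weighted sum of the records by `a`, so exact darts count with
weight `1` and draws with weight `d/a`. At most `2na` records are exact and at most `na` are draws.

Law and cost. The outcomes of the queue correspond bijectively to the mathematical draws
(`exists_turn_outcomes`), and bijections preserve uniform laws; hence the two random functions agree
in law (`build_law`). For the cost, loop-free bodies take time proportional to the bit length of the
largest number present (`exec_bound`). Loop invariants keep all numbers below the polynomial `cap`,
whose bit length is logarithmic (`size_cap_le`). -/

namespace ExpanderSketch
open Finset

/-! ### Cheeger's inequality for the volume-weighted second moment -/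

section Cheeger

variable {V : Type*} [Fintype V] [DecidableEq V] (G : SimpleGraph V) [DecidableRel G.Adj]

/-- The cut inequality that a lower bound on the conductance provides. -/
theorem mul_vol_le_interedges {h : ℝ} (hc : ENNReal.ofReal h ≤ conductance G)
    (S : Finset V) (hS : vol G S ≤ vol G Sᶜ) :
    h * vol G S ≤ (G.interedges S Sᶜ).card := by
  rcases Nat.eq_zero_or_pos (vol G S) with h0 | h0
  · simp [h0]
  have hmin : min (vol G S) (vol G Sᶜ) = vol G S := min_eq_left hS
  have hne : S ≠ ∅ := by rintro rfl; simp [vol] at h0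
  have hnu : S ≠ univ := by
    rintro rfl
    have : vol G univᶜ = 0 := by simp [vol]
    omega
  have h1 : ENNReal.ofReal h ≤
      ((G.interedges S Sᶜ).card : ENNReal) / ((min (vol G S) (vol G Sᶜ) : ℕ) : ENNReal) :=
    hc.trans (iInf_le_of_le S (iInf_le_of_le hne (iInf_le_of_le hnu
      (iInf_le_of_le (by rw [hmin]; exact h0) le_rfl))))
  rw [hmin, ENNReal.le_div_iff_mul_le (Or.inl (by exact_mod_cast h0.ne'))
    (Or.inl (by simp))] at h1
  have h2 := ENNReal.toReal_mono (by simp) h1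
  rw [ENNReal.toReal_mul, ENNReal.toReal_natCast, ENNReal.toReal_natCast] at h2
  refine le_trans ?_ h2
  gcongr
  rw [ENNReal.toReal_ofReal']
  exact le_max_left h 0

/-- The total ascent of `φ` over the edges. -/
def ascent (φ : V → ℝ) : ℝ :=
  ∑ u, ∑ v, if G.Adj u v then max (φ u - φ v) 0 else 0

theorem card_interedges_eq_sum (S : Finset V) :
    ((G.interedges S Sᶜ).card : ℝ) =
      ∑ u, ∑ v, if G.Adj u v then (if u ∈ S ∧ v ∉ S then 1 else 0) else 0 := by
  rw [SimpleGraph.interedges, Rel.interedges, Finset.card_filter]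
  push_cast
  rw [Finset.sum_product, ← Finset.sum_filter_add_sum_filter_not univ (· ∈ S)]
  rw [Finset.filter_mem_eq_inter, Finset.univ_inter]
  rw [Finset.sum_eq_zero (s := univ.filter (fun x => ¬ x ∈ S)), add_zero]
  · refine Finset.sum_congr rfl fun u hu => ?_
    rw [← Finset.sum_subset (Finset.subset_univ Sᶜ)]
    · refine Finset.sum_congr rfl fun v hv => ?_
      simp at hv
      simp [hu, hv]
    · intro v _ hv
      simp at hv
      simp [hv]
  · intro u hu
    simp at hu
    simp [hu]

/-- A discrete coarea argument, by induction on the size of the support `S`. Subtracting the least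
positive value `φ w` on `S` removes `w` from the support, lowers the degree sum by `φ w * vol G S`
and lowers the ascent by `φ w` times the size of the cut around `S`. The cut inequality for `S`
compares these two losses, and the smaller support still has at most half of the volume. -/
theorem mul_sum_degree_le_ascent {h : ℝ} (hc : ENNReal.ofReal h ≤ conductance G)
    (φ : V → ℝ) (hφ : ∀ v, 0 ≤ φ v)
    (hS : vol G (univ.filter fun v => 0 < φ v) ≤ vol G (univ.filter fun v => 0 < φ v)ᶜ) :
    h * ∑ v, (G.degree v : ℝ) * φ v ≤ ascent G φ := by
  induction hk : (univ.filter fun v => 0 < φ v).card using Nat.strong_induction_on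
    generalizing φ with
  | _ k ih =>
  set S := univ.filter fun v => 0 < φ v with hSdef
  rcases S.eq_empty_or_nonempty with hE | hne
  · have h0 : ∀ v, φ v = 0 := fun v => by
      by_contra hv
      have : v ∈ S := by simp [hSdef]; exact lt_of_le_of_ne (hφ v) (Ne.symm hv)
      simp [hE] at this
    simp [ascent, h0]
  obtain ⟨w, hwS, hw⟩ := S.exists_min_image φ hne
  have hwpos : 0 < φ w := by simpa [hSdef] using hwS
  set ψ : V → ℝ := fun v => φ v - if v ∈ S then φ w else 0 with hψ
  have hzero : ∀ v, v ∉ S → φ v = 0 := fun v hv => by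
    simp [hSdef] at hv
    exact le_antisymm hv (hφ v)
  have hψ0 : ∀ v, 0 ≤ ψ v := fun v => by
    by_cases hv : v ∈ S
    · simpa [hψ, hv] using hw v hv
    · simp [hψ, hv, hφ v]
  have hsub : (univ.filter fun v => 0 < ψ v) ⊆ S.erase w := by
    intro v hv
    simp only [mem_filter, mem_univ, true_and] at hv
    rw [mem_erase]
    constructor
    · rintro rfl
      simp [hψ, hwS] at hv
    · by_contra hvS
      simp [hψ, hvS, hzero v hvS] at hv
  have hcard : (univ.filter fun v => 0 < ψ v).card < k := by
    rw [← hk]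
    exact (card_le_card hsub).trans_lt (card_erase_lt_of_mem hwS)
  have hsubS := hsub.trans (erase_subset w S)
  have hvol : vol G (univ.filter fun v => 0 < ψ v) ≤ vol G (univ.filter fun v => 0 < ψ v)ᶜ :=
    (sum_le_sum_of_subset hsubS).trans
      (hS.trans (sum_le_sum_of_subset (compl_subset_compl.2 hsubS)))
  have key := ih _ hcard ψ hψ0 hvol rfl
  have hcut := mul_vol_le_interedges G hc S hS
  have e1 : ∑ v, (G.degree v : ℝ) * φ v
      = ∑ v, (G.degree v : ℝ) * ψ v + φ w * vol G S := by
    have : (vol G S : ℝ) = ∑ v, if v ∈ S then (G.degree v : ℝ) else 0 := by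
      simp [vol]
    rw [this, mul_sum, ← sum_add_distrib]
    refine sum_congr rfl fun v _ => ?_
    by_cases hv : v ∈ S <;> simp [hψ, hv]
    ring
  have e2 : ascent G φ = ascent G ψ + φ w * (G.interedges S Sᶜ).card := by
    rw [card_interedges_eq_sum, ascent, ascent, mul_sum, ← sum_add_distrib]
    refine sum_congr rfl fun u _ => ?_
    rw [mul_sum, ← sum_add_distrib]
    refine sum_congr rfl fun v _ => ?_
    -- Only an edge leaving `S` loses ascent, namely `φ w`: inside `S` the shifts cancel, and an
    -- edge entering `S` has no ascent before or after.
    by_cases hA : G.Adj u v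
    · simp only [hA, if_true]
      by_cases hu : u ∈ S <;> by_cases hv : v ∈ S
      · simp [hψ, hu, hv]
      · have h1 := hw u hu
        simp only [hψ, hu, hv, hzero v hv, if_true, if_false, not_false_eq_true, and_self]
        rw [max_eq_left (by linarith), max_eq_left (by linarith)]
        ring
      · have h1 := hw v hv
        simp only [hψ, hu, hv, hzero u hu, if_true, if_false, not_true, and_false]
        rw [max_eq_right (by linarith), max_eq_right (by linarith)]
        ring
      · simp [hψ, hu, hv]
    · simp [hA]
  rw [e1, e2]
  nlinarith [mul_le_mul_of_nonneg_left hcut hwpos.le]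

/-- The Dirichlet form, each edge being counted in both directions. -/
def dirichlet (g : V → ℝ) : ℝ := ∑ u, ∑ v, if G.Adj u v then (g u - g v) ^ 2 else 0

theorem sum_sum_adj_left {V : Type*} [Fintype V] (G : SimpleGraph V) [DecidableRel G.Adj]
    (g : V → ℝ) :
    ∑ u, ∑ v, (if G.Adj u v then g u else 0) = ∑ u, (G.degree u : ℝ) * g u := by
  refine sum_congr rfl fun u _ => ?_
  rw [← sum_filter, sum_const, nsmul_eq_mul]
  congr 2
  rw [← SimpleGraph.card_neighborFinset_eq_degree]
  congr 1
  ext v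
  simp

theorem sum_sum_adj_right {V : Type*} [Fintype V] (G : SimpleGraph V) [DecidableRel G.Adj]
    (g : V → ℝ) :
    ∑ u, ∑ v, (if G.Adj u v then g v else 0) = ∑ u, (G.degree u : ℝ) * g u := by
  rw [sum_comm, ← sum_sum_adj_left]
  simp_rw [G.adj_comm]

theorem dirichlet_eq (g : V → ℝ) :
    dirichlet G g = 2 * (g ⬝ᵥ (Matrix.mulVec (G.lapMatrix ℝ) g)) := by
  have h := SimpleGraph.lapMatrix_toLinearMap₂' ℝ G g
  rw [Matrix.toLinearMap₂'_apply'] at h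
  rw [h, dirichlet]
  ring

/-- Cauchy–Schwarz applied to `|g u ^ 2 - g v ^ 2| = |g u - g v| * (g u + g v)` over all ordered
adjacent pairs. The left side is then `(2 * ascent)²`, and `(g u + g v)² ≤ 2 g u ² + 2 g v ²` makes
the second factor at most four times the degree sum, so the constants cancel. -/
theorem ascent_sq_le (g : V → ℝ) (hg : ∀ v, 0 ≤ g v) :
    ascent G (fun v => g v ^ 2) ^ 2 ≤
      dirichlet G g * ∑ v, (G.degree v : ℝ) * g v ^ 2 := by
  have hsym : 2 * ascent G (fun v => g v ^ 2) =
      ∑ u, ∑ v, if G.Adj u v then |g u ^ 2 - g v ^ 2| else 0 := by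
    have : ascent G (fun v => g v ^ 2) =
        ∑ u, ∑ v, if G.Adj u v then max (g v ^ 2 - g u ^ 2) 0 else 0 := by
      rw [ascent, sum_comm]
      simp_rw [G.adj_comm]
    rw [two_mul]
    nth_rewrite 2 [this]
    rw [ascent, ← sum_add_distrib]
    refine sum_congr rfl fun u _ => ?_
    rw [← sum_add_distrib]
    refine sum_congr rfl fun v _ => ?_
    by_cases hA : G.Adj u v
    · simp only [hA, if_true]
      rcases le_total (g u ^ 2) (g v ^ 2) with h | h
      · rw [max_eq_right (by linarith), max_eq_left (by linarith), abs_of_nonpos (by linarith)]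
        ring
      · rw [max_eq_left (by linarith), max_eq_right (by linarith), abs_of_nonneg (by linarith)]
        ring
    · simp [hA]
  have hcs := sum_mul_sq_le_sq_mul_sq (univ : Finset (V × V))
    (fun p => if G.Adj p.1 p.2 then |g p.1 - g p.2| else 0)
    (fun p => if G.Adj p.1 p.2 then g p.1 + g p.2 else 0)
  have e0 : ∑ p : V × V, (if G.Adj p.1 p.2 then |g p.1 - g p.2| else 0) *
      (if G.Adj p.1 p.2 then g p.1 + g p.2 else 0) = 2 * ascent G (fun v => g v ^ 2) := by
    rw [hsym, ← univ_product_univ, sum_product]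
    refine sum_congr rfl fun u _ => sum_congr rfl fun v _ => ?_
    by_cases hA : G.Adj u v
    · simp only [hA, if_true]
      have : g u ^ 2 - g v ^ 2 = (g u - g v) * (g u + g v) := by ring
      rw [this, abs_mul, abs_of_nonneg (add_nonneg (hg u) (hg v))]
    · simp [hA]
  have e1 : ∑ p : V × V, (if G.Adj p.1 p.2 then |g p.1 - g p.2| else 0) ^ 2 = dirichlet G g := by
    rw [dirichlet, ← univ_product_univ, sum_product]
    refine sum_congr rfl fun u _ => sum_congr rfl fun v _ => ?_
    by_cases hA : G.Adj u v <;> simp [hA]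
  have e2 : ∑ p : V × V, (if G.Adj p.1 p.2 then g p.1 + g p.2 else 0) ^ 2
      ≤ 4 * ∑ v, (G.degree v : ℝ) * g v ^ 2 := by
    have a1 := sum_sum_adj_left G (fun v => g v ^ 2)
    have a2 := sum_sum_adj_right G (fun v => g v ^ 2)
    have : 4 * ∑ v, (G.degree v : ℝ) * g v ^ 2 =
        ∑ u, ∑ v, (2 * (if G.Adj u v then g u ^ 2 else 0) +
          2 * (if G.Adj u v then g v ^ 2 else 0)) := by
      simp_rw [sum_add_distrib, ← mul_sum]
      rw [a1, a2]
      ring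
    rw [this, ← univ_product_univ, sum_product]
    refine sum_le_sum fun u _ => sum_le_sum fun v _ => ?_
    by_cases hA : G.Adj u v
    · simp only [hA, if_true]
      nlinarith [sq_nonneg (g u - g v)]
    · simp [hA]
  rw [e0, e1] at hcs
  have hd : 0 ≤ dirichlet G g := by
    rw [← e1]
    exact sum_nonneg fun _ _ => sq_nonneg _
  nlinarith [mul_le_mul_of_nonneg_left e2 hd]

/-- Cheeger's inequality for a nonnegative function supported on at most half of the volume. -/
theorem cheeger_half {h : ℝ} (hh : 0 < h) (hc : ENNReal.ofReal h ≤ conductance G)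
    (g : V → ℝ) (hg : ∀ v, 0 ≤ g v)
    (hS : vol G (univ.filter fun v => 0 < g v) ≤ vol G (univ.filter fun v => 0 < g v)ᶜ) :
    h ^ 2 * ∑ v, (G.degree v : ℝ) * g v ^ 2 ≤ dirichlet G g := by
  set A := ∑ v, (G.degree v : ℝ) * g v ^ 2 with hA
  have hfil : (univ.filter fun v => 0 < g v ^ 2) = univ.filter fun v => 0 < g v := by
    ext v
    simp only [mem_filter, mem_univ, true_and]
    constructor
    · intro hv
      rcases (hg v).lt_or_eq with h | h
      · exact h
      · simp [← h] at hv
    · exact fun hv => by positivity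
  have h1 := mul_sum_degree_le_ascent G hc (fun v => g v ^ 2) (fun v => sq_nonneg _)
    (by rw [hfil]; exact hS)
  have h2 := ascent_sq_le G g hg
  have hA0 : 0 ≤ A := sum_nonneg fun v _ => by positivity
  have hD0 : 0 ≤ dirichlet G g := sum_nonneg fun u _ => sum_nonneg fun v _ => by
    split_ifs <;> positivity
  -- The coarea bound and `ascent_sq_le` give `(h * A)² ≤ dirichlet G g * A`; a positive `A`
  -- cancels, and for `A = 0` nonnegativity of the form suffices.
  rcases hA0.lt_or_eq with hpos | h0
  · have h3 : (h * A) ^ 2 ≤ dirichlet G g * A :=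
      (pow_le_pow_left₀ (by positivity) h1 2).trans h2
    have : (h ^ 2 * A) * A ≤ dirichlet G g * A := by nlinarith
    exact le_of_mul_le_mul_right this hpos
  · rw [← h0]
    simpa using hD0

/-- A median with respect to the volume. -/
theorem exists_median [Nonempty V] (z : V → ℝ) :
    ∃ c : ℝ, vol G (univ.filter fun v => c < z v) ≤ vol G (univ.filter fun v => c < z v)ᶜ ∧
      vol G (univ.filter fun v => z v < c) ≤ vol G (univ.filter fun v => z v < c)ᶜ := by
  classical
  -- The median is the least value of `z` above which lies at most half of the volume; the largest
  -- value shows that there is one.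
  let good : Finset V := univ.filter fun w =>
    vol G (univ.filter fun v => z w < z v) ≤ vol G (univ.filter fun v => z w < z v)ᶜ
  have hne : good.Nonempty := by
    obtain ⟨w, -, hw⟩ := exists_max_image (univ : Finset V) z univ_nonempty
    refine ⟨w, ?_⟩
    simp only [good, mem_filter, mem_univ, true_and]
    have : (univ.filter fun v => z w < z v) = ∅ := by
      ext v; simpa using hw v (mem_univ v)
    rw [this]
    simp [vol]
  obtain ⟨w, hwg, hw⟩ := exists_min_image good z hne
  refine ⟨z w, (mem_filter.1 hwg).2, ?_⟩
  rcases (univ.filter fun v => z v < z w).eq_empty_or_nonempty with hE | hN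
  · rw [hE]; simp [vol]
  obtain ⟨p, hp, hpm⟩ := exists_max_image _ z hN
  simp only [mem_filter, mem_univ, true_and] at hp hpm
  -- The greatest value below the median fails the criterion by minimality. What lies above it is
  -- exactly the complement of what lies below the median, so the latter carries less than half of
  -- the volume.
  have hpg : p ∉ good := fun h => absurd (hw p h) (not_le.2 hp)
  simp only [good, mem_filter, mem_univ, true_and, not_le] at hpg
  have hset : (univ.filter fun v => z p < z v)ᶜ = univ.filter fun v => z v < z w := by
    ext v
    simp only [mem_compl, mem_filter, mem_univ, true_and, not_lt]
    exact ⟨fun h => h.trans_lt hp, fun h => hpm v h⟩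
  rw [hset] at hpg
  rw [← hset, compl_compl, hset]
  exact hpg.le

/-- Cheeger's inequality. -/
theorem cheeger [Nonempty V] {h : ℝ} (hh : 0 < h) (hc : ENNReal.ofReal h ≤ conductance G)
    (z : V → ℝ) :
    ∃ c : ℝ, h ^ 2 * ∑ v, (G.degree v : ℝ) * (z v - c) ^ 2 ≤
      2 * (z ⬝ᵥ (Matrix.mulVec (G.lapMatrix ℝ) z)) := by
  obtain ⟨c, h1, h2⟩ := exists_median G z
  refine ⟨c, ?_⟩
  have k1 := cheeger_half G hh hc (fun v => max (z v - c) 0) (fun v => le_max_right _ _)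
    (by simpa using h1)
  have k2 := cheeger_half G hh hc (fun v => max (c - z v) 0) (fun v => le_max_right _ _)
    (by simpa using h2)
  rw [← dirichlet_eq]
  have e1 : ∑ v, (G.degree v : ℝ) * (z v - c) ^ 2 =
      ∑ v, (G.degree v : ℝ) * max (z v - c) 0 ^ 2 + ∑ v, (G.degree v : ℝ) * max (c - z v) 0 ^ 2 := by
    rw [← sum_add_distrib]
    refine sum_congr rfl fun v _ => ?_
    rcases le_total (z v) c with h | h
    · rw [max_eq_right (by linarith), max_eq_left (by linarith)]; ring
    · rw [max_eq_left (by linarith), max_eq_right (by linarith)]; ring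
  -- Edges on one side of `c` contribute equally to both sides. An edge across `c` has difference `p
  -- + q` with `p, q ≥ 0`, and `p² + q² ≤ (p + q)²`.
  have e2 : dirichlet G (fun v => max (z v - c) 0) + dirichlet G (fun v => max (c - z v) 0)
      ≤ dirichlet G z := by
    simp only [dirichlet]
    rw [← sum_add_distrib]
    refine sum_le_sum fun u _ => ?_
    rw [← sum_add_distrib]
    refine sum_le_sum fun v _ => ?_
    by_cases hA : G.Adj u v
    · simp only [hA, if_true]
      rcases le_total (z u) c with hu | hu <;> rcases le_total (z v) c with hv | hv
      · rw [max_eq_right (sub_nonpos.2 hu), max_eq_right (sub_nonpos.2 hv),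
          max_eq_left (sub_nonneg.2 hu), max_eq_left (sub_nonneg.2 hv)]
        nlinarith
      · rw [max_eq_right (sub_nonpos.2 hu), max_eq_left (sub_nonneg.2 hv),
          max_eq_left (sub_nonneg.2 hu), max_eq_right (sub_nonpos.2 hv)]
        nlinarith [mul_nonneg (sub_nonneg.2 hu) (sub_nonneg.2 hv)]
      · rw [max_eq_left (sub_nonneg.2 hu), max_eq_right (sub_nonpos.2 hv),
          max_eq_right (sub_nonpos.2 hu), max_eq_left (sub_nonneg.2 hv)]
        nlinarith [mul_nonneg (sub_nonneg.2 hu) (sub_nonneg.2 hv)]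
      · rw [max_eq_left (sub_nonneg.2 hu), max_eq_left (sub_nonneg.2 hv),
          max_eq_right (sub_nonpos.2 hu), max_eq_right (sub_nonpos.2 hv)]
        nlinarith
    · simp [hA]
  rw [e1, mul_add]
  linarith

end Cheeger

end ExpanderSketch

namespace ExpanderSketch
open Finset

/-! ### Mean and variance of the evaluation of a random sketch -/

section Moments

open MeasureTheory ProbabilityTheory

variable {n : ℕ} (H : SimpleGraph (Fin n)) [DecidableRel H.Adj] (a : ℕ)

/-- The query vector, shifted so that its degree-weighted mean vanishes. -/
noncomputable def centered (x : Fin n → ℝ) (u : Fin n) : ℝ :=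
  x u - (∑ v, (H.degree v : ℝ) * x v) / ∑ v, (H.degree v : ℝ)

/-- The part of the evaluation that does not depend on the draws. -/
noncomputable def exactPart (y : Fin n → ℝ) : ℝ :=
  (∑ u, y u ^ 2 * (H.degree u : ℝ)) -
    ∑ u, ∑ v, if H.Adj u v ∧ (H.degree u ≤ a ∨ H.degree v ≤ a) then y u * y v else 0

/-- The vertices that draw. -/
abbrev Drawer : Type := {u : Fin n // u ∈ highSet H a ∧ (highNbrs H a u).Nonempty}

instance drawerNbrsNonempty (u : Drawer H a) : Nonempty {v : Fin n // v ∈ highNbrs H a u} :=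
  ⟨⟨u.2.2.choose, u.2.2.choose_spec⟩⟩

theorem mem_lowSet {u : Fin n} : u ∈ lowSet H a ↔ H.degree u ≤ a := by simp [lowSet]

theorem mem_highSet {u : Fin n} : u ∈ highSet H a ↔ a < H.degree u := by
  simp [highSet, mem_lowSet]

theorem mem_highNbrs {u v : Fin n} : v ∈ highNbrs H a u ↔ a < H.degree v ∧ H.Adj u v := by
  simp [highNbrs, mem_highSet]

theorem mem_sketchOf_edges (ω : Draws H a) (u v : Fin n) :
    s(u, v) ∈ (sketchOf H a ω).edges ↔ H.Adj u v ∧ (H.degree u ≤ a ∨ H.degree v ≤ a) := by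
  simp only [sketchOf, mem_filter, SimpleGraph.mem_edgeFinset, SimpleGraph.mem_edgeSet,
    mem_lowSet, Sym2.mem_iff]
  refine and_congr_right fun _ => ?_
  constructor
  · rintro ⟨w, hw, rfl | rfl⟩
    · exact Or.inl hw
    · exact Or.inr hw
  · rintro (h | h)
    · exact ⟨u, h, Or.inl rfl⟩
    · exact ⟨v, h, Or.inr rfl⟩

theorem sum_mul_count_map {ι κ : Type*} [Fintype ι] [DecidableEq κ] (φ : ι → κ) (s : Finset κ)
    (hs : ∀ i, φ i ∈ s) (g : κ → ℝ) :
    ∑ v ∈ s, g v * (((univ : Finset ι).val.map φ).count v : ℝ) = ∑ i, g (φ i) := by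
  have h1 : ∀ v, (((univ : Finset ι).val.map φ).count v : ℝ) = ∑ i, if v = φ i then 1 else 0 := by
    intro v
    rw [Multiset.count_map, ← Finset.filter_val, Finset.card_val, Finset.card_filter]
    push_cast
    rfl
  simp_rw [h1, mul_sum]
  rw [sum_comm]
  refine sum_congr rfl fun i _ => ?_
  simp [hs i]

theorem sum_drawer' (F : Fin n → ℝ) :
    ∑ u : Drawer H a, F u = ∑ u ∈ (highSet H a).filter fun u => (highNbrs H a u).Nonempty, F u := by
  rw [← Finset.sum_subtype_of_mem (p := fun u => u ∈ highSet H a ∧ (highNbrs H a u).Nonempty)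
    (s := (highSet H a).filter fun u => (highNbrs H a u).Nonempty) _
    (fun u hu => by simpa using hu)]
  rw [show (Finset.subtype (fun u => u ∈ highSet H a ∧ (highNbrs H a u).Nonempty)
    ((highSet H a).filter fun u => (highNbrs H a u).Nonempty)) = univ by
      ext u; simpa using u.2]

/-- A high vertex without high neighbours draws nothing, and its term vanishes as well. -/
theorem sum_drawer (F : Fin n → ℝ) (hF : ∀ u, ¬ (highNbrs H a u).Nonempty → F u = 0) :
    ∑ u : Drawer H a, F u = ∑ u ∈ highSet H a, F u := by
  rw [sum_drawer', sum_filter_of_ne fun u _ hne => by_contra fun h => hne (hF u h)]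

/-- Counting multiplicities of samples amounts to summing over the individual draws. This separates
a deterministic part from a sum of independent variables, the form in which both moments are
computed and in which the output of the machine is recognized. -/
theorem expanderEval_sketchOf (ω : Draws H a) (x : Fin n → ℝ) :
    expanderEval (sketchOf H a ω) x = exactPart H a (centered H x) -
      ∑ u : Drawer H a, ∑ j, ((highNbrs H a u).card : ℝ) / a *
        (centered H x u * centered H x (ω u j)) := by
  set y := centered H x with hy
  -- The two exact sums, over `S` with all neighbours and over `L` with neighbours in `S`, split the
  -- ordered adjacent pairs with a low end according to the first vertex.
  have hsum : ∑ u, ∑ v, (if H.Adj u v ∧ (H.degree u ≤ a ∨ H.degree v ≤ a) then y u * y v else 0)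
      = (∑ u ∈ lowSet H a, ∑ v ∈ univ.filter (fun v => s(u, v) ∈ (sketchOf H a ω).edges),
          y u * y v) +
        ∑ u ∈ highSet H a, ∑ v ∈ (lowSet H a).filter
          (fun v => s(u, v) ∈ (sketchOf H a ω).edges), y u * y v := by
    rw [← sum_add_sum_compl (lowSet H a)]
    congr 1
    · refine sum_congr rfl fun u _ => ?_
      rw [sum_filter]
      simp_rw [mem_sketchOf_edges]
    · rw [show (lowSet H a)ᶜ = highSet H a from rfl]
      refine sum_congr rfl fun u hu => ?_
      rw [lowSet, filter_filter, sum_filter]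
      refine sum_congr rfl fun v _ => ?_
      rw [mem_highSet] at hu
      simp_rw [mem_sketchOf_edges]
      congr 1
      rw [eq_iff_iff]
      constructor
      · rintro ⟨h1, h2 | h2⟩
        · omega
        · exact ⟨h2, h1, Or.inr h2⟩
      · rintro ⟨h1, h2, -⟩
        exact ⟨h2, Or.inr h1⟩
  have hlast : ∑ u ∈ highSet H a, ((sketchOf H a ω).degL u : ℝ) / a *
        ∑ v ∈ highSet H a, y u * y v * (((sketchOf H a ω).samples u).count v : ℝ) =
      ∑ u : Drawer H a, ∑ j, ((highNbrs H a u).card : ℝ) / a * (y u * y (ω u j)) := by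
    rw [← sum_drawer]
    swap
    · intro u hne
      rw [not_nonempty_iff_eq_empty] at hne
      simp [sketchOf, hne]
    refine sum_congr rfl fun u _ => ?_
    have hs : (sketchOf H a ω).samples u =
        (univ : Finset (Fin a)).val.map fun j => (ω u j : Fin n) := by
      simp only [sketchOf]
      rw [dif_pos u.2]
    have hd : (sketchOf H a ω).degL u = (highNbrs H a u).card := by
      simp only [sketchOf]
      rw [if_pos u.2.1]
    rw [hs, hd, sum_mul_count_map (fun j => (ω u j : Fin n)) _ _ (fun v => y u * y v), mul_sum]
    intro j
    have := (mem_highNbrs H a).1 (ω u j).2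
    exact (mem_highSet H a).2 this.1
  rw [exactPart, hsum, ← hlast]
  simp only [expanderEval, ← sub_sub]
  rfl

/-- The source of independence: on a finite product, the uniform law and the product of the uniform
laws give every point the same mass. -/
theorem toMeasure_uniformOfFintype_pi {ι : Type*} [Fintype ι] [DecidableEq ι] {X : ι → Type*}
    [∀ i, Fintype (X i)] [∀ i, Nonempty (X i)] [∀ i, MeasurableSpace (X i)]
    [∀ i, MeasurableSingletonClass (X i)] :
    (PMF.uniformOfFintype (∀ i, X i)).toMeasure =
      Measure.pi fun i => (PMF.uniformOfFintype (X i)).toMeasure := by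
  rw [Measure.ext_iff_singleton]
  intro f
  rw [Measure.pi_singleton, PMF.toMeasure_apply_singleton _ _ (measurableSet_singleton f)]
  simp_rw [PMF.toMeasure_apply_singleton _ _ (measurableSet_singleton _),
    PMF.uniformOfFintype_apply, Fintype.card_pi]
  rw [Nat.cast_prod, ENNReal.prod_inv_distrib]
  · intro i _ j _ _
    exact Or.inl (by simp)

/-- The law of the draws. -/
noncomputable def drawsMeasure : Measure (Draws H a) :=
  (PMF.uniformOfFintype (Draws H a)).toMeasure

instance : IsProbabilityMeasure (drawsMeasure H a) := by
  unfold drawsMeasure; infer_instance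

theorem drawsMeasure_eq_pi : drawsMeasure H a =
    Measure.pi fun u : Drawer H a => Measure.pi fun _ : Fin a =>
      (PMF.uniformOfFintype {v : Fin n // v ∈ highNbrs H a u}).toMeasure := by
  rw [drawsMeasure]
  simp_rw [← toMeasure_uniformOfFintype_pi]

theorem integral_draw (u : Drawer H a) (j : Fin a) (g : {v : Fin n // v ∈ highNbrs H a u} → ℝ) :
    ∫ ω, g (ω u j) ∂(drawsMeasure H a) = ((highNbrs H a u).card : ℝ)⁻¹ * ∑ v, g v := by
  rw [drawsMeasure_eq_pi]
  refine (integral_comp_eval (X := fun u : Drawer H a => Fin a → {v : Fin n // v ∈ highNbrs H a u})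
    (i := u) (f := fun w : Fin a → _ => g (w j))
    (MemLp.of_discrete (p := 1)).1).trans ?_
  refine (integral_comp_eval (X := fun _ : Fin a => {v : Fin n // v ∈ highNbrs H a u})
    (i := j) (f := g) (MemLp.of_discrete (p := 1)).1).trans ?_
  rw [PMF.integral_eq_sum]
  simp [PMF.uniformOfFintype_apply, mul_sum]

/-- Variances add over independent coordinates, first over the drawing vertices and then over the
draws of each; a single variance is at most the second moment. -/
theorem variance_draws_le (g : (u : Drawer H a) → {v : Fin n // v ∈ highNbrs H a u} → ℝ) :
    Var[fun ω => ∑ u, ∑ j, g u (ω u j); drawsMeasure H a] ≤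
      ∑ u : Drawer H a, (a : ℝ) * (((highNbrs H a u).card : ℝ)⁻¹ * ∑ v, g u v ^ 2) := by
  rw [drawsMeasure_eq_pi]
  have e : (fun ω : Draws H a => ∑ u, ∑ j, g u (ω u j)) =
      ∑ u, fun ω : Draws H a => (∑ j, fun w : Fin a → _ => g u (w j)) (ω u) := by
    ext ω
    simp
  rw [e, variance_sum_pi (X := fun u => ∑ j, fun w : Fin a → _ => g u (w j))
    fun _ => MemLp.of_discrete]
  refine sum_le_sum fun u _ => ?_
  rw [variance_sum_pi (X := fun _ : Fin a => g u) fun _ => MemLp.of_discrete, sum_const,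
    card_univ, Fintype.card_fin, nsmul_eq_mul]
  gcongr
  refine (variance_le_expectation_sq (MemLp.of_discrete (p := 1)).1).trans_eq ?_
  rw [PMF.integral_eq_sum]
  simp [PMF.uniformOfFintype_apply, mul_sum]

theorem quadForm_eq (x : Fin n → ℝ) :
    x ⬝ᵥ (Matrix.mulVec (H.lapMatrix ℝ) x) =
      (∑ u, x u ^ 2 * (H.degree u : ℝ)) - ∑ u, ∑ v, if H.Adj u v then x u * x v else 0 := by
  simp only [dotProduct, SimpleGraph.lapMatrix_mulVec_apply]
  rw [← sum_sub_distrib]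
  refine sum_congr rfl fun u _ => ?_
  rw [← sum_filter, mul_sub, mul_sum]
  congr 1
  · ring
  · refine sum_congr ?_ fun _ _ => rfl
    ext v
    simp

/-- The form depends only on differences along edges, which a shift by a constant does not change.
-/
theorem quadForm_centered (x : Fin n → ℝ) :
    centered H x ⬝ᵥ (Matrix.mulVec (H.lapMatrix ℝ) (centered H x)) =
      x ⬝ᵥ (Matrix.mulVec (H.lapMatrix ℝ) x) := by
  have h : dirichlet H (centered H x) = dirichlet H x := by simp [dirichlet, centered]
  rw [dirichlet_eq, dirichlet_eq] at h
  linarith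

theorem integral_expanderEval (ha : 1 ≤ a) (x : Fin n → ℝ) :
    ∫ ω, expanderEval (sketchOf H a ω) x ∂(drawsMeasure H a) =
      x ⬝ᵥ (Matrix.mulVec (H.lapMatrix ℝ) x) := by
  have ha' : (a : ℝ) ≠ 0 := by positivity
  simp_rw [expanderEval_sketchOf]
  set y := centered H x with hy
  rw [integral_sub (integrable_const _) ((MemLp.of_discrete (p := 1)).integrable le_rfl),
    integral_finsetSum _ fun _ _ => (MemLp.of_discrete (p := 1)).integrable le_rfl]
  simp_rw [integral_finsetSum _ fun (_ : Fin a) _ =>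
    (MemLp.of_discrete (p := 1) (μ := drawsMeasure H a)).integrable le_rfl]
  have h1 : ∀ u : Drawer H a, ∀ j : Fin a,
      ∫ ω, ((highNbrs H a u).card : ℝ) / a * (y u * y (ω u j)) ∂(drawsMeasure H a) =
        (1 / a) * ∑ v ∈ highNbrs H a u, y u * y v := by
    intro u j
    have := integral_draw H a u j (fun v => ((highNbrs H a u).card : ℝ) / a * (y u * y v))
    rw [this, ← mul_sum, ← Finset.sum_coe_sort (highNbrs H a u) fun v => y u * y v]
    have hc : ((highNbrs H a u).card : ℝ) ≠ 0 := by
      have := Finset.card_pos.2 u.2.2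
      positivity
    field_simp
  simp_rw [h1]
  simp only [sum_const, card_univ, Fintype.card_fin, nsmul_eq_mul, integral_const,
    probReal_univ, one_smul]
  simp_rw [← mul_assoc, mul_one_div_cancel ha', one_mul]
  -- The expected contributions run over the ordered adjacent pairs with both ends high, precisely
  -- those that `exactPart` omits.
  have h2 : ∑ u : Drawer H a, ∑ v ∈ highNbrs H a u, y u * y v =
      ∑ u, ∑ v, if H.Adj u v ∧ ¬ (H.degree u ≤ a ∨ H.degree v ≤ a) then y u * y v else 0 := by
    rw [sum_drawer H a fun u => ∑ v ∈ highNbrs H a u, y u * y v]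
    · rw [← sum_subset (subset_univ (highSet H a))]
      · refine sum_congr rfl fun u hu => ?_
        rw [mem_highSet] at hu
        rw [← sum_filter]
        refine sum_congr ?_ fun _ _ => rfl
        ext v
        simp [mem_highNbrs, hu, and_comm]
      · intro u _ hu
        rw [mem_highSet, not_lt] at hu
        simp [hu]
    · intro u hne
      rw [not_nonempty_iff_eq_empty] at hne
      simp [hne]
  rw [h2, exactPart, sub_sub, ← sum_add_distrib]
  rw [← quadForm_centered, quadForm_eq]
  congr 1
  refine sum_congr rfl fun u _ => ?_
  rw [← sum_add_distrib]
  refine sum_congr rfl fun v _ => ?_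
  by_cases hA : H.Adj u v <;> by_cases hB : H.degree u ≤ a ∨ H.degree v ≤ a <;>
    simp [hA, hB, hy]

/-- The weighted mean minimizes the weighted second moment. It lets the shift computed from `H`
alone compete with the unknown median that Cheeger's inequality provides in the ambient graph. -/
theorem sum_degree_centered_le (x : Fin n → ℝ) (c : ℝ) :
    ∑ u, (H.degree u : ℝ) * centered H x u ^ 2 ≤ ∑ u, (H.degree u : ℝ) * (x u - c) ^ 2 := by
  set m := (∑ v, (H.degree v : ℝ) * x v) / ∑ v, (H.degree v : ℝ) with hm
  set D := ∑ v, (H.degree v : ℝ) with hD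
  have hD0 : 0 ≤ D := sum_nonneg fun _ _ => by positivity
  have hz : ∑ u, (H.degree u : ℝ) * centered H x u = 0 := by
    simp only [centered, mul_sub, sum_sub_distrib, ← sum_mul, ← hm, ← hD]
    rcases hD0.lt_or_eq with h | h
    · rw [hm]
      field_simp
      ring
    -- Without edges the quotient in `centered` is not a mean, but all the weights are zero.
    · have h0 : ∀ u, (H.degree u : ℝ) = 0 := fun u =>
        (sum_eq_zero_iff_of_nonneg (fun _ _ => by positivity)).1 (hD ▸ h.symm) u (mem_univ u)
      simp [h0, ← h]
  have e : ∑ u, (H.degree u : ℝ) * (x u - c) ^ 2 =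
      ∑ u, (H.degree u : ℝ) * centered H x u ^ 2 +
        2 * (m - c) * ∑ u, (H.degree u : ℝ) * centered H x u + (m - c) ^ 2 * D := by
    rw [mul_sum, hD, mul_sum, ← sum_add_distrib, ← sum_add_distrib]
    refine sum_congr rfl fun u _ => ?_
    simp only [centered, ← hD, ← hm]
    ring
  rw [e, hz]
  nlinarith [mul_nonneg (sq_nonneg (m - c)) hD0]

/-- The threshold matters here: sampled neighbours have degree above `a`, so their `y v ^ 2` sum to
at most `Z / a`. One factor `1 / a` comes from this, the other from averaging over `a` draws. -/
theorem variance_expanderEval_le (ha : 1 ≤ a) (x : Fin n → ℝ) :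
    Var[fun ω => expanderEval (sketchOf H a ω) x; drawsMeasure H a] ≤
      ((a : ℝ) ^ 2)⁻¹ * (∑ u, (H.degree u : ℝ) * centered H x u ^ 2) ^ 2 := by
  have ha' : (0 : ℝ) < a := by positivity
  simp_rw [expanderEval_sketchOf]
  set y := centered H x with hy
  rw [variance_const_sub (MemLp.of_discrete (p := 1)).1]
  refine (variance_draws_le H a fun u v =>
    ((highNbrs H a u).card : ℝ) / a * (y u * y v)).trans ?_
  set Z := ∑ u, (H.degree u : ℝ) * y u ^ 2 with hZ
  have hnb : ∀ u : Fin n, (a : ℝ) * ∑ v ∈ highNbrs H a u, y v ^ 2 ≤ Z := by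
    intro u
    rw [hZ, mul_sum]
    refine (sum_le_sum (g := fun v => (H.degree v : ℝ) * y v ^ 2) fun v hv => ?_).trans
      (sum_le_sum_of_subset_of_nonneg (subset_univ _) fun _ _ _ => by positivity)
    have := ((mem_highNbrs H a).1 hv).1
    gcongr
  have hZ0 : 0 ≤ Z := sum_nonneg fun _ _ => by positivity
  clear_value Z y
  have hterm : ∀ u : Drawer H a, (a : ℝ) * (((highNbrs H a u).card : ℝ)⁻¹ *
      ∑ v : {v // v ∈ highNbrs H a u}, (((highNbrs H a u).card : ℝ) / a * (y u * y v)) ^ 2) ≤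
      ((a : ℝ) ^ 2)⁻¹ * Z * ((H.degree u : ℝ) * y u ^ 2) := by
    intro u
    have hc : (0 : ℝ) < ((highNbrs H a u).card : ℝ) := by
      have := Finset.card_pos.2 u.2.2
      positivity
    have hle : ((highNbrs H a u).card : ℝ) ≤ H.degree u := by
      rw [← SimpleGraph.card_neighborFinset_eq_degree]
      exact_mod_cast card_le_card fun v hv => by
        simpa using ((mem_highNbrs H a).1 hv).2
    rw [Finset.sum_coe_sort (highNbrs H a u)
      fun v => (((highNbrs H a u).card : ℝ) / a * (y u * y v)) ^ 2]
    have e : (a : ℝ) * (((highNbrs H a u).card : ℝ)⁻¹ *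
        ∑ v ∈ highNbrs H a u, (((highNbrs H a u).card : ℝ) / a * (y u * y v)) ^ 2) =
        ((a : ℝ) ^ 2)⁻¹ * ((a : ℝ) * ∑ v ∈ highNbrs H a u, y v ^ 2) *
          (((highNbrs H a u).card : ℝ) * y u ^ 2) := by
      have : ∀ v, (((highNbrs H a u).card : ℝ) / a * (y u * y v)) ^ 2 =
          (((highNbrs H a u).card : ℝ) / a * y u) ^ 2 * y v ^ 2 := fun v => by ring
      simp_rw [this, ← mul_sum]
      field_simp
    rw [e]
    exact mul_le_mul (mul_le_mul_of_nonneg_left (hnb u) (by positivity))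
      (mul_le_mul_of_nonneg_right hle (by positivity)) (by positivity) (by positivity)
  refine (sum_le_sum fun u _ => hterm u).trans ?_
  have hsub : ∑ u : Drawer H a, (H.degree u : ℝ) * y u ^ 2 ≤ Z := by
    rw [sum_drawer' H a fun u => (H.degree u : ℝ) * y u ^ 2, hZ]
    exact sum_le_sum_of_subset_of_nonneg (subset_univ _) fun _ _ _ => by positivity
  rw [← mul_sum, sq Z, ← mul_assoc]
  exact mul_le_mul_of_nonneg_left hsub (by positivity)

/-- The law of the evaluation at a query vector. -/
theorem toMeasure_map_expanderEval (x : Fin n → ℝ) :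
    (((sampleSketch H a).map expanderEval).map fun f => f x).toMeasure =
      (drawsMeasure H a).map fun ω => expanderEval (sketchOf H a ω) x := by
  rw [sampleSketch, PMF.map_comp, PMF.map_comp, drawsMeasure, PMF.toMeasure_map _ _ .of_discrete]
  rfl

theorem memLp_expanderEval (x : Fin n → ℝ) :
    MemLp (fun r : ℝ => r) 2
      (((sampleSketch H a).map expanderEval).map fun f => f x).toMeasure := by
  rw [toMeasure_map_expanderEval, memLp_map_measure_iff (g := fun r : ℝ => r) measurable_id.aestronglyMeasurable
    (Measurable.of_discrete).aemeasurable]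
  exact MemLp.of_discrete

theorem mean_expanderEval (ha : 1 ≤ a) (x : Fin n → ℝ) :
    ∫ r, r ∂(((sampleSketch H a).map expanderEval).map fun f => f x).toMeasure =
      x ⬝ᵥ (Matrix.mulVec (H.lapMatrix ℝ) x) := by
  rw [toMeasure_map_expanderEval, integral_map (f := fun r : ℝ => r) (Measurable.of_discrete).aemeasurable
    measurable_id.aestronglyMeasurable, integral_expanderEval H a ha]

/-- The variance bound for induced subgraphs of graphs of large conductance. -/
theorem variance_expanderEval_le_of_conductance [NeZero n] {α : ℝ} (hα : 1 ≤ α) (ha : α ≤ a)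
    {n' : ℕ} (T : SimpleGraph (Fin n')) [DecidableRel T.Adj] (φ : H ↪g T)
    {h : ℝ} (hh : 0 < h) (hc : ENNReal.ofReal h ≤ conductance T)
    (x : Fin n → ℝ) (z : Fin n' → ℝ) (hxz : ∀ u, x u = z (φ u)) :
    Var[fun r : ℝ => r; (((sampleSketch H a).map expanderEval).map fun f => f x).toMeasure] ≤
      4 * α ^ (-2 : ℤ) * h ^ (-4 : ℤ) * (z ⬝ᵥ (Matrix.mulVec (T.lapMatrix ℝ) z)) ^ 2 := by
  have ha1 : 1 ≤ a := by exact_mod_cast hα.trans ha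
  have : Nonempty (Fin n') := ⟨φ 0⟩
  rw [toMeasure_map_expanderEval, variance_map (X := fun r : ℝ => r) measurable_id.aemeasurable
    (Measurable.of_discrete).aemeasurable]
  refine (variance_expanderEval_le H a ha1 x).trans ?_
  obtain ⟨c, hcheeger⟩ := cheeger T hh hc z
  set E := z ⬝ᵥ (Matrix.mulVec (T.lapMatrix ℝ) z)
  have hdeg : ∀ u, H.degree u ≤ T.degree (φ u) := by
    intro u
    rw [← SimpleGraph.card_neighborFinset_eq_degree, ← SimpleGraph.card_neighborFinset_eq_degree,
      ← card_map φ.toEmbedding]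
    refine card_le_card fun w hw => ?_
    obtain ⟨v, hv, rfl⟩ := mem_map.1 hw
    simpa using hv
  -- The embedding is injective and does not decrease degrees, so the sum over `H` is dominated by
  -- part of the sum over `T`.
  have h1 : ∑ u, (H.degree u : ℝ) * (x u - c) ^ 2 ≤ ∑ v, (T.degree v : ℝ) * (z v - c) ^ 2 := by
    calc ∑ u, (H.degree u : ℝ) * (x u - c) ^ 2
        ≤ ∑ u, (T.degree (φ u) : ℝ) * (z (φ u) - c) ^ 2 := by
          refine sum_le_sum fun u _ => ?_
          rw [hxz u]
          have := hdeg u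
          gcongr
      _ = ∑ v ∈ univ.map φ.toEmbedding, (T.degree v : ℝ) * (z v - c) ^ 2 := by
          rw [sum_map]; rfl
      _ ≤ _ := sum_le_sum_of_subset_of_nonneg (subset_univ _) fun _ _ _ => by positivity
  have h2 := (sum_degree_centered_le H x c).trans h1
  set Z := ∑ u, (H.degree u : ℝ) * centered H x u ^ 2
  have hZ0 : 0 ≤ Z := sum_nonneg fun _ _ => by positivity
  have h3 : Z ≤ 2 * (h ^ 2)⁻¹ * E := by
    have : h ^ 2 * Z ≤ 2 * E := (mul_le_mul_of_nonneg_left h2 (by positivity)).trans hcheeger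
    rw [mul_right_comm, ← div_eq_mul_inv, le_div_iff₀ (by positivity)]
    linarith
  have h4 : Z ^ 2 ≤ (2 * (h ^ 2)⁻¹ * E) ^ 2 := by gcongr
  have h5 : ((a : ℝ) ^ 2)⁻¹ ≤ (α ^ 2)⁻¹ := by gcongr
  calc ((a : ℝ) ^ 2)⁻¹ * Z ^ 2 ≤ (α ^ 2)⁻¹ * (2 * (h ^ 2)⁻¹ * E) ^ 2 := by gcongr
    _ = _ := by
      rw [zpow_neg, zpow_neg]
      norm_cast
      field_simp
      ring

end Moments

end ExpanderSketch

namespace ExpanderSketch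
open Finset

/-! ### Reasoning about programs: deterministic runs, running time, laws of random loops -/

section Machine

/-! ### Deterministic runs -/

/-- Programs that draw no random numbers. -/
def Prog.SampleFree : Prog → Prop
  | .sample _ _ _ => False
  | .seq p q => p.SampleFree ∧ q.SampleFree
  | .ifLe _ _ p q => p.SampleFree ∧ q.SampleFree
  | .loop _ p => p.SampleFree
  | _ => True

/-- The final state of a program that draws no random numbers. -/
noncomputable def Prog.det : Prog → State → State
  | .skip, s => s.tick 1
  | .assign arr idx val, s =>
      (s.write arr (idx.eval s) (val.eval s)).tick
        (idx.cost s + val.cost s + 1 + Nat.size (idx.eval s) + Nat.size (val.eval s))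
  | .rassign arr idx val, s =>
      (s.rwrite arr (idx.eval s) (val.eval s)).tick
        (idx.cost s + val.cost s + 1 + Nat.size (idx.eval s))
  | .sample _ _ _, s => s
  | .seq p q, s => q.det (p.det s)
  | .ifLe e₁ e₂ p q, s =>
      let s' := s.tick (e₁.cost s + e₂.cost s + 1 + Nat.size (e₁.eval s) + Nat.size (e₂.eval s))
      if e₁.eval s ≤ e₂.eval s then p.det s' else q.det s'
  | .loop e p, s =>
      (fun t => p.det (t.tick 1))^[e.eval s] (s.tick (e.cost s + 1 + Nat.size (e.eval s)))

theorem Prog.exec_eq_pure {p : Prog} (hp : p.SampleFree) (s : State) :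
    p.exec s = PMF.pure (p.det s) := by
  induction p generalizing s with
  | skip => rfl
  | assign => rfl
  | rassign => rfl
  | sample => exact hp.elim
  | seq p q ihp ihq => rw [Prog.exec, ihp hp.1, PMF.pure_bind, ihq hp.2, Prog.det]
  | ifLe e₁ e₂ p q ihp ihq =>
    simp only [Prog.exec, Prog.det]
    split_ifs
    · exact ihp hp.1 _
    · exact ihq hp.2 _
  | loop e p ih =>
    simp only [Prog.exec, Prog.det]
    generalize s.tick _ = s₀
    induction e.eval s with
    | zero => rfl
    | succ k ihk =>
      rw [Function.iterate_succ_apply', Function.iterate_succ_apply', ihk, PMF.pure_bind,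
        ih hp]

/-! ### Time bounds for programs without loops -/

/-- All integer cells hold numbers that are at most `W`. -/
def Bdd (W : ℕ) (m : ℕ → ℕ → ℕ) : Prop := ∀ arr i, m arr i ≤ W

theorem Bdd.mono {W W' : ℕ} (h : W ≤ W') {m : ℕ → ℕ → ℕ} (hm : Bdd W m) : Bdd W' m :=
  fun arr i => (hm arr i).trans h

theorem Bdd.write {W : ℕ} {s : State} (hs : Bdd W s.nat) (arr i : ℕ) {v : ℕ} (hv : v ≤ W) :
    Bdd W (s.write arr i v).nat := by
  intro arr' i'
  simp only [State.write, Function.update_apply]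
  split_ifs
  · simp only [Function.update_apply]
    split_ifs
    · exact hv
    · exact hs _ _
  · exact hs _ _

theorem size_mul_le (b W : ℕ) : (b * W).size ≤ b.size + W.size := by
  rw [Nat.size_le, pow_add]
  exact Nat.mul_lt_mul'' (Nat.lt_size_self b) (Nat.lt_size_self W)

/-- In this product form every cost below is a constant of the program text times `W.size + 1`. -/
theorem size_le_of_le_mul {v b W : ℕ} (h : v ≤ b * W) :
    v.size ≤ (b.size + 1) * (W.size + 1) := by
  have h1 := (Nat.size_le_size h).trans (size_mul_le b W)
  nlinarith [Nat.zero_le (b.size * W.size)]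

/-- A factor by which an integer expression can exceed the contents of the cells. -/
def NExpr.bd : NExpr → ℕ
  | const k => k
  | cell _ _ => 1
  | add e₁ e₂ => e₁.bd + e₂.bd
  | sub e₁ _ => e₁.bd

/-- A constant for the evaluation time of an integer expression. -/
def NExpr.kc : NExpr → ℕ
  | const k => 1 + k.size
  | cell _ idx => idx.kc + 1 + (idx.bd.size + 1) + 1
  | add e₁ e₂ => e₁.kc + e₂.kc + 1 + (e₁.bd.size + 1) + (e₂.bd.size + 1)
  | sub e₁ e₂ => e₁.kc + e₂.kc + 1 + (e₁.bd.size + 1) + (e₂.bd.size + 1)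

/-- A constant for the evaluation time of a real expression. -/
def RExpr.kc : RExpr → ℕ
  | cell _ idx => idx.kc + 1 + (idx.bd.size + 1)
  | ofNat e => e.kc + 1 + (e.bd.size + 1)
  | add e₁ e₂ => e₁.kc + e₂.kc + 1
  | sub e₁ e₂ => e₁.kc + e₂.kc + 1
  | mul e₁ e₂ => e₁.kc + e₂.kc + 1
  | div e₁ e₂ => e₁.kc + e₂.kc + 1

theorem NExpr.eval_le (e : NExpr) {W : ℕ} (hW : 1 ≤ W) {s : State} (hs : Bdd W s.nat) :
    e.eval s ≤ e.bd * W := by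
  induction e with
  | const k => exact Nat.le_mul_of_pos_right k hW
  | cell arr idx _ => simpa [NExpr.eval, NExpr.bd] using hs _ _
  | add e₁ e₂ h₁ h₂ => simp only [NExpr.eval, NExpr.bd, add_mul]; omega
  | sub e₁ e₂ h₁ _ => simp only [NExpr.eval, NExpr.bd]; omega

theorem NExpr.size_le (e : NExpr) {W : ℕ} (hW : 1 ≤ W) {s : State} (hs : Bdd W s.nat) :
    (e.eval s).size ≤ (e.bd.size + 1) * (W.size + 1) :=
  size_le_of_le_mul (e.eval_le hW hs)

theorem NExpr.cost_le (e : NExpr) {W : ℕ} (hW : 1 ≤ W) {s : State} (hs : Bdd W s.nat) :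
    e.cost s ≤ e.kc * (W.size + 1) := by
  induction e with
  | const k => exact Nat.le_mul_of_pos_right _ (Nat.succ_pos _)
  | cell arr idx h =>
    have h1 := idx.size_le hW hs
    have h2 := Nat.size_le_size (hs arr (idx.eval s))
    simp only [NExpr.cost, NExpr.kc, add_mul] at *
    omega
  | add e₁ e₂ h₁ h₂ =>
    have h3 := e₁.size_le hW hs
    have h4 := e₂.size_le hW hs
    simp only [NExpr.cost, NExpr.kc, add_mul] at *
    omega
  | sub e₁ e₂ h₁ h₂ =>
    have h3 := e₁.size_le hW hs
    have h4 := e₂.size_le hW hs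
    simp only [NExpr.cost, NExpr.kc, add_mul] at *
    omega

theorem RExpr.cost_le (e : RExpr) {W : ℕ} (hW : 1 ≤ W) {s : State} (hs : Bdd W s.nat) :
    e.cost s ≤ e.kc * (W.size + 1) := by
  induction e with
  | cell arr idx =>
    have h1 := idx.size_le hW hs
    have h2 := idx.cost_le hW hs
    simp only [RExpr.cost, RExpr.kc, add_mul] at *
    omega
  | ofNat e =>
    have h1 := e.size_le hW hs
    have h2 := e.cost_le hW hs
    simp only [RExpr.cost, RExpr.kc, add_mul] at *
    omega
  | add e₁ e₂ h₁ h₂ => simp only [RExpr.cost, RExpr.kc, add_mul] at *; omega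
  | sub e₁ e₂ h₁ h₂ => simp only [RExpr.cost, RExpr.kc, add_mul] at *; omega
  | mul e₁ e₂ h₁ h₂ => simp only [RExpr.cost, RExpr.kc, add_mul] at *; omega
  | div e₁ e₂ h₁ h₂ => simp only [RExpr.cost, RExpr.kc, add_mul] at *; omega

namespace Prog

/-- Programs without loops. -/
def LoopFree : Prog → Prop
  | .seq p q => p.LoopFree ∧ q.LoopFree
  | .ifLe _ _ p q => p.LoopFree ∧ q.LoopFree
  | .loop _ _ => False
  | _ => True

/-- A factor by which a program without loops can enlarge the contents of the cells. -/
def growth : Prog → ℕ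
  | .assign _ _ val => val.bd + 1
  | .sample _ _ bound => bound.bd + 1
  | .seq p q => p.growth * q.growth
  | .ifLe _ _ p q => p.growth + q.growth
  | _ => 1

/-- A constant for the running time of a program without loops. -/
def kt : Prog → ℕ
  | .skip => 1
  | .assign _ idx val => idx.kc + val.kc + 1 + (idx.bd.size + 1) + (val.bd.size + 1)
  | .rassign _ idx val => idx.kc + val.kc + 1 + (idx.bd.size + 1)
  | .sample _ idx bound => idx.kc + bound.kc + 1 + (idx.bd.size + 1) + (bound.bd.size + 1)
  | .seq p q => p.kt + q.kt * (p.growth.size + 1)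
  | .ifLe e₁ e₂ p q => e₁.kc + e₂.kc + 1 + (e₁.bd.size + 1) + (e₂.bd.size + 1) + p.kt + q.kt
  | .loop _ _ => 0

theorem growth_pos (p : Prog) : 1 ≤ p.growth := by
  induction p with
  | seq p q hp hq => exact Nat.mul_pos hp hq
  | ifLe e₁ e₂ p q hp hq => simp only [growth]; omega
  | _ => simp [growth]

theorem le_of_mem_support_uniformBelow {N v : ℕ} (hv : v ∈ (uniformBelow N).support) :
    v ≤ N := by
  rw [uniformBelow] at hv
  split_ifs at hv with h
  · rw [PMF.mem_support_uniformOfFinset_iff, mem_range] at hv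
    exact hv.le
  · simp only [PMF.support_pure, Set.mem_singleton_iff] at hv
    omega

/-- The text of a loop-free program bounds its number of operations, and each write exceeds the
previous maximum by at most a constant factor. Bit lengths therefore grow by additive constants
only, and each operation costs a constant times the initial bit length plus one. The bound holds for
every possible outcome of the draws. -/
theorem exec_bound {p : Prog} (hp : p.LoopFree) {W : ℕ} (hW : 1 ≤ W) {s : State}
    (hs : Bdd W s.nat) {s' : State} (hs' : s' ∈ (p.exec s).support) :
    s'.time ≤ s.time + p.kt * (W.size + 1) ∧ Bdd (p.growth * W) s'.nat := by
  induction p generalizing s s' W with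
  | skip =>
    simp only [exec, PMF.support_pure, Set.mem_singleton_iff] at hs'
    subst hs'
    exact ⟨by simp [State.tick, kt], Bdd.mono (m := s.nat) (by simp [growth]) hs⟩
  | assign arr idx val =>
    simp only [exec, PMF.support_pure, Set.mem_singleton_iff] at hs'
    subst hs'
    have h1 := idx.size_le hW hs
    have h2 := idx.cost_le hW hs
    have h3 := val.size_le hW hs
    have h4 := val.cost_le hW hs
    refine ⟨?_, ?_⟩
    · simp only [State.tick, State.write, kt, add_mul] at *
      omega
    · refine Bdd.write (hs.mono (Nat.le_mul_of_pos_left W (growth_pos _))) arr _ ?_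
      refine (val.eval_le hW hs).trans ?_
      simp only [growth, add_mul]
      omega
  | rassign arr idx val =>
    simp only [exec, PMF.support_pure, Set.mem_singleton_iff] at hs'
    subst hs'
    have h1 := idx.size_le hW hs
    have h2 := idx.cost_le hW hs
    have h4 := val.cost_le hW hs
    refine ⟨?_, Bdd.mono (m := s.nat) (by simp [growth]) hs⟩
    simp only [State.tick, State.rwrite, kt, add_mul] at *
    omega
  | sample arr idx bound =>
    simp only [exec, PMF.support_map, Set.mem_image] at hs'
    obtain ⟨v, hv, rfl⟩ := hs'
    have hv := le_of_mem_support_uniformBelow hv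
    have h1 := idx.size_le hW hs
    have h2 := idx.cost_le hW hs
    have h3 := bound.size_le hW hs
    have h4 := bound.cost_le hW hs
    refine ⟨?_, ?_⟩
    · simp only [State.tick, State.write, kt, add_mul] at *
      omega
    · refine Bdd.write (hs.mono (Nat.le_mul_of_pos_left W (growth_pos _))) arr _ ?_
      refine hv.trans ((bound.eval_le hW hs).trans ?_)
      simp only [growth, add_mul]
      omega
  | seq p q ihp ihq =>
    simp only [exec, PMF.support_bind, Set.mem_iUnion] at hs'
    obtain ⟨t, ht, hs'⟩ := hs'
    obtain ⟨h1, h2⟩ := ihp hp.1 hW hs ht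
    obtain ⟨h3, h4⟩ := ihq hp.2 (Nat.mul_pos (growth_pos p) hW) h2 hs'
    refine ⟨?_, by rw [growth, mul_comm p.growth, mul_assoc]; exact h4⟩
    -- The second program starts from numbers up to `p.growth * W`; the longer bit length is
    -- absorbed into its constant.
    have h5 : q.kt * ((p.growth * W).size + 1) ≤
        q.kt * (p.growth.size + 1) * (W.size + 1) := by
      rw [mul_assoc]
      have := size_mul_le p.growth W
      exact Nat.mul_le_mul_left _ (by nlinarith [Nat.zero_le (p.growth.size * W.size)])
    simp only [kt, add_mul p.kt]
    omega
  | ifLe e₁ e₂ p q ihp ihq =>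
    have h1 := e₁.size_le hW hs
    have h2 := e₁.cost_le hW hs
    have h3 := e₂.size_le hW hs
    have h4 := e₂.cost_le hW hs
    simp only [exec] at hs'
    split_ifs at hs' with hle
    · obtain ⟨h5, h6⟩ := ihp hp.1 hW (s := s.tick _) hs hs'
      refine ⟨?_, h6.mono (Nat.mul_le_mul_right _ (by simp [growth]))⟩
      simp only [State.tick, kt, add_mul] at *
      omega
    · obtain ⟨h5, h6⟩ := ihq hp.2 hW (s := s.tick _) hs hs'
      refine ⟨?_, h6.mono (Nat.mul_le_mul_right _ (by simp [growth]))⟩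
      simp only [State.tick, kt, add_mul] at *
      omega
  | loop => exact hp.elim

/-! ### Hoare triples -/

/-- From `s`, the program reaches a memory satisfying `Q` within time `T`. -/
def Runs (p : Prog) (s : State) (T : ℕ) (Q : (ℕ → ℕ → ℕ) → (ℕ → ℕ → ℝ) → Prop) : Prop :=
  Q (p.det s).nat (p.det s).real ∧ (p.det s).time ≤ s.time + T

theorem Runs.seq {p q : Prog} {s : State} {T T' : ℕ} {Q Q' : (ℕ → ℕ → ℕ) → (ℕ → ℕ → ℝ) → Prop}
    (hp : p.Runs s T Q) (hq : ∀ s', Q s'.nat s'.real → q.Runs s' T' Q') :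
    (Prog.seq p q).Runs s (T + T') Q' := by
  obtain ⟨h1, h2⟩ := hp
  obtain ⟨h3, h4⟩ := hq _ h1
  exact ⟨h3, by rw [det]; omega⟩

theorem runs_of_loopFree {p : Prog} (hp : p.LoopFree) (hp' : p.SampleFree) {W : ℕ} (hW : 1 ≤ W)
    {s : State} (hs : Bdd W s.nat) {Q : (ℕ → ℕ → ℕ) → (ℕ → ℕ → ℝ) → Prop}
    (hQ : Q (p.det s).nat (p.det s).real) : p.Runs s (p.kt * (W.size + 1)) Q :=
  ⟨hQ, (exec_bound hp hW hs (s' := p.det s) (by rw [exec_eq_pure hp']; simp)).1⟩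

/-- A constant for the time to set up a loop. -/
def headCost (e : NExpr) : ℕ := e.kc + 1 + (e.bd.size + 1)

/-- Iterating the growth factor of the body would give an exponential bound. Instead the invariant
guarantees one bound `W` before every pass, so each pass has the same cost. -/
theorem runs_loop {e : NExpr} {p : Prog} (hp : p.LoopFree) (hp' : p.SampleFree) {W : ℕ}
    (hW : 1 ≤ W) {s : State} {N : ℕ} (hN : e.eval s = N)
    (Inv : ℕ → (ℕ → ℕ → ℕ) → (ℕ → ℕ → ℝ) → Prop)
    (hB : ∀ t m r, Inv t m r → Bdd W m) (h0 : Inv 0 s.nat s.real)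
    (hstep : ∀ t < N, ∀ s : State, Inv t s.nat s.real → Inv (t + 1) (p.det s).nat (p.det s).real) :
    (Prog.loop e p).Runs s ((headCost e + N * (p.kt + 1)) * (W.size + 1)) (Inv N) := by
  have hs := hB _ _ _ h0
  have h1 := e.size_le hW hs
  have h2 := e.cost_le hW hs
  simp only [Runs, det, hN] at *
  set s₀ := s.tick (e.cost s + 1 + Nat.size N) with hs₀
  have key : ∀ k ≤ N, Inv k ((fun t => p.det (t.tick 1))^[k] s₀).nat
      ((fun t => p.det (t.tick 1))^[k] s₀).real ∧
      ((fun t => p.det (t.tick 1))^[k] s₀).time ≤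
        s₀.time + k * (p.kt + 1) * (W.size + 1) := by
    intro k hk
    induction k with
    | zero => exact ⟨h0, by simp⟩
    | succ k ih =>
      obtain ⟨i1, i2⟩ := ih (by omega)
      rw [Function.iterate_succ_apply']
      set t := (fun t => p.det (t.tick 1))^[k] s₀
      have := (runs_of_loopFree hp hp' hW (s := t.tick 1) (hB _ _ _ i1)
        (Q := Inv (k + 1)) (hstep k (by omega) (t.tick 1) i1))
      refine ⟨this.1, this.2.trans ?_⟩
      have e1 : (k + 1) * (p.kt + 1) * (W.size + 1) =
        k * (p.kt + 1) * (W.size + 1) + p.kt * (W.size + 1) + (W.size + 1) := by ring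
      rw [e1]
      simp only [State.tick] at *
      omega
  refine ⟨(key N le_rfl).1, (key N le_rfl).2.trans ?_⟩
  simp only [hs₀, State.tick, headCost, add_mul] at *
  omega

end Prog

/-! ### Sequences of independent draws -/

/-- The law of a list of `N` independent draws, the `t`-th one from `{0, …, b t - 1}`. -/
noncomputable def drawList (b : ℕ → ℕ) : ℕ → PMF (List ℕ)
  | 0 => PMF.pure []
  | N + 1 => (drawList b N).bind fun rs => (uniformBelow (b N)).map fun v => rs ++ [v]

theorem uniformOfFintype_map_equiv {α β : Type*} [Fintype α] [Fintype β] [Nonempty α] [Nonempty β]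
    (e : α ≃ β) : (PMF.uniformOfFintype α).map e = PMF.uniformOfFintype β := by
  classical
  ext b
  rw [PMF.map_apply, tsum_eq_single (e.symm b)]
  · simp [Fintype.card_congr e]
  · intro a ha
    rw [if_neg]
    rintro rfl
    simp at ha

theorem uniformOfFintype_prod {α β : Type*} [Fintype α] [Fintype β] [Nonempty α] [Nonempty β] :
    PMF.uniformOfFintype (α × β) =
      (PMF.uniformOfFintype β).bind fun b => (PMF.uniformOfFintype α).map fun a => (a, b) := by
  classical
  ext ⟨a, b⟩
  rw [PMF.bind_apply, tsum_eq_single b]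
  · rw [PMF.map_apply, tsum_eq_single a]
    · simp only [PMF.uniformOfFintype_apply, Fintype.card_prod, if_true]
      rw [Nat.cast_mul, ENNReal.mul_inv (by simp) (by simp), mul_comm]
    · intro a' ha'
      rw [if_neg]
      simpa using fun h => ha' h.symm
  · intro b' hb'
    rw [PMF.map_apply, ENNReal.tsum_eq_zero.2, mul_zero]
    intro a'
    rw [if_neg]
    simp only [Prod.mk.injEq, not_and]
    exact fun _ h => hb' h.symm

theorem uniformBelow_eq_map (N : ℕ) [NeZero N] :
    uniformBelow N = (PMF.uniformOfFintype (Fin N)).map fun v : Fin N => (v : ℕ) := by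
  have h : (range N).Nonempty := by simpa using NeZero.ne N
  ext v
  rw [uniformBelow, dif_pos h, PMF.map_apply, PMF.uniformOfFinset_apply]
  split_ifs with hv
  · rw [tsum_eq_single ⟨v, mem_range.1 hv⟩]
    · simp
    · intro w hw
      rw [if_neg]
      rintro rfl
      exact hw rfl
  · rw [ENNReal.tsum_eq_zero.2]
    intro w
    rw [if_neg]
    rintro rfl
    exact hv (by simp)

/-- Successive independent draws form a uniform point of the product; the induction splits off the
last coordinate. Positive bounds are needed because `Fin 0` carries no uniform law. -/
theorem drawList_eq_map (b : ℕ → ℕ) [∀ i, NeZero (b i)] (N : ℕ) :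
    drawList b N = (PMF.uniformOfFintype ((i : Fin N) → Fin (b i))).map
      fun r : (i : Fin N) → Fin (b i) => List.ofFn fun i => (r i : ℕ) := by
  induction N with
  | zero =>
    rw [drawList]
    have : (fun r : (i : Fin 0) → Fin (b i) => List.ofFn fun i => (r i : ℕ)) =
        Function.const _ [] := by ext1 r; simp
    rw [this, PMF.map_const]
  | succ N ih =>
    have e : PMF.uniformOfFintype ((i : Fin (N + 1)) → Fin (b i)) =
        (PMF.uniformOfFintype (Fin (b N) × ((i : Fin N) → Fin (b i)))).map
          (Fin.snocEquiv fun i : Fin (N + 1) => Fin (b i)) :=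
      (uniformOfFintype_map_equiv (Fin.snocEquiv fun i : Fin (N + 1) => Fin (b i))).symm
    rw [drawList, ih, e, uniformOfFintype_prod, PMF.map_comp, PMF.map_bind, PMF.bind_map]
    refine congrArg _ (funext fun r => ?_)
    simp only [Function.comp_apply]
    rw [uniformBelow_eq_map, PMF.map_comp, PMF.map_comp]
    refine congrArg (fun f => PMF.map f _) (funext fun v => ?_)
    simp only [Function.comp_apply]
    rw [List.ofFn_succ', List.concat_eq_append]
    simp [Fin.snocEquiv]

/-- The law of a loop each of whose passes makes one draw. -/
theorem loop_law (p : Prog) (step : State → ℕ → State) (b : ℕ → ℕ)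
    (Inv : List ℕ → State → Prop) (s₀ : State) (h0 : Inv [] s₀) (N : ℕ)
    (hexec : ∀ rs s, rs.length < N → Inv rs s →
      p.exec (s.tick 1) = (uniformBelow (b rs.length)).map (step s))
    (hstep : ∀ rs s v, rs.length < N → Inv rs s → v ∈ (uniformBelow (b rs.length)).support →
      Inv (rs ++ [v]) (step s v)) :
    (fun μ : PMF State => μ.bind fun t => p.exec (t.tick 1))^[N] (PMF.pure s₀) =
      (drawList b N).map (fun rs => rs.foldl step s₀) ∧
    ∀ rs ∈ (drawList b N).support, rs.length = N ∧ Inv rs (rs.foldl step s₀) := by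
  suffices ∀ k ≤ N, (fun μ : PMF State => μ.bind fun t => p.exec (t.tick 1))^[k] (PMF.pure s₀) =
      (drawList b k).map (fun rs => rs.foldl step s₀) ∧
      ∀ rs ∈ (drawList b k).support, rs.length = k ∧ Inv rs (rs.foldl step s₀) from this N le_rfl
  intro k hk
  induction k with
  | zero =>
    refine ⟨by simp [drawList, PMF.pure_map], ?_⟩
    intro rs hrs
    simp only [drawList, PMF.support_pure, Set.mem_singleton_iff] at hrs
    subst hrs
    exact ⟨rfl, h0⟩
  | succ k ih =>
    obtain ⟨h1, h2⟩ := ih (by omega)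
    constructor
    · rw [Function.iterate_succ_apply', h1, PMF.bind_map, drawList, PMF.map_bind]
      refine PMF.ext fun s => ?_
      rw [PMF.bind_apply, PMF.bind_apply]
      refine tsum_congr fun rs => ?_
      -- A pass is known to be a single draw only where the invariant holds, hence only after
      -- possible outcomes; the others have weight zero.
      by_cases hrs : rs ∈ (drawList b k).support
      · obtain ⟨h3, h4⟩ := h2 rs hrs
        rw [Function.comp_apply, hexec rs _ (by omega) h4, h3, PMF.map_comp]
        congr 3
        ext1 v
        simp
      · rw [PMF.mem_support_iff, not_not] at hrs
        simp [hrs]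
    · intro rs hrs
      simp only [drawList, PMF.support_bind, PMF.support_map, Set.mem_iUnion,
        Set.mem_image] at hrs
      obtain ⟨rs, hrs, v, hv, rfl⟩ := hrs
      obtain ⟨h3, h4⟩ := h2 rs hrs
      refine ⟨by simp [h3], ?_⟩
      rw [List.foldl_append]
      exact hstep rs _ v (by omega) h4 (by rwa [h3])

end Machine

end ExpanderSketch

namespace ExpanderSketch
open Finset

/-! ### Construction: program text and layout of the records -/

section Build

open NExpr Prog

/-! ### The construction program -/

/-- Overwrite one integer cell. -/
def upd (M : ℕ → ℕ → ℕ) (arr i v : ℕ) : ℕ → ℕ → ℕ :=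
  Function.update M arr (Function.update (M arr) i v)

theorem upd_apply (M : ℕ → ℕ → ℕ) (arr i v arr' i' : ℕ) :
    upd M arr i v arr' i' = if arr' = arr ∧ i' = i then v else M arr' i' := by
  by_cases h : arr' = arr
  · subst h
    by_cases h' : i' = i
    · subst h'; simp [upd]
    · simp [upd, h']
  · simp [upd, h]

theorem write_nat (s : State) (arr i v : ℕ) : (s.write arr i v).nat = upd s.nat arr i v := rfl

theorem tick_nat (s : State) (k : ℕ) : (s.tick k).nat = s.nat := rfl

theorem Bdd.upd {W : ℕ} {M : ℕ → ℕ → ℕ} (hM : Bdd W M) (arr i : ℕ) {v : ℕ} (hv : v ≤ W) :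
    Bdd W (upd M arr i v) := by
  intro arr' i'
  rw [upd_apply]
  split_ifs
  · exact hv
  · exact hM _ _

/-- The number of vertices. -/
def numV : NExpr := cell 1 (const 0)
/-- The number of edges. -/
def numE : NExpr := cell 1 (const 1)
/-- The threshold. -/
def thr : NExpr := cell 1 (const 2)
/-- The loop counter. -/
def ctr : NExpr := cell 6 (const 0)
/-- The number of records written so far. -/
def numR : NExpr := cell 0 (const 3)
/-- The length of the queue. -/
def numQ : NExpr := cell 6 (const 1)
/-- The tail of the current dart. -/
def tail : NExpr := cell 4 ctr
/-- The head of the current dart. -/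
def head : NExpr := cell 5 ctr
/-- The address of the next record. -/
def recAddr : NExpr := add (add numV (const 4)) (add (add numR numR) numR)

/-- Advance the loop counter. -/
def incr : Prog := assign 6 (const 0) (add ctr (const 1))
/-- Reset the loop counter. -/
def reset : Prog := assign 6 (const 0) (const 0)

/-- Append a record to the sketch. -/
def emit (e₁ e₂ e₃ : NExpr) : Prog :=
  seq (assign 0 recAddr e₁) (seq (assign 0 (add recAddr (const 1)) e₂)
    (seq (assign 0 (add recAddr (const 2)) e₃) (assign 0 (const 3) (add numR (const 1)))))

/-- List every edge in both directions. -/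
def copyBody : Prog :=
  seq (assign 4 ctr (cell 2 ctr)) (seq (assign 5 ctr (cell 3 ctr))
    (seq (assign 4 (add numE ctr) (cell 3 ctr)) (seq (assign 5 (add numE ctr) (cell 2 ctr)) incr)))

/-- Count the degrees and tabulate the multiples of the number of vertices. -/
def countBody : Prog :=
  seq (assign 0 (add (const 4) tail) (add (cell 0 (add (const 4) tail)) (const 1)))
    (seq (assign 9 (add ctr (const 1)) (add (cell 9 ctr) numV)) incr)

/-- Store a dart exactly if it touches a vertex of low degree; otherwise, put its head into the
table of its tail. -/
def sortBody : Prog :=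
  seq (ifLe (cell 0 (add (const 4) tail)) thr (emit tail head thr)
    (ifLe (cell 0 (add (const 4) head)) thr (emit tail head thr)
      (seq (assign 8 (add (cell 9 (cell 7 tail)) tail) head)
        (assign 7 tail (add (cell 7 tail) (const 1)))))) incr

/-- Put the tail of a dart into the queue if it draws and is not yet there often enough. -/
def queueBody : Prog :=
  seq (ifLe (const 1) (cell 7 tail)
    (ifLe (add (cell 11 tail) (const 1)) thr
      (seq (assign 10 numQ tail) (seq (assign 11 tail (add (cell 11 tail) (const 1)))
        (assign 6 (const 1) (add numQ (const 1))))) skip) skip) incr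

/-- Store the drawn neighbour. -/
def storeDraw : Prog :=
  seq (emit (cell 10 ctr) (cell 8 (add (cell 9 (cell 6 (const 2))) (cell 10 ctr)))
    (cell 7 (cell 10 ctr))) incr

/-- Draw a neighbour of the vertex whose turn it is. -/
def drawBody : Prog := seq (sample 6 (const 2) (cell 7 (cell 10 ctr))) storeDraw

/-- Write the header of the sketch. -/
def finish : Prog :=
  seq (assign 0 (const 1) numV) (seq (assign 0 (const 2) thr)
    (assign 0 (const 0) (add (add numV (const 3)) (add (add numR numR) numR))))

/-- The deterministic part of the construction. -/
def prepare : Prog :=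
  seq (loop numE copyBody) (seq reset (seq (loop (add numE numE) countBody) (seq reset
    (seq (loop (add numE numE) sortBody) (seq reset (seq (loop (add numE numE) queueBody) reset))))))

/-- The construction program. -/
def buildProg : Prog := seq prepare (seq (loop numQ drawBody) finish)

/-! ### Records -/

/-- The memory after a record has been appended. -/
def emitMem (n : ℕ) (M : ℕ → ℕ → ℕ) (r : ℕ × ℕ × ℕ) : ℕ → ℕ → ℕ :=
  upd (upd (upd (upd M 0 (n + 4 + (M 0 3 + M 0 3 + M 0 3)) r.1)
    0 (n + 4 + (M 0 3 + M 0 3 + M 0 3) + 1) r.2.1)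
    0 (n + 4 + (M 0 3 + M 0 3 + M 0 3) + 2) r.2.2) 0 3 (M 0 3 + 1)

/-- The stored records. -/
def Recs (n : ℕ) (M : ℕ → ℕ → ℕ) (rl : List (ℕ × ℕ × ℕ)) : Prop :=
  M 0 3 = rl.length ∧ ∀ j (h : j < rl.length), M 0 (n + 4 + (j + j + j)) = rl[j].1 ∧
    M 0 (n + 4 + (j + j + j) + 1) = rl[j].2.1 ∧ M 0 (n + 4 + (j + j + j) + 2) = rl[j].2.2

theorem emitMem_of_ne {n : ℕ} {M : ℕ → ℕ → ℕ} {r : ℕ × ℕ × ℕ} {arr i : ℕ} (h : arr ≠ 0) :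
    emitMem n M r arr i = M arr i := by
  simp [emitMem, upd_apply, h]

theorem emitMem_of_lt {n : ℕ} {M : ℕ → ℕ → ℕ} {r : ℕ × ℕ × ℕ} {i : ℕ} (h : i < n + 4)
    (h3 : i ≠ 3) : emitMem n M r 0 i = M 0 i := by
  simp only [emitMem, upd_apply]
  rw [if_neg (by omega), if_neg (by omega), if_neg (by omega), if_neg (by omega)]

theorem Bdd.emitMem {n W : ℕ} {M : ℕ → ℕ → ℕ} (hM : Bdd W M) {r : ℕ × ℕ × ℕ} (h1 : r.1 ≤ W)
    (h2 : r.2.1 ≤ W) (h3 : r.2.2 ≤ W) (h : M 0 3 + 1 ≤ W) : Bdd W (emitMem n M r) :=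
  (((hM.upd _ _ h1).upd _ _ h2).upd _ _ h3).upd _ _ h

theorem Recs.emitMem {n : ℕ} {M : ℕ → ℕ → ℕ} {rl : List (ℕ × ℕ × ℕ)} (hM : Recs n M rl)
    (r : ℕ × ℕ × ℕ) : Recs n (emitMem n M r) (rl ++ [r]) := by
  obtain ⟨h1, h2⟩ := hM
  refine ⟨by simp [ExpanderSketch.emitMem, upd_apply, h1], fun j hj => ?_⟩
  simp only [ExpanderSketch.emitMem, upd_apply, h1]
  simp only [List.length_append, List.length_singleton] at hj
  rcases Nat.lt_succ_iff_lt_or_eq.1 hj with h | rfl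
  · obtain ⟨a1, a2, a3⟩ := h2 j h
    rw [List.getElem_append_left h]
    refine ⟨?_, ?_, ?_⟩ <;>
      rw [if_neg (by omega), if_neg (by omega), if_neg (by omega), if_neg (by omega)]
    · exact a1
    · exact a2
    · exact a3
  · simp only [List.getElem_concat_length]
    refine ⟨?_, ?_, ?_⟩
    · rw [if_neg (by omega), if_neg (by omega), if_neg (by omega), if_pos (by simp)]
    · rw [if_neg (by omega), if_neg (by omega), if_pos (by simp)]
    · rw [if_neg (by omega), if_pos (by simp)]

theorem Recs.congr {n : ℕ} {M M' : ℕ → ℕ → ℕ} {rl : List (ℕ × ℕ × ℕ)} (hM : Recs n M rl)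
    (h : ∀ i, 3 ≤ i → M' 0 i = M 0 i) : Recs n M' rl := by
  refine ⟨by rw [h 3 le_rfl, hM.1], fun j hj => ?_⟩
  rw [h _ (by omega), h _ (by omega), h _ (by omega)]
  exact hM.2 j hj

/-- The second and third entries are evaluated after earlier entries have been written to array `0`,
so they must depend on the other arrays only. -/
theorem det_emit {n : ℕ} {e₁ e₂ e₃ : NExpr} {s : State} {r : ℕ × ℕ × ℕ} (hn : s.nat 1 0 = n)
    (h1 : e₁.eval s = r.1)
    (h2 : ∀ s' : State, (∀ arr, arr ≠ 0 → s'.nat arr = s.nat arr) → e₂.eval s' = r.2.1)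
    (h3 : ∀ s' : State, (∀ arr, arr ≠ 0 → s'.nat arr = s.nat arr) → e₃.eval s' = r.2.2) :
    ((emit e₁ e₂ e₃).det s).nat = emitMem n s.nat r := by
  have hne : ∀ M : ℕ → ℕ → ℕ, ∀ i v arr, arr ≠ 0 → upd M 0 i v arr = M arr := by
    intro M i v arr h
    ext j
    simp [upd_apply, h]
  simp only [emit, Prog.det, write_nat, tick_nat]
  rw [h2 _ (by intro arr h; simp only [write_nat, tick_nat]; rw [hne _ _ _ _ h]),
    h3 _ (by intro arr h; simp only [write_nat, tick_nat]; rw [hne _ _ _ _ h, hne _ _ _ _ h])]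
  -- Records start at address `n + 4`, so writing their entries leaves the record counter in cell
  -- `3`, and with it the address, intact.
  have c1 : ∀ k, ¬ (3 = n + 4 + k) := by omega
  have c2 : ∀ k, ¬ (3 = n + 4 + k + 1) := by omega
  have c3 : ∀ k, ¬ (3 = n + 4 + k + 2) := by omega
  simp [recAddr, numR, numV, NExpr.eval, write_nat, tick_nat, upd_apply, hn, h1, emitMem, c1, c2,
    c3]

end Build

end ExpanderSketch

namespace ExpanderSketch
open Finset

/-! ### Invariants of the deterministic phases -/

section Phases

open NExpr Prog

variable {n : ℕ}

/-- Every edge in both directions. -/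
def darts (l : List (Fin n × Fin n)) : List (Fin n × Fin n) := l ++ l.map Prod.swap

theorem length_darts (l : List (Fin n × Fin n)) : (darts l).length = l.length + l.length := by
  simp [darts]

/-- The degree of a vertex, read off from the darts. -/
def outDeg (D : List (Fin n × Fin n)) (u : Fin n) : ℕ := (D.map Prod.fst).count u

/-- The exact records of a list of darts. -/
def lowRecs (a : ℕ) (dg : Fin n → ℕ) (D : List (Fin n × Fin n)) : List (ℕ × ℕ × ℕ) :=
  (D.filter fun d => dg d.1 ≤ a ∨ dg d.2 ≤ a).map fun d => ((d.1 : ℕ), (d.2 : ℕ), a)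

/-- The heads of the darts from `u` between vertices of high degree. -/
def nbrList (a : ℕ) (dg : Fin n → ℕ) (D : List (Fin n × Fin n)) (u : Fin n) : List (Fin n) :=
  (D.filter fun d => d.1 = u ∧ ¬ (dg d.1 ≤ a ∨ dg d.2 ≤ a)).map Prod.snd

/-- A bound on all the numbers that occur in the construction. -/
def cap (n m a : ℕ) : ℕ := n * (m + m) + n + a + 12 * m + 4

/-- The memory while the darts are being listed. -/
structure Copying (l : List (Fin n × Fin n)) (a t : ℕ) (M : ℕ → ℕ → ℕ) : Prop where
  numV : M 1 0 = n
  numE : M 1 1 = l.length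
  thr : M 1 2 = a
  ctr : M 6 0 = t
  inFst : ∀ i (h : i < l.length), M 2 i = l[i].1
  inSnd : ∀ i (h : i < l.length), M 3 i = l[i].2
  fst : ∀ i (h : i < l.length), i < t → M 4 i = l[i].1
  snd : ∀ i (h : i < l.length), i < t → M 5 i = l[i].2
  fst' : ∀ i (h : i < l.length), i < t → M 4 (l.length + i) = l[i].2
  snd' : ∀ i (h : i < l.length), i < t → M 5 (l.length + i) = l[i].1
  out0 : ∀ i, M 0 i = 0
  cnt0 : ∀ i, M 7 i = 0
  mul0 : M 9 0 = 0
  seen0 : ∀ i, M 11 i = 0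
  queue0 : M 6 1 = 0
  bdd : Bdd (cap n l.length a) M

/-- The input and the darts. -/
structure Static (D : List (Fin n × Fin n)) (m a t : ℕ) (M : ℕ → ℕ → ℕ) : Prop where
  numV : M 1 0 = n
  numE : M 1 1 = m
  thr : M 1 2 = a
  ctr : M 6 0 = t
  fst : ∀ i (h : i < D.length), M 4 i = D[i].1
  snd : ∀ i (h : i < D.length), M 5 i = D[i].2
  bdd : Bdd (cap n m a) M

/-- The memory while the degrees are being counted. -/
structure Counting (D : List (Fin n × Fin n)) (m a t : ℕ) (M : ℕ → ℕ → ℕ) : Prop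
    extends Static D m a t M where
  deg : ∀ u : Fin n, M 0 (4 + u) = outDeg (D.take t) u
  mul : ∀ j ≤ t, M 9 j = n * j
  recs0 : M 0 3 = 0
  cnt0 : ∀ i, M 7 i = 0
  seen0 : ∀ i, M 11 i = 0
  queue0 : M 6 1 = 0

/-- The memory while the darts are being sorted. -/
structure Sorting (D : List (Fin n × Fin n)) (dg : Fin n → ℕ) (m a t : ℕ) (M : ℕ → ℕ → ℕ) : Prop
    extends Static D m a t M where
  deg : ∀ u : Fin n, M 0 (4 + u) = dg u
  mul : ∀ j ≤ D.length, M 9 j = n * j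
  recs : Recs n M (lowRecs a dg (D.take t))
  cnt : ∀ u : Fin n, M 7 u = (nbrList a dg (D.take t) u).length
  nbr : ∀ u : Fin n, ∀ j (h : j < (nbrList a dg (D.take t) u).length),
    M 8 (n * j + u) = (nbrList a dg (D.take t) u)[j]
  seen0 : ∀ i, M 11 i = 0
  queue0 : M 6 1 = 0

/-- The tables on which the draws are based. -/
structure Tables (D : List (Fin n × Fin n)) (dg : Fin n → ℕ) (m a t : ℕ)
    (rl : List (ℕ × ℕ × ℕ)) (M : ℕ → ℕ → ℕ) : Prop extends Static D m a t M where
  deg : ∀ u : Fin n, M 0 (4 + u) = dg u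
  mul : ∀ j ≤ D.length, M 9 j = n * j
  recs : Recs n M rl
  cnt : ∀ u : Fin n, M 7 u = (nbrList a dg D u).length
  nbr : ∀ u : Fin n, ∀ j (h : j < (nbrList a dg D u).length),
    M 8 (n * j + u) = (nbrList a dg D u)[j]

/-- The memory while the queue is being filled. -/
structure Queueing (D : List (Fin n × Fin n)) (dg : Fin n → ℕ) (m a t : ℕ) (q : List (Fin n))
    (M : ℕ → ℕ → ℕ) : Prop extends Tables D dg m a t (lowRecs a dg D) M where
  numQ : M 6 1 = q.length
  queue : ∀ j (h : j < q.length), M 10 j = q[j]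
  seen : ∀ u : Fin n, M 11 u = q.count u
  count : ∀ u : Fin n, q.count u = if nbrList a dg D u = [] then 0
    else min a (outDeg (D.take t) u)
  length_le : q.length ≤ t

theorem take_succ_eq {α : Type*} (D : List α) {t : ℕ} (h : t < D.length) :
    D.take (t + 1) = D.take t ++ [D[t]] := by
  rw [List.take_succ_eq_append_getElem h]

theorem outDeg_append (D : List (Fin n × Fin n)) (d : Fin n × Fin n) (u : Fin n) :
    outDeg (D ++ [d]) u = outDeg D u + if u = d.1 then 1 else 0 := by
  simp only [outDeg, List.map_append, List.map_cons, List.map_nil, List.count_append,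
    List.count_singleton, beq_iff_eq, eq_comm (a := u)]

theorem outDeg_le (D : List (Fin n × Fin n)) (u : Fin n) : outDeg D u ≤ D.length := by
  simpa [outDeg] using List.count_le_length (l := D.map Prod.fst) (a := u)

theorem nbrList_append (a : ℕ) (dg : Fin n → ℕ) (D : List (Fin n × Fin n)) (d : Fin n × Fin n)
    (u : Fin n) : nbrList a dg (D ++ [d]) u = nbrList a dg D u ++
      if d.1 = u ∧ ¬ (dg d.1 ≤ a ∨ dg d.2 ≤ a) then [d.2] else [] := by
  simp only [nbrList, List.filter_append, List.map_append]
  congr 1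
  by_cases h : d.1 = u ∧ ¬ (dg d.1 ≤ a ∨ dg d.2 ≤ a)
  · rw [if_pos h, List.filter_singleton, decide_eq_true h]; rfl
  · rw [if_neg h, List.filter_singleton, decide_eq_false h]; rfl

theorem nbrList_length_le (a : ℕ) (dg : Fin n → ℕ) (D : List (Fin n × Fin n)) (u : Fin n) :
    (nbrList a dg D u).length ≤ D.length := by
  simpa [nbrList] using List.length_filter_le _ D

theorem lowRecs_append (a : ℕ) (dg : Fin n → ℕ) (D : List (Fin n × Fin n)) (d : Fin n × Fin n) :
    lowRecs a dg (D ++ [d]) = lowRecs a dg D ++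
      if dg d.1 ≤ a ∨ dg d.2 ≤ a then [((d.1 : ℕ), (d.2 : ℕ), a)] else [] := by
  simp only [lowRecs, List.filter_append, List.map_append]
  congr 1
  by_cases h : dg d.1 ≤ a ∨ dg d.2 ≤ a
  · rw [if_pos h, List.filter_singleton, decide_eq_true h]; rfl
  · rw [if_neg h, List.filter_singleton, decide_eq_false h]; rfl

theorem lowRecs_length_le (a : ℕ) (dg : Fin n → ℕ) (D : List (Fin n × Fin n)) :
    (lowRecs a dg D).length ≤ D.length := by
  simpa [lowRecs] using List.length_filter_le _ D

/-- By uniqueness of division with remainder, distinct pairs of vertex and position occupy distinct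
cells `n * j + u` of the neighbour table. -/
theorem mul_add_inj {u u' : Fin n} {j j' : ℕ} (h : n * j + u = n * j' + u') : j = j' ∧ u = u' := by
  have hn : 0 < n := u.pos
  have h1 : (n * j + u) % n = u := by simp [Nat.add_mod, Nat.mod_eq_of_lt u.2]
  have h2 : (n * j' + u') % n = u' := by simp [Nat.add_mod, Nat.mod_eq_of_lt u'.2]
  have h3 : (u : ℕ) = u' := by rw [← h1, ← h2, h]
  refine ⟨?_, Fin.ext h3⟩
  have : n * j = n * j' := by omega
  exact Nat.eq_of_mul_eq_mul_left hn this

theorem copying_init (l : List (Fin n × Fin n)) (a : ℕ) :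
    Copying l a 0 (buildInput l a).nat := by
  constructor <;> try simp [buildInput]
  · intro i hi
    simp [hi]
  · intro i hi
    simp [hi]
  · intro arr i
    simp only [cap]
    split
    · rcases i with _ | _ | _ | i
      · simp; omega
      · simp; omega
      · simp; omega
      · simp
    · rcases h : l[i]? with _ | p
      · simp
      · simp only [Option.map_some, Option.getD_some]
        have := p.1.2
        omega
    · rcases h : l[i]? with _ | p
      · simp
      · simp only [Option.map_some, Option.getD_some]
        have := p.2.2
        omega
    · simp

theorem copying_step {l : List (Fin n × Fin n)} {a t : ℕ} (ht : t < l.length) {s : State}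
    (h : Copying l a t s.nat) : Copying l a (t + 1) (copyBody.det s).nat := by
  have hM : (copyBody.det s).nat = upd (upd (upd (upd (upd s.nat 4 t l[t].1) 5 t l[t].2)
      4 (l.length + t) l[t].2) 5 (l.length + t) l[t].1) 6 0 (t + 1) := by
    simp [copyBody, incr, ctr, numE, Prog.det, NExpr.eval, write_nat, tick_nat, upd_apply, h.ctr,
      h.numE, h.inFst t ht, h.inSnd t ht]
  have hf := l[t].1.2
  have hs := l[t].2.2
  rw [hM]
  constructor <;> try simp only [upd_apply]
  · simpa using h.numV
  · simpa using h.numE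
  · simpa using h.thr
  · simp
  · simpa using h.inFst
  · simpa using h.inSnd
  · intro i hi hit
    simp only [Nat.reduceEqDiff, false_and, if_false, true_and]
    rw [if_neg (by omega)]
    split_ifs with e
    · subst e; rfl
    · exact h.fst i hi (by omega)
  · intro i hi hit
    simp only [Nat.reduceEqDiff, false_and, if_false, true_and]
    rw [if_neg (by omega)]
    split_ifs with e
    · subst e; rfl
    · exact h.snd i hi (by omega)
  · intro i hi hit
    simp only [Nat.reduceEqDiff, false_and, if_false, true_and]
    split_ifs with e e
    · obtain rfl : i = t := by omega
      rfl
    · omega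
    · exact h.fst' i hi (by omega)
  · intro i hi hit
    simp only [Nat.reduceEqDiff, false_and, if_false, true_and]
    split_ifs with e e
    · obtain rfl : i = t := by omega
      rfl
    · omega
    · exact h.snd' i hi (by omega)
  · simpa using h.out0
  · simpa using h.cnt0
  · simpa using h.mul0
  · simpa using h.seen0
  · simpa using h.queue0
  · refine ((((h.bdd.upd _ _ ?_).upd _ _ ?_).upd _ _ ?_).upd _ _ ?_).upd _ _ ?_ <;>
      (simp only [cap]; omega)

theorem counting_init {l : List (Fin n × Fin n)} {a : ℕ} {s : State}
    (h : Copying l a l.length s.nat) : Counting (darts l) l.length a 0 (reset.det s).nat := by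
  have hM : (reset.det s).nat = upd s.nat 6 0 0 := by
    simp [reset, Prog.det, NExpr.eval, write_nat, tick_nat]
  rw [hM]
  constructor <;> try constructor
  all_goals try simp only [upd_apply]
  · simpa using h.numV
  · simpa using h.numE
  · simpa using h.thr
  · simp
  · intro i hi
    simp only [Nat.reduceEqDiff, false_and, if_false]
    rcases lt_or_ge i l.length with hil | hil
    · simp only [darts]
      rw [List.getElem_append_left hil, h.fst i hil hil]
    · obtain ⟨j, rfl⟩ := Nat.exists_eq_add_of_le hil
      rw [length_darts] at hi
      simp only [darts]
      rw [List.getElem_append_right hil, h.fst' j (by omega) (by omega)]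
      simp
  · intro i hi
    simp only [Nat.reduceEqDiff, false_and, if_false]
    rcases lt_or_ge i l.length with hil | hil
    · simp only [darts]
      rw [List.getElem_append_left hil, h.snd i hil hil]
    · obtain ⟨j, rfl⟩ := Nat.exists_eq_add_of_le hil
      rw [length_darts] at hi
      simp only [darts]
      rw [List.getElem_append_right hil, h.snd' j (by omega) (by omega)]
      simp
  · exact h.bdd.upd _ _ (Nat.zero_le _)
  · simpa [outDeg] using fun u => h.out0 _
  · simpa using h.mul0
  · simpa using h.out0 3
  · simpa using h.cnt0
  · simpa using h.seen0
  · simpa using h.queue0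

/-- The machine has no multiplication, so the multiples of `n` that address the neighbour table are
accumulated along the way. There are as many as darts, and no neighbour list is longer. -/
theorem counting_step {D : List (Fin n × Fin n)} {m a t : ℕ}
    (hlen : D.length = m + m) (ht : t < D.length) {s : State}
    (h : Counting D m a t s.nat) : Counting D m a (t + 1) (countBody.det s).nat := by
  have hM : (countBody.det s).nat = upd (upd (upd s.nat
      0 (4 + D[t].1) (outDeg (D.take t) D[t].1 + 1))
      9 (t + 1) (n * (t + 1))) 6 0 (t + 1) := by
    simp [countBody, incr, ctr, tail, numV, Prog.det, NExpr.eval, write_nat, tick_nat, upd_apply,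
      h.ctr, h.numV, h.fst t ht, h.deg, h.mul t le_rfl, mul_add]
  have hd : outDeg (D.take t) D[t].1 ≤ t :=
    (outDeg_le _ _).trans (by simp)
  rw [hM]
  constructor <;> try constructor
  all_goals try simp only [upd_apply]
  · simpa using h.numV
  · simpa using h.numE
  · simpa using h.thr
  · simp
  · simpa using h.fst
  · simpa using h.snd
  · refine ((h.bdd.upd _ _ ?_).upd _ _ ?_).upd _ _ ?_
    · simp only [cap]; omega
    -- These multiples account for the term `n * (m + m)` of `cap`.
    · have : n * (t + 1) ≤ n * (m + m) := Nat.mul_le_mul_left _ (by omega)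
      simp only [cap]; omega
    · simp only [cap]; omega
  · intro u
    rw [take_succ_eq _ ht, outDeg_append]
    simp only [false_and, if_false, true_and, OfNat.zero_ne_ofNat, Nat.add_left_cancel_iff, ← Fin.ext_iff]
    split_ifs with e
    · rw [e]
    · rw [h.deg u, add_zero]
  · intro j hj
    simp only [Nat.reduceEqDiff, false_and, if_false, true_and, OfNat.ofNat_ne_zero]
    split_ifs with e
    · rw [e]
    · exact h.mul j (by omega)
  · rw [if_neg (by omega), if_neg (by omega), if_neg (by omega)]
    exact h.recs0
  · simpa using h.cnt0
  · simpa using h.seen0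
  · simpa using h.queue0

theorem sorting_init {D : List (Fin n × Fin n)} {m a : ℕ} {s : State}
    (h : Counting D m a D.length s.nat) : Sorting D (outDeg D) m a 0 (reset.det s).nat := by
  have hM : (reset.det s).nat = upd s.nat 6 0 0 := by
    simp [reset, Prog.det, NExpr.eval, write_nat, tick_nat]
  rw [hM]
  constructor <;> try constructor
  all_goals try simp only [upd_apply]
  · simpa using h.numV
  · simpa using h.numE
  · simpa using h.thr
  · simp
  · simpa using h.fst
  · simpa using h.snd
  · exact h.bdd.upd _ _ (Nat.zero_le _)
  · simpa using h.deg
  · simpa using h.mul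
  · simpa [lowRecs] using h.recs0
  · simp [lowRecs]
  · simpa [nbrList] using fun u => h.cnt0 _
  · simp [nbrList]
  · simpa using h.seen0
  · simpa using h.queue0

/-- A dart with a low end extends the records and leaves the neighbour table alone. Any other dart
goes to the first free position of its tail, which is the current length of that list. -/
theorem sorting_step {D : List (Fin n × Fin n)} {dg : Fin n → ℕ} {m a t : ℕ}
    (hlen : D.length = m + m) (ht : t < D.length) {s : State}
    (h : Sorting D dg m a t s.nat) : Sorting D dg m a (t + 1) (sortBody.det s).nat := by
  have hf := D[t].1.2
  have hs := D[t].2.2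
  have hR := lowRecs_length_le a dg (D.take t)
  have hL : ∀ u, (nbrList a dg (D.take t) u).length ≤ t :=
    fun u => (nbrList_length_le _ _ _ _).trans (by simp)
  rw [List.length_take] at hR
  by_cases hlow : dg D[t].1 ≤ a ∨ dg D[t].2 ≤ a
  · have hM : (sortBody.det s).nat =
        upd (emitMem n s.nat (D[t].1, D[t].2, a)) 6 0 (t + 1) := by
      have key : ∀ s' : State, s'.nat = s.nat → ((emit tail head thr).det s').nat =
          emitMem n s.nat (D[t].1, D[t].2, a) := by
        intro s' e
        rw [← e]
        rw [← e] at h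
        refine det_emit (s := s') h.numV ?_ ?_ ?_
        · simpa [tail, ctr, NExpr.eval, h.ctr] using h.fst t ht
        · intro s' hs'
          simpa [head, ctr, NExpr.eval, hs', h.ctr] using h.snd t ht
        · intro s' hs'
          simpa [thr, NExpr.eval, hs'] using h.thr
      simp only [sortBody, Prog.det, incr, write_nat, tick_nat, NExpr.eval, ctr, tail, head, thr,
        h.ctr, h.fst t ht, h.snd t ht, h.deg, h.thr]
      simp only [tail, head, thr, ctr] at key
      by_cases h1 : dg D[t].1 ≤ a
      · rw [if_pos h1, key (State.tick _ _) rfl, emitMem_of_ne (by decide), h.ctr]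
      · rw [if_neg h1, if_pos (hlow.resolve_left h1), key (State.tick (State.tick _ _) _) rfl, emitMem_of_ne (by decide), h.ctr]
    have hnb : ∀ u, nbrList a dg (D.take (t + 1)) u = nbrList a dg (D.take t) u := fun u => by
      rw [take_succ_eq _ ht, nbrList_append, if_neg (by tauto), List.append_nil]
    rw [hM]
    refine ⟨⟨?_, ?_, ?_, ?_, ?_, ?_, ?_⟩, ?_, ?_, ?_, ?_, ?_, ?_, ?_⟩
    all_goals try simp only [upd_apply]
    · simpa [emitMem_of_ne] using h.numV
    · simpa [emitMem_of_ne] using h.numE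
    · simpa [emitMem_of_ne] using h.thr
    · simp
    · simpa [emitMem_of_ne] using h.fst
    · simpa [emitMem_of_ne] using h.snd
    · refine (h.bdd.emitMem ?_ ?_ ?_ ?_).upd _ _ ?_
      · simp only [cap]; omega
      · simp only [cap]; omega
      · simp only [cap]; omega
      · rw [h.recs.1]; simp only [cap]; omega
      · simp only [cap]; omega
    · intro u
      have := u.2
      rw [if_neg (by omega), emitMem_of_lt (by omega) (by omega), h.deg]
    · simpa [emitMem_of_ne] using h.mul
    · rw [take_succ_eq _ ht, lowRecs_append, if_pos hlow]
      exact (h.recs.emitMem _).congr fun i _ => by simp [upd_apply]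
    · intro u
      rw [hnb, ← h.cnt u]
      simp [emitMem_of_ne]
    · intro u j hj
      simp only [hnb] at hj ⊢
      rw [← h.nbr u j hj]
      simp [emitMem_of_ne]
    · simpa [emitMem_of_ne] using h.seen0
    · simpa [emitMem_of_ne] using h.queue0
  · have h1 : ¬ dg D[t].1 ≤ a := fun h => hlow (Or.inl h)
    have h2 : ¬ dg D[t].2 ≤ a := fun h => hlow (Or.inr h)
    set c := (nbrList a dg (D.take t) D[t].1).length with hc
    have hct : c ≤ t := hL _
    have hM : (sortBody.det s).nat =
        upd (upd (upd s.nat 8 (n * c + D[t].1) D[t].2) 7 D[t].1 (c + 1)) 6 0 (t + 1) := by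
      simp [sortBody, Prog.det, incr, write_nat, tick_nat, NExpr.eval, ctr, tail, head, thr,
        h.ctr, h.fst t ht, h.snd t ht, h.deg, h.thr, h1, h2, upd_apply, h.cnt, ← hc,
        h.mul c (hct.trans ht.le)]
    rw [hM]
    refine ⟨⟨?_, ?_, ?_, ?_, ?_, ?_, ?_⟩, ?_, ?_, ?_, ?_, ?_, ?_, ?_⟩
    all_goals try simp only [upd_apply]
    · simpa using h.numV
    · simpa using h.numE
    · simpa using h.thr
    · simp
    · simpa using h.fst
    · simpa using h.snd
    · refine ((h.bdd.upd _ _ ?_).upd _ _ ?_).upd _ _ ?_ <;> (simp only [cap]; omega)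
    · simpa using h.deg
    · simpa using h.mul
    · rw [take_succ_eq _ ht, lowRecs_append, if_neg hlow, List.append_nil]
      exact h.recs.congr fun i _ => by simp [upd_apply]
    · intro u
      rw [take_succ_eq _ ht, nbrList_append]
      simp only [Nat.reduceEqDiff, false_and, if_false, true_and]
      by_cases e : D[t].1 = u
      · subst e
        simp [hlow, ← hc]
      · rw [if_neg (fun h => e (Fin.ext h.symm)), if_neg (fun h => e h.1), List.append_nil, h.cnt u]
    · intro u j hj
      have hX : nbrList a dg (D.take (t + 1)) u = nbrList a dg (D.take t) u ++
          if D[t].1 = u ∧ ¬ (dg D[t].1 ≤ a ∨ dg D[t].2 ≤ a) then [D[t].2] else [] := by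
        rw [take_succ_eq _ ht, nbrList_append]
      simp only [Nat.reduceEqDiff, false_and, if_false, true_and]
      simp only [hX] at hj ⊢
      rcases lt_or_ge j (nbrList a dg (D.take t) u).length with hjl | hjl
      · rw [List.getElem_append_left hjl, ← h.nbr u j hjl, if_neg]
        -- A collision with an older entry would force the same vertex and the position `c`, which
        -- was still free.
        intro e
        obtain ⟨rfl, rfl⟩ := mul_add_inj e
        exact absurd hjl (lt_irrefl _)
      · by_cases e : D[t].1 = u
        · subst e
          simp only [hlow, not_false_eq_true, and_self, if_true, List.length_append,
            List.length_singleton] at hj ⊢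
          obtain rfl : j = c := by omega
          simp [hc]
        · rw [if_neg (fun h => e h.1), List.append_nil] at hj
          omega
    · simpa using h.seen0
    · simpa using h.queue0

theorem queueing_init {D : List (Fin n × Fin n)} {dg : Fin n → ℕ} {m a : ℕ} {s : State}
    (h : Sorting D dg m a D.length s.nat) : Queueing D dg m a 0 [] (reset.det s).nat := by
  have hM : (reset.det s).nat = upd s.nat 6 0 0 := by
    simp [reset, Prog.det, NExpr.eval, write_nat, tick_nat]
  rw [hM]
  refine ⟨⟨⟨?_, ?_, ?_, ?_, ?_, ?_, ?_⟩, ?_, ?_, ?_, ?_, ?_⟩, ?_, ?_, ?_, ?_, ?_⟩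
  all_goals try simp only [upd_apply]
  · simpa using h.numV
  · simpa using h.numE
  · simpa using h.thr
  · simp
  · simpa using h.fst
  · simpa using h.snd
  · exact h.bdd.upd _ _ (Nat.zero_le _)
  · simpa using h.deg
  · simpa using h.mul
  · have := h.recs
    rw [List.take_length] at this
    exact this.congr fun i _ => by simp [upd_apply]
  · simpa using h.cnt
  · simpa using h.nbr
  · simpa using h.queue0
  · simp
  · simpa using fun u => h.seen0 _
  · simp [outDeg]
  · simp

theorem Tables.congr {D : List (Fin n × Fin n)} {dg : Fin n → ℕ} {m a t t' : ℕ} {rl : List (ℕ × ℕ × ℕ)}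
    {M M' : ℕ → ℕ → ℕ} (h : Tables D dg m a t rl M)
    (hM : ∀ arr i, arr ≠ 6 → arr ≠ 10 → arr ≠ 11 → M' arr i = M arr i) (hc : M' 6 0 = t')
    (hb : Bdd (cap n m a) M') : Tables D dg m a t' rl M' := by
  constructor
  · constructor
    · rw [hM _ _ (by decide) (by decide) (by decide), h.numV]
    · rw [hM _ _ (by decide) (by decide) (by decide), h.numE]
    · rw [hM _ _ (by decide) (by decide) (by decide), h.thr]
    · exact hc
    · intro i hi
      rw [hM _ _ (by decide) (by decide) (by decide), h.fst]
    · intro i hi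
      rw [hM _ _ (by decide) (by decide) (by decide), h.snd]
    · exact hb
  · intro u
    rw [hM _ _ (by decide) (by decide) (by decide), h.deg]
  · intro j hj
    rw [hM _ _ (by decide) (by decide) (by decide), h.mul j hj]
  · exact h.recs.congr fun i _ => hM _ _ (by decide) (by decide) (by decide)
  · intro u
    rw [hM _ _ (by decide) (by decide) (by decide), h.cnt]
  · intro u j hj
    rw [hM _ _ (by decide) (by decide) (by decide), h.nbr]

/-- Each dart offers its tail to the queue once, and the offer is accepted below `a` copies. After
`t` darts a vertex with a nonempty list thus occurs as often as the minimum of `a` and the number of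
its darts seen. -/
theorem queueing_step {D : List (Fin n × Fin n)} {dg : Fin n → ℕ} {m a t : ℕ}
    (hlen : D.length = m + m) (ht : t < D.length)
    {q : List (Fin n)} {s : State} (h : Queueing D dg m a t q s.nat) :
    ∃ q', Queueing D dg m a (t + 1) q' (queueBody.det s).nat := by
  have hf := D[t].1.2
  have hq := h.length_le
  by_cases hpush : nbrList a dg D D[t].1 ≠ [] ∧ q.count D[t].1 + 1 ≤ a
  · have hpos : 1 ≤ (nbrList a dg D D[t].1).length := List.length_pos_iff.2 hpush.1
    have hM : (queueBody.det s).nat = upd (upd (upd (upd s.nat 10 q.length D[t].1)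
        11 D[t].1 (q.count D[t].1 + 1)) 6 1 (q.length + 1)) 6 0 (t + 1) := by
      simp [queueBody, Prog.det, incr, write_nat, tick_nat, NExpr.eval, ctr, tail, thr, numQ,
        h.ctr, h.fst t ht, h.thr, h.cnt, hpos, h.seen, hpush.2, upd_apply, h.numQ]
    have hcl : q.count D[t].1 ≤ q.length := List.count_le_length
    refine ⟨q ++ [D[t].1], ?_⟩
    rw [hM]
    constructor
    · refine h.toTables.congr (fun arr i h1 h2 h3 => ?_) (by simp [upd_apply]) ?_
      · simp [upd_apply, h1, h2, h3]
      · refine (((h.bdd.upd _ _ ?_).upd _ _ ?_).upd _ _ ?_).upd _ _ ?_ <;>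
          (simp only [cap]; omega)
    · simp [upd_apply]
    · intro j hj
      simp only [List.length_append, List.length_singleton] at hj
      simp only [upd_apply, Nat.reduceEqDiff, false_and, if_false, true_and]
      split_ifs with e
      · subst e; simp
      · rw [List.getElem_append_left (by omega), h.queue]
    · intro u
      simp only [upd_apply, Nat.reduceEqDiff, false_and, if_false, true_and, List.count_append,
        List.count_singleton, beq_iff_eq]
      by_cases e : D[t].1 = u
      · subst e; simp
      · rw [if_neg (fun h => e (Fin.ext h.symm)), if_neg e, h.seen, add_zero]
    · intro u
      rw [take_succ_eq _ ht, outDeg_append, List.count_append, List.count_singleton, h.count u]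
      by_cases e : D[t].1 = u
      · subst e
        have h5 := h.count D[t].1
        rw [if_neg hpush.1] at h5
        rw [if_neg hpush.1, if_neg hpush.1]
        simp only [beq_self_eq_true, if_true]
        omega
      · simp [e, Ne.symm e]
    · simp; omega
  · have hM : (queueBody.det s).nat = upd s.nat 6 0 (t + 1) := by
      by_cases hpos : nbrList a dg D D[t].1 = []
      · simp [queueBody, Prog.det, incr, write_nat, tick_nat, NExpr.eval, ctr, tail, thr,
          h.ctr, h.fst t ht, h.cnt, hpos]
      · have hle : ¬ (q.count D[t].1 + 1 ≤ a) := fun h => hpush ⟨hpos, h⟩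
        have hpos : 1 ≤ (nbrList a dg D D[t].1).length := List.length_pos_iff.2 hpos
        simp only [queueBody, Prog.det, incr, write_nat, tick_nat, NExpr.eval, ctr, tail, thr,
          h.ctr, h.fst t ht, h.thr, h.cnt, hpos, h.seen, hle, if_true, if_false]
    refine ⟨q, ?_⟩
    rw [hM]
    constructor
    · refine h.toTables.congr (fun arr i h1 h2 h3 => ?_) (by simp [upd_apply]) ?_
      · simp [upd_apply, h1]
      · exact h.bdd.upd _ _ (by simp only [cap]; omega)
    · simpa [upd_apply] using h.numQ
    · simpa [upd_apply] using h.queue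
    · simpa [upd_apply] using h.seen
    · intro u
      rw [take_succ_eq _ ht, outDeg_append]
      have h5 := h.count u
      by_cases e : u = D[t].1
      · subst e
        rw [h5]
        by_cases hE : nbrList a dg D D[t].1 = []
        · rw [if_pos hE, if_pos hE]
        · have hle : ¬ (q.count D[t].1 + 1 ≤ a) := fun h => hpush ⟨hE, h⟩
          rw [if_neg hE] at h5
          rw [if_neg hE, if_neg hE, if_pos rfl]
          omega
      · rw [if_neg e, add_zero, h5]
    · omega

end Phases

end ExpanderSketch

namespace ExpanderSketch
open Finset

/-! ### Running time and outcome of the construction -/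

section Construction

open NExpr Prog

variable {n : ℕ}

/-- What the queue has to satisfy. -/
structure QueueSpec (D : List (Fin n × Fin n)) (dg : Fin n → ℕ) (a : ℕ) (q : List (Fin n)) :
    Prop where
  count : ∀ u : Fin n, q.count u = if nbrList a dg D u = [] then 0 else min a (outDeg D u)
  length_le : q.length ≤ D.length

theorem QueueSpec.nbrList_ne_nil {D : List (Fin n × Fin n)} {dg : Fin n → ℕ} {a : ℕ}
    {q : List (Fin n)} (h : QueueSpec D dg a q) {u : Fin n} (hu : u ∈ q) :
    nbrList a dg D u ≠ [] := by
  intro h0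
  have := List.count_pos_iff.2 hu
  rw [h.count u, if_pos h0] at this
  exact lt_irrefl _ this

/-- The memory while the neighbours are being drawn. -/
structure Drawing (D : List (Fin n × Fin n)) (dg : Fin n → ℕ) (m a t : ℕ) (q : List (Fin n))
    (rl : List (ℕ × ℕ × ℕ)) (M : ℕ → ℕ → ℕ) : Prop extends Tables D dg m a t rl M where
  numQ : M 6 1 = q.length
  queue : ∀ j (h : j < q.length), M 10 j = q[j]

/-- The finished sketch. -/
structure Sketch (n m a : ℕ) (dg : Fin n → ℕ) (rl : List (ℕ × ℕ × ℕ)) (M : ℕ → ℕ → ℕ) :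
    Prop where
  len : M 0 0 = n + 3 + (rl.length + rl.length + rl.length)
  numV : M 0 1 = n
  thr : M 0 2 = a
  deg : ∀ u : Fin n, M 0 (4 + u) = dg u
  recs : Recs n M rl
  bdd : Bdd (cap n m a) M

/-- The record of the draw with outcome `r` for the vertex `u`. -/
def drawRec (a : ℕ) (dg : Fin n → ℕ) (D : List (Fin n × Fin n)) (u : Fin n) (r : ℕ) : ℕ × ℕ × ℕ :=
  ((u : ℕ), ((nbrList a dg D u).getD r u : ℕ), (nbrList a dg D u).length)

/-- The number of outcomes of the `t`-th draw. -/
def drawBound (a : ℕ) (dg : Fin n → ℕ) (D : List (Fin n × Fin n)) (q : List (Fin n)) (t : ℕ) : ℕ :=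
  if h : t < q.length then (nbrList a dg D q[t]).length else 1

theorem drawing_init {D : List (Fin n × Fin n)} {dg : Fin n → ℕ} {m a : ℕ} {q : List (Fin n)}
    {s : State} (h : Queueing D dg m a D.length q s.nat) :
    Drawing D dg m a 0 q (lowRecs a dg D) (reset.det s).nat ∧ QueueSpec D dg a q := by
  have hM : (reset.det s).nat = upd s.nat 6 0 0 := by
    simp [reset, Prog.det, NExpr.eval, write_nat, tick_nat]
  rw [hM]
  refine ⟨⟨?_, ?_, ?_⟩, ?_, h.length_le⟩
  · refine h.toTables.congr (fun arr i h1 h2 h3 => ?_) (by simp [upd_apply])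
      (h.bdd.upd _ _ (Nat.zero_le _))
    simp [upd_apply, h1]
  · simpa [upd_apply] using h.numQ
  · simpa [upd_apply] using h.queue
  · simpa using h.count

theorem one_le_cap (n m a : ℕ) : 1 ≤ cap n m a := by simp only [cap]; omega

/-- A constant for the running time of the deterministic part. -/
def prepareConst : ℕ :=
  headCost numE + 3 * headCost (add numE numE) + 4 * reset.kt + (copyBody.kt + 1) +
    2 * (countBody.kt + 1) + 2 * (sortBody.kt + 1) + 2 * (queueBody.kt + 1)

/-- The four loops make `m`, `2m`, `2m` and `2m` passes, none of them over the vertices; `n` enters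
the time only through bit lengths. -/
theorem prepare_runs (l : List (Fin n × Fin n)) (a : ℕ) :
    prepare.Runs (buildInput l a)
      (prepareConst * (l.length + 1) * ((cap n l.length a).size + 1)) fun M _ => ∃ q,
        Drawing (darts l) (outDeg (darts l)) l.length a 0 q
          (lowRecs a (outDeg (darts l)) (darts l)) M ∧
        QueueSpec (darts l) (outDeg (darts l)) a q := by
  set B := (cap n l.length a).size + 1 with hB
  have hW := one_le_cap n l.length a
  have hlen := length_darts l
  have h1 : (loop numE copyBody).Runs (buildInput l a)
      ((headCost numE + l.length * (copyBody.kt + 1)) * B) fun M _ => Copying l a l.length M :=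
    runs_loop (by simp [copyBody, incr, LoopFree]) (by simp [copyBody, incr, SampleFree]) hW
      (show numE.eval (buildInput l a) = l.length from (copying_init l a).numE) (fun t M _ => Copying l a t M) (fun t M r h => h.bdd)
      (copying_init l a) (fun t ht s h => copying_step ht h)
  have h2 : ∀ s : State, Copying l a l.length s.nat →
      reset.Runs s (reset.kt * B) fun M _ => Counting (darts l) l.length a 0 M :=
    fun s h => runs_of_loopFree (p := reset) (by simp [reset, LoopFree]) (by simp [reset, SampleFree])
       hW h.bdd (Q := fun M _ =>
      Counting (darts l) l.length a 0 M) (counting_init h)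
  have h3 : ∀ s : State, Counting (darts l) l.length a 0 s.nat →
      (loop (add numE numE) countBody).Runs s
        ((headCost (add numE numE) + (darts l).length * (countBody.kt + 1)) * B)
        fun M _ => Counting (darts l) l.length a (darts l).length M :=
    fun s h => runs_loop (by simp [countBody, incr, LoopFree])
      (by simp [countBody, incr, SampleFree]) hW
      (by simp [NExpr.eval, numE, h.numE, hlen]) (fun t M _ => Counting (darts l) l.length a t M)
      (fun t M r h => h.bdd) h (fun t ht s h => counting_step hlen ht h)
  have h4 : ∀ s : State, Counting (darts l) l.length a (darts l).length s.nat →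
      reset.Runs s (reset.kt * B) fun M _ => Sorting (darts l) (outDeg (darts l)) l.length a 0 M :=
    fun s h => runs_of_loopFree (p := reset) (by simp [reset, LoopFree]) (by simp [reset, SampleFree])
       hW h.bdd (Q := fun M _ =>
      Sorting (darts l) (outDeg (darts l)) l.length a 0 M) (sorting_init h)
  have h5 : ∀ s : State, Sorting (darts l) (outDeg (darts l)) l.length a 0 s.nat →
      (loop (add numE numE) sortBody).Runs s
        ((headCost (add numE numE) + (darts l).length * (sortBody.kt + 1)) * B)
        fun M _ => Sorting (darts l) (outDeg (darts l)) l.length a (darts l).length M :=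
    fun s h => runs_loop (by simp [sortBody, emit, incr, LoopFree])
      (by simp [sortBody, emit, incr, SampleFree]) hW
      (by simp [NExpr.eval, numE, h.numE, hlen])
      (fun t M _ => Sorting (darts l) (outDeg (darts l)) l.length a t M)
      (fun t M r h => h.bdd) h (fun t ht s h => sorting_step hlen ht h)
  have h6 : ∀ s : State, Sorting (darts l) (outDeg (darts l)) l.length a (darts l).length s.nat →
      reset.Runs s (reset.kt * B) fun M _ => ∃ q,
        Queueing (darts l) (outDeg (darts l)) l.length a 0 q M :=
    fun s h => runs_of_loopFree (p := reset) (by simp [reset, LoopFree]) (by simp [reset, SampleFree])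
       hW h.bdd (Q := fun M _ => ∃ q,
      Queueing (darts l) (outDeg (darts l)) l.length a 0 q M) ⟨[], queueing_init h⟩
  have h7 : ∀ s : State, (∃ q, Queueing (darts l) (outDeg (darts l)) l.length a 0 q s.nat) →
      (loop (add numE numE) queueBody).Runs s
        ((headCost (add numE numE) + (darts l).length * (queueBody.kt + 1)) * B)
        fun M _ => ∃ q, Queueing (darts l) (outDeg (darts l)) l.length a (darts l).length q M :=
    fun s h => runs_loop (by simp [queueBody, incr, LoopFree])
      (by simp [queueBody, incr, SampleFree]) hW
      (by obtain ⟨q, h⟩ := h; simp [NExpr.eval, numE, h.numE, hlen])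
      (fun t M _ => ∃ q, Queueing (darts l) (outDeg (darts l)) l.length a t q M)
      (fun t M r ⟨q, h⟩ => h.bdd) h (fun t ht s ⟨q, h⟩ => queueing_step hlen ht h)
  have h8 : ∀ s : State,
      (∃ q, Queueing (darts l) (outDeg (darts l)) l.length a (darts l).length q s.nat) →
      reset.Runs s (reset.kt * B) fun M _ => ∃ q,
        Drawing (darts l) (outDeg (darts l)) l.length a 0 q
          (lowRecs a (outDeg (darts l)) (darts l)) M ∧
        QueueSpec (darts l) (outDeg (darts l)) a q :=
    fun s ⟨q, h⟩ => runs_of_loopFree (p := reset) (by simp [reset, LoopFree]) (by simp [reset, SampleFree])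
       hW h.bdd (Q := fun M _ => ∃ q,
        Drawing (darts l) (outDeg (darts l)) l.length a 0 q
          (lowRecs a (outDeg (darts l)) (darts l)) M ∧
        QueueSpec (darts l) (outDeg (darts l)) a q) ⟨q, drawing_init h⟩
  have key := h1.seq fun s hs => (h2 s hs).seq fun s hs => (h3 s hs).seq fun s hs =>
    (h4 s hs).seq fun s hs => (h5 s hs).seq fun s hs => (h6 s hs).seq fun s hs =>
    (h7 s hs).seq h8
  refine ⟨key.1, key.2.trans (Nat.add_le_add_left ?_ _)⟩
  rw [hlen]
  calc _ = (headCost numE + l.length * (copyBody.kt + 1) + reset.kt +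
        (headCost (add numE numE) + (l.length + l.length) * (countBody.kt + 1)) + reset.kt +
        (headCost (add numE numE) + (l.length + l.length) * (sortBody.kt + 1)) + reset.kt +
        (headCost (add numE numE) + (l.length + l.length) * (queueBody.kt + 1)) + reset.kt) * B := by
        ring
    _ ≤ _ := by
        refine Nat.mul_le_mul_right _ ?_
        simp only [prepareConst]
        generalize headCost numE = c₁
        generalize headCost (add numE numE) = c₂
        generalize reset.kt = c₃
        generalize copyBody.kt + 1 = c₄
        generalize countBody.kt + 1 = c₅
        generalize sortBody.kt + 1 = c₆
        generalize queueBody.kt + 1 = c₇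
        nlinarith [Nat.zero_le (c₁ * l.length), Nat.zero_le (c₂ * l.length),
          Nat.zero_le (c₃ * l.length)]

/-- The state after a pass of the drawing loop in which `v` is drawn. -/
noncomputable def drawStep (s : State) (v : ℕ) : State :=
  storeDraw.det (((s.tick 1).write 6 2 v).tick
    ((const 2).cost (s.tick 1) + (cell 7 (cell 10 ctr)).cost (s.tick 1) + 1 + Nat.size 2 +
      Nat.size ((cell 7 (cell 10 ctr)).eval s)))

theorem drawBody_exec (s : State) : drawBody.exec (s.tick 1) =
    (uniformBelow ((cell 7 (cell 10 ctr)).eval s)).map (drawStep s) := by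
  rw [drawBody, Prog.exec, Prog.exec, PMF.bind_map, ← PMF.bind_pure_comp]
  refine congrArg _ (funext fun v => ?_)
  rw [Function.comp_apply, exec_eq_pure (by simp [storeDraw, emit, incr, SampleFree])]
  rfl

theorem zipWith_append_singleton {α β γ : Type*} (f : α → β → γ) (q : List α) (rs : List β) (v : β)
    (h : rs.length < q.length) :
    List.zipWith f q (rs ++ [v]) = List.zipWith f q rs ++ [f q[rs.length] v] := by
  induction rs generalizing q with
  | nil =>
    cases q with
    | nil => simp at h
    | cons x q => simp
  | cons r rs ih =>
    cases q with
    | nil => simp at h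
    | cons x q =>
      have h' : rs.length < q.length := by simpa using h
      simp [ih q h']

/-- The outcome `v` selects a position in the neighbour list of the vertex whose turn it is. New
records lie beyond the degrees in array `0`, so everything on which later draws depend survives. -/
theorem drawing_step {D : List (Fin n × Fin n)} {dg : Fin n → ℕ} {m a t : ℕ}
    (hlen : D.length = m + m) {q : List (Fin n)} (hq : q.length ≤ D.length)
    {rl : List (ℕ × ℕ × ℕ)} (hrl : rl.length ≤ D.length + t) {s : State} (ht : t < q.length)
    (h : Drawing D dg m a t q rl s.nat) {v : ℕ} (hv : v < (nbrList a dg D q[t]).length) :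
    Drawing D dg m a (t + 1) q (rl ++ [drawRec a dg D q[t] v]) (drawStep s v).nat := by
  have hnl := nbrList_length_le a dg D q[t]
  have hnv := ((nbrList a dg D q[t]).getD v q[t]).2
  have hqt := q[t].2
  have hM : (drawStep s v).nat =
      upd (emitMem n (upd s.nat 6 2 v) (drawRec a dg D q[t] v)) 6 0 (t + 1) := by
    rw [drawStep]
    generalize ((const 2).cost (s.tick 1) + (cell 7 (cell 10 ctr)).cost (s.tick 1) + 1 +
      Nat.size 2 + Nat.size ((cell 7 (cell 10 ctr)).eval s)) = k
    have hs : ((((s.tick 1).write 6 2 v).tick k)).nat = upd s.nat 6 2 v := rfl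
    have key := det_emit (n := n) (s := ((s.tick 1).write 6 2 v).tick k)
      (e₁ := cell 10 ctr) (e₂ := cell 8 (add (cell 9 (cell 6 (const 2))) (cell 10 ctr)))
      (e₃ := cell 7 (cell 10 ctr)) (r := drawRec a dg D q[t] v)
      (by rw [hs]; simpa [upd_apply] using h.numV)
      (by simp [NExpr.eval, ctr, hs, upd_apply, h.ctr, h.queue t ht, drawRec])
      (by
        intro s' hs'
        have := h.nbr q[t] v hv
        simp only [NExpr.eval, ctr, hs' 10 (by decide), hs' 9 (by decide), hs' 6 (by decide),
          hs' 8 (by decide), hs]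
        simp [upd_apply, h.ctr, h.queue t ht, h.mul v (hv.le.trans hnl), this, drawRec,
          List.getElem?_eq_getElem hv])
      (by
        intro s' hs'
        simp only [NExpr.eval, ctr, hs' 10 (by decide), hs' 6 (by decide), hs' 7 (by decide), hs]
        simp [upd_apply, h.ctr, h.queue t ht, h.cnt, drawRec])
    simp only [storeDraw, Prog.det, incr, write_nat, tick_nat, NExpr.eval] at key ⊢
    change upd _ 6 0 ((Prog.det (emit _ _ _) _).nat 6 0 + 1) = _
    rw [key, emitMem_of_ne (by decide)]
    simp [upd_apply, h.ctr]
  have hne : ∀ arr i, arr ≠ 0 → arr ≠ 6 → (drawStep s v).nat arr i = s.nat arr i := by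
    intro arr i h0 h6
    rw [hM]
    simp [upd_apply, h6, emitMem_of_ne h0]
  have hcap : Bdd (cap n m a) (drawStep s v).nat := by
    rw [hM]
    have hR := h.recs.1
    refine ((h.bdd.upd _ _ ?_).emitMem ?_ ?_ ?_ ?_).upd _ _ ?_
    · simp only [cap]; omega
    · simp only [cap, drawRec]; omega
    · simp only [cap, drawRec]; omega
    · simp only [cap, drawRec]; omega
    · simp only [cap, upd_apply]
      rw [if_neg (by omega)]
      omega
    · simp only [cap]; omega
  refine ⟨⟨⟨?_, ?_, ?_, ?_, ?_, ?_, hcap⟩, ?_, ?_, ?_, ?_, ?_⟩, ?_, ?_⟩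
  · rw [hne _ _ (by decide) (by decide), h.numV]
  · rw [hne _ _ (by decide) (by decide), h.numE]
  · rw [hne _ _ (by decide) (by decide), h.thr]
  · rw [hM]; simp [upd_apply]
  · intro i hi
    rw [hne _ _ (by decide) (by decide), h.fst]
  · intro i hi
    rw [hne _ _ (by decide) (by decide), h.snd]
  · intro u
    have := u.2
    rw [hM, upd_apply, if_neg (by omega), emitMem_of_lt (by omega) (by omega), upd_apply,
      if_neg (by omega), h.deg]
  · intro j hj
    rw [hne _ _ (by decide) (by decide), h.mul j hj]
  · have h1 : Recs n (upd s.nat 6 2 v) rl := h.recs.congr fun i _ => by simp [upd_apply]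
    rw [hM]
    exact (h1.emitMem _).congr fun i _ => by simp [upd_apply]
  · intro u
    rw [hne _ _ (by decide) (by decide), h.cnt]
  · intro u j hj
    rw [hne _ _ (by decide) (by decide), h.nbr]
  · rw [hM]
    simp [upd_apply, emitMem_of_ne, h.numQ]
  · intro j hj
    rw [hne _ _ (by decide) (by decide), h.queue]

theorem sketch_of_drawing {D : List (Fin n × Fin n)} {dg : Fin n → ℕ} {m a t : ℕ}
    {q : List (Fin n)} {rl : List (ℕ × ℕ × ℕ)} (hrl : rl.length ≤ 4 * m) {s : State}
    (h : Drawing D dg m a t q rl s.nat) : Sketch n m a dg rl (finish.det s).nat := by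
  have hM : (finish.det s).nat = upd (upd (upd s.nat 0 1 n) 0 2 a) 0 0
      (n + 3 + (rl.length + rl.length + rl.length)) := by
    simp [finish, Prog.det, NExpr.eval, numV, thr, numR, write_nat, tick_nat, upd_apply, h.numV,
      h.thr, h.recs.1]
  rw [hM]
  refine ⟨?_, ?_, ?_, ?_, ?_, ?_⟩
  · simp [upd_apply]
  · simp [upd_apply]
  · simp [upd_apply]
  · intro u
    simp only [upd_apply]
    rw [if_neg (by omega), if_neg (by omega), if_neg (by omega), h.deg]
  · refine h.recs.congr fun i hi => ?_
    simp only [upd_apply]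
    rw [if_neg (by omega), if_neg (by omega), if_neg (by omega)]
  -- The length cell holds `n + 3` plus three cells for each of at most `4 * m` records, which
  -- explains the `12 * m` in `cap`.
  · refine ((h.bdd.upd _ _ ?_).upd _ _ ?_).upd _ _ ?_ <;> (simp only [cap]; omega)

/-- A constant for the running time of the construction. -/
def buildConst : ℕ := prepareConst + headCost numQ + 2 * (drawBody.kt + 1) + finish.kt

/-- All randomness is confined to the list `rs` of outcomes; the final state is a deterministic
function of it. The queue is fixed by the deterministic part, so the bounds of the draws do not
depend on earlier outcomes. -/
theorem build_spec (l : List (Fin n × Fin n)) (a : ℕ) :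
    ∃ q, QueueSpec (darts l) (outDeg (darts l)) a q ∧ ∃ F : List ℕ → State,
      buildProg.exec (buildInput l a) =
        (drawList (drawBound a (outDeg (darts l)) (darts l) q) q.length).map F ∧
      ∀ rs ∈ (drawList (drawBound a (outDeg (darts l)) (darts l) q) q.length).support,
        rs.length = q.length ∧
        Sketch n l.length a (outDeg (darts l)) (lowRecs a (outDeg (darts l)) (darts l) ++
          List.zipWith (drawRec a (outDeg (darts l)) (darts l)) q rs) (F rs).nat ∧
        (F rs).time ≤ buildConst * (l.length + 1) * ((cap n l.length a).size + 1) := by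
  have hlen := length_darts l
  set D := darts l with hD
  set dg := outDeg D with hdg
  obtain ⟨⟨q, hdraw, hspec⟩, htime⟩ := prepare_runs l a
  rw [← hD, ← hdg] at hdraw hspec
  set s₁ := prepare.det (buildInput l a) with hs₁
  set B := (cap n l.length a).size + 1 with hB
  have hW := one_le_cap n l.length a
  have hlow := lowRecs_length_le a dg D
  have hpos : ∀ t (ht : t < q.length), 0 < (nbrList a dg D q[t]).length := fun t ht =>
    List.length_pos_iff.2 (hspec.nbrList_ne_nil (List.getElem_mem ht))
  have hQ : numQ.eval s₁ = q.length := by simp [NExpr.eval, numQ, hdraw.numQ]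
  set s₂ := s₁.tick (numQ.cost s₁ + 1 + Nat.size q.length) with hs₂
  have ht2 : s₂.time ≤ (prepareConst * (l.length + 1) + headCost numQ) * B := by
    have e1 := numQ.cost_le hW hdraw.bdd
    have e2 := numQ.size_le hW hdraw.bdd
    rw [hQ] at e2
    rw [← hB] at e1 e2
    have e3 : (buildInput l a).time = 0 := rfl
    simp only [hs₂, State.tick, headCost, add_mul _ _ B] at *
    omega
  -- The invariant carries the elapsed time along with the memory, since both depend on the
  -- outcomes.
  have hloop := loop_law drawBody drawStep (drawBound a dg D q) (fun rs s =>
      Drawing D dg l.length a rs.length q (lowRecs a dg D ++ List.zipWith (drawRec a dg D) q rs)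
        s.nat ∧ s.time ≤ s₂.time + rs.length * ((drawBody.kt + 1) * B)) s₂
    ⟨by simpa using (show Drawing D dg l.length a 0 q (lowRecs a dg D) s₂.nat from hdraw),
      by simp⟩ q.length
    (by
      rintro rs s hrs ⟨h1, -⟩
      rw [drawBody_exec, drawBound, dif_pos hrs]
      congr 2
      simp [NExpr.eval, ctr, h1.ctr, h1.queue _ hrs, h1.cnt])
    (by
      rintro rs s v hrs ⟨h1, h2⟩ hv
      rw [drawBound, dif_pos hrs] at hv
      have hvlt : v < (nbrList a dg D q[rs.length]).length := by
        have hne : (range (nbrList a dg D q[rs.length]).length).Nonempty :=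
          ⟨0, mem_range.2 (hpos _ hrs)⟩
        rw [uniformBelow, dif_pos hne,
          PMF.mem_support_uniformOfFinset_iff, mem_range] at hv
        exact hv
      have hz : (List.zipWith (drawRec a dg D) q rs).length ≤ rs.length := by simp
      refine ⟨?_, ?_⟩
      · rw [List.length_append, List.length_singleton, zipWith_append_singleton _ _ _ _ hrs,
          ← List.append_assoc]
        exact drawing_step hlen hspec.length_le (by rw [List.length_append]; omega) hrs h1 hvlt
      · have hmem : drawStep s v ∈ (drawBody.exec (s.tick 1)).support := by
          rw [drawBody_exec, PMF.support_map]
          refine ⟨v, ?_, rfl⟩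
          have : (cell 7 (cell 10 ctr)).eval s = (nbrList a dg D q[rs.length]).length := by
            simp [NExpr.eval, ctr, h1.ctr, h1.queue _ hrs, h1.cnt]
          rw [this]
          exact hv
        have h3 := (exec_bound (by simp [drawBody, storeDraw, emit, incr, LoopFree]) hW
          (s := s.tick 1) h1.bdd hmem).1
        rw [List.length_append, List.length_singleton]
        have e : (rs.length + 1) * ((drawBody.kt + 1) * B) =
          rs.length * ((drawBody.kt + 1) * B) + (drawBody.kt * B + B) := by ring
        rw [e]
        simp only [State.tick, ← hB] at h3
        omega)
  refine ⟨q, hspec, fun rs => finish.det (rs.foldl drawStep s₂), ?_, ?_⟩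
  · rw [buildProg, Prog.exec, exec_eq_pure (by
      simp [prepare, copyBody, countBody, sortBody, queueBody, emit, incr, reset, SampleFree]),
      PMF.pure_bind, Prog.exec, Prog.exec, ← hs₁, hQ, ← hs₂, hloop.1, PMF.bind_map,
      ← PMF.bind_pure_comp]
    refine congrArg _ (funext fun rs => ?_)
    rw [Function.comp_apply, Function.comp_apply, exec_eq_pure (by simp [finish, SampleFree])]
  · intro rs hrs
    obtain ⟨h1, h2, h3⟩ := hloop.2 rs hrs
    have hz : (List.zipWith (drawRec a dg D) q rs).length ≤ rs.length := by simp
    have hql := hspec.length_le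
    refine ⟨h1, sketch_of_drawing (by rw [List.length_append]; omega) h2, ?_⟩
    have h4 := (runs_of_loopFree (p := finish) (by simp [finish, LoopFree])
      (by simp [finish, SampleFree]) hW (s := rs.foldl drawStep s₂) h2.bdd
      (Q := fun _ _ => True) trivial).2
    refine h4.trans ((Nat.add_le_add_right (h3.trans (Nat.add_le_add_right ht2 _)) _).trans ?_)
    rw [← hB]
    calc _ = (prepareConst * (l.length + 1) + headCost numQ + rs.length * (drawBody.kt + 1) +
          finish.kt) * B := by ring
      _ ≤ _ := by
        refine Nat.mul_le_mul_right _ ?_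
        simp only [buildConst]
        generalize headCost numQ = c₁
        generalize drawBody.kt + 1 = c₂
        generalize finish.kt = c₃
        generalize prepareConst = c₄
        -- The queue is no longer than the list of darts, whence the factor `2` in `buildConst`.
        have : rs.length * c₂ ≤ (l.length + l.length) * c₂ :=
          Nat.mul_le_mul_right _ (by omega)
        nlinarith [Nat.zero_le (c₁ * l.length), Nat.zero_le (c₂ * l.length),
          Nat.zero_le (c₃ * l.length)]

end Construction

end ExpanderSketch

namespace ExpanderSketch
open Finset

/-! ### Queries: program text, value and running time -/

section Query

open Prog

/-! ### The query program -/

theorem rwrite_real (s : State) (arr i : ℕ) (v : ℝ) (arr' i' : ℕ) :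
    (s.rwrite arr i v).real arr' i' = if arr' = arr ∧ i' = i then v else s.real arr' i' := by
  by_cases h : arr' = arr
  · subst h
    by_cases h' : i' = i
    · subst h'; simp [State.rwrite]
    · simp [State.rwrite, h']
  · simp [State.rwrite, h]

theorem rwrite_nat (s : State) (arr i : ℕ) (v : ℝ) : (s.rwrite arr i v).nat = s.nat := rfl

theorem write_real (s : State) (arr i v : ℕ) : (s.write arr i v).real = s.real := rfl

theorem tick_real (s : State) (k : ℕ) : (s.tick k).real = s.real := rfl

/-- The loop counter of the query program. -/
def qctr : NExpr := .cell 1 (.const 0)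
/-- The number of vertices, as stored in the sketch. -/
def skNumV : NExpr := .cell 0 (.const 1)
/-- The number of records of the sketch. -/
def skNumR : NExpr := .cell 0 (.const 3)
/-- The degree of the current vertex, as stored in the sketch. -/
def skDeg : NExpr := .cell 0 (.add (.const 4) qctr)
/-- The address of the current record. -/
def skAddr : NExpr := .add (.add skNumV (.const 4)) (.add (.add qctr qctr) qctr)
/-- A real register. -/
def reg (k : ℕ) : RExpr := .cell 2 (.const k)
/-- The current entry of the query vector. -/
def curX : RExpr := .cell 0 qctr
/-- An entry of the query vector, centered. -/
def centeredAt (e : NExpr) : RExpr := .sub (.cell 0 e) (reg 2)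

/-- Advance the loop counter. -/
def qincr : Prog := .assign 1 (.const 0) (.add qctr (.const 1))
/-- Reset the loop counter. -/
def qreset : Prog := .assign 1 (.const 0) (.const 0)

/-- Accumulate the weighted mean. -/
def meanBody : Prog :=
  .seq (.rassign 2 (.const 0) (.add (reg 0) (.mul (.ofNat skDeg) curX)))
    (.seq (.rassign 2 (.const 1) (.add (reg 1) (.ofNat skDeg))) qincr)

/-- Accumulate the diagonal part. -/
def diagBody : Prog :=
  .seq (.rassign 2 (.const 3) (.add (reg 3)
    (.mul (.mul (centeredAt qctr) (centeredAt qctr)) (.ofNat skDeg)))) qincr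

/-- Accumulate the contribution of a record. -/
def recBody : Prog :=
  .seq (.rassign 2 (.const 4) (.add (reg 4)
    (.mul (.ofNat (.cell 0 (.add skAddr (.const 2))))
      (.mul (centeredAt (.cell 0 skAddr)) (centeredAt (.cell 0 (.add skAddr (.const 1)))))))) qincr

/-- Compute the mean. -/
def meanEnd : Prog := .seq (.rassign 2 (.const 2) (.div (reg 0) (reg 1))) qreset

/-- Write the answer. -/
def answerEnd : Prog :=
  .rassign 1 (.const 0) (.sub (reg 3) (.div (reg 4) (.ofNat (.cell 0 (.const 2)))))

/-- The query program. -/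
def queryProg : Prog :=
  .seq (.loop skNumV meanBody) (.seq meanEnd (.seq (.loop skNumV diagBody) (.seq qreset
    (.seq (.loop skNumR recBody) answerEnd))))

/-- The weighted mean of the query vector `X`, the cells of the sketch being `g`. -/
noncomputable def cellMean (g : ℕ → ℕ) (X : ℕ → ℝ) : ℝ :=
  (∑ i ∈ range (g 1), (g (4 + i) : ℝ) * X i) / ∑ i ∈ range (g 1), (g (4 + i) : ℝ)

/-- The contribution of a record. -/
noncomputable def cellTerm (g : ℕ → ℕ) (X : ℕ → ℝ) (c : ℝ) (j : ℕ) : ℝ :=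
  (g (g 1 + 4 + (j + j + j) + 2) : ℝ) *
    ((X (g (g 1 + 4 + (j + j + j))) - c) * (X (g (g 1 + 4 + (j + j + j) + 1)) - c))

/-- The answer to the query `X`, the cells of the sketch being `g`. -/
noncomputable def cellValue (g : ℕ → ℕ) (X : ℕ → ℝ) : ℝ :=
  (∑ i ∈ range (g 1), (X i - cellMean g X) * (X i - cellMean g X) * (g (4 + i) : ℝ)) -
    (∑ j ∈ range (g 3), cellTerm g X (cellMean g X) j) / (g 2 : ℝ)

/-- The memory during a query. -/
structure Querying (g : ℕ → ℕ) (X : ℕ → ℝ) (W t : ℕ) (v₀ v₁ v₂ v₃ v₄ : ℝ) (M : ℕ → ℕ → ℕ)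
    (R : ℕ → ℕ → ℝ) : Prop where
  cells : ∀ i, M 0 i = g i
  ctr : M 1 0 = t
  bdd : Bdd W M
  vec : ∀ i, R 0 i = X i
  reg₀ : R 2 0 = v₀
  reg₁ : R 2 1 = v₁
  reg₂ : R 2 2 = v₂
  reg₃ : R 2 3 = v₃
  reg₄ : R 2 4 = v₄

variable {g : ℕ → ℕ} {X : ℕ → ℝ} {W t : ℕ} {v₀ v₁ v₂ v₃ v₄ : ℝ} {s : State}

theorem Querying.meanBody (h : Querying g X W t v₀ v₁ v₂ v₃ v₄ s.nat s.real) (ht : t + 1 ≤ W) :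
    Querying g X W (t + 1) (v₀ + g (4 + t) * X t) (v₁ + g (4 + t)) v₂ v₃ v₄
      (meanBody.det s).nat (meanBody.det s).real := by
  have hM : (ExpanderSketch.meanBody.det s).nat = upd s.nat 1 0 (t + 1) := by
    simp [ExpanderSketch.meanBody, qincr, Prog.det, NExpr.eval, write_nat, tick_nat, rwrite_nat,
      qctr, h.ctr]
  rw [hM]
  refine ⟨by simpa [upd_apply] using h.cells, by simp [upd_apply], h.bdd.upd _ _ ht, ?_, ?_, ?_,
    ?_, ?_, ?_⟩ <;>
    simp [ExpanderSketch.meanBody, qincr, Prog.det, NExpr.eval, RExpr.eval, write_real, tick_real,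
      rwrite_real, tick_nat, rwrite_nat, reg, skDeg, curX, qctr, h.ctr, h.cells, h.vec, h.reg₀,
      h.reg₁, h.reg₂, h.reg₃, h.reg₄]

theorem Querying.diagBody (h : Querying g X W t v₀ v₁ v₂ v₃ v₄ s.nat s.real) (ht : t + 1 ≤ W) :
    Querying g X W (t + 1) v₀ v₁ v₂ (v₃ + (X t - v₂) * (X t - v₂) * g (4 + t)) v₄
      (diagBody.det s).nat (diagBody.det s).real := by
  have hM : (ExpanderSketch.diagBody.det s).nat = upd s.nat 1 0 (t + 1) := by
    simp [ExpanderSketch.diagBody, qincr, Prog.det, NExpr.eval, write_nat, tick_nat, rwrite_nat,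
      qctr, h.ctr]
  rw [hM]
  refine ⟨by simpa [upd_apply] using h.cells, by simp [upd_apply], h.bdd.upd _ _ ht, ?_, ?_, ?_,
    ?_, ?_, ?_⟩ <;>
    simp [ExpanderSketch.diagBody, qincr, Prog.det, NExpr.eval, RExpr.eval, write_real, tick_real,
      rwrite_real, reg, skDeg, centeredAt, qctr, h.ctr, h.cells, h.vec,
      h.reg₀, h.reg₁, h.reg₂, h.reg₃, h.reg₄]

theorem Querying.recBody (h : Querying g X W t v₀ v₁ v₂ v₃ v₄ s.nat s.real) (ht : t + 1 ≤ W) :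
    Querying g X W (t + 1) v₀ v₁ v₂ v₃ (v₄ + cellTerm g X v₂ t)
      (recBody.det s).nat (recBody.det s).real := by
  have hM : (ExpanderSketch.recBody.det s).nat = upd s.nat 1 0 (t + 1) := by
    simp [ExpanderSketch.recBody, qincr, Prog.det, NExpr.eval, write_nat, tick_nat, rwrite_nat,
      qctr, h.ctr]
  rw [hM]
  refine ⟨by simpa [upd_apply] using h.cells, by simp [upd_apply], h.bdd.upd _ _ ht, ?_, ?_, ?_,
    ?_, ?_, ?_⟩ <;>
    simp [ExpanderSketch.recBody, qincr, Prog.det, NExpr.eval, RExpr.eval, write_real, tick_real,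
      rwrite_real, reg, skAddr, skNumV, centeredAt, qctr, h.ctr, h.cells,
      h.vec, h.reg₀, h.reg₁, h.reg₂, h.reg₃, h.reg₄, cellTerm]

theorem Querying.meanEnd (h : Querying g X W t v₀ v₁ v₂ v₃ v₄ s.nat s.real) :
    Querying g X W 0 v₀ v₁ (v₀ / v₁) v₃ v₄ (meanEnd.det s).nat (meanEnd.det s).real := by
  have hM : (ExpanderSketch.meanEnd.det s).nat = upd s.nat 1 0 0 := by
    simp [ExpanderSketch.meanEnd, qreset, Prog.det, NExpr.eval, write_nat, tick_nat, rwrite_nat]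
  rw [hM]
  refine ⟨by simpa [upd_apply] using h.cells, by simp [upd_apply],
    h.bdd.upd _ _ (Nat.zero_le _), ?_, ?_, ?_, ?_, ?_, ?_⟩ <;>
    simp [ExpanderSketch.meanEnd, qreset, Prog.det, NExpr.eval, RExpr.eval, write_real, tick_real,
      rwrite_real, reg, h.vec, h.reg₀, h.reg₁, h.reg₃, h.reg₄]

theorem Querying.qreset (h : Querying g X W t v₀ v₁ v₂ v₃ v₄ s.nat s.real) :
    Querying g X W 0 v₀ v₁ v₂ v₃ v₄ (qreset.det s).nat (qreset.det s).real := by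
  have hM : (ExpanderSketch.qreset.det s).nat = upd s.nat 1 0 0 := by
    simp [ExpanderSketch.qreset, Prog.det, NExpr.eval, write_nat, tick_nat]
  rw [hM]
  exact ⟨by simpa [upd_apply] using h.cells, by simp [upd_apply],
    h.bdd.upd _ _ (Nat.zero_le _), h.vec, h.reg₀, h.reg₁, h.reg₂, h.reg₃, h.reg₄⟩

/-- A constant for the running time of a query. -/
def queryConst : ℕ :=
  2 * headCost skNumV + headCost skNumR + (meanBody.kt + 1) + (diagBody.kt + 1) +
    (recBody.kt + 1) + meanEnd.kt + qreset.kt + answerEnd.kt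

/-- Two loops over the vertices and one over the records, each accumulating a partial sum in a real
register. The sketch itself is never overwritten. -/
theorem queryProg_runs {N K : ℕ} (hN : g 1 = N) (hK : g 3 = K) (hW : 1 ≤ W)
    (h : Querying g X W 0 0 0 0 0 0 s.nat s.real) :
    queryProg.Runs s (queryConst * (N + K + 1) * (W.size + 1)) fun _ R => R 1 0 = cellValue g X := by
  set B := W.size + 1 with hB
  -- The numbers of passes are themselves stored cells, so the loop counter never exceeds `W`.
  have hgW : ∀ i, g i ≤ W := fun i => (h.cells i).symm.trans_le (h.bdd 0 i)
  have hNW : N ≤ W := hN ▸ hgW 1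
  have hKW : K ≤ W := hK ▸ hgW 3
  set c := cellMean g X with hc
  set d := ∑ i ∈ range N, (X i - c) * (X i - c) * (g (4 + i) : ℝ) with hd
  set r := ∑ j ∈ range K, cellTerm g X c j with hr
  set A₀ : ℕ → ℝ := fun t => ∑ i ∈ range t, (g (4 + i) : ℝ) * X i with hA₀
  set A₁ : ℕ → ℝ := fun t => ∑ i ∈ range t, (g (4 + i) : ℝ) with hA₁
  have hmean : A₀ N / A₁ N = c := by rw [hc, cellMean, hN]
  have h1 : (Prog.loop skNumV meanBody).Runs s ((headCost skNumV + N * (meanBody.kt + 1)) * B)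
      fun M R => Querying g X W N (A₀ N) (A₁ N) 0 0 0 M R :=
    runs_loop (by simp [meanBody, qincr, LoopFree]) (by simp [meanBody, qincr, SampleFree]) hW
      (by simp [NExpr.eval, skNumV, h.cells, hN])
      (fun t M R => Querying g X W t (A₀ t) (A₁ t) 0 0 0 M R) (fun t M R h => h.bdd)
      (by simpa [hA₀, hA₁] using h)
      (fun t ht s h => by
        simp only [hA₀, hA₁, sum_range_succ]
        exact h.meanBody (by omega))
  have h2 : ∀ s : State, Querying g X W N (A₀ N) (A₁ N) 0 0 0 s.nat s.real →
      meanEnd.Runs s (meanEnd.kt * B)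
        fun M R => Querying g X W 0 (A₀ N) (A₁ N) c 0 0 M R :=
    fun s h => runs_of_loopFree (by simp [meanEnd, qreset, LoopFree])
      (by simp [meanEnd, qreset, SampleFree]) hW h.bdd (hmean ▸ h.meanEnd)
  have h3 : ∀ s : State, Querying g X W 0 (A₀ N) (A₁ N) c 0 0 s.nat s.real →
      (Prog.loop skNumV diagBody).Runs s ((headCost skNumV + N * (diagBody.kt + 1)) * B)
        fun M R => Querying g X W N (A₀ N) (A₁ N) c d 0 M R :=
    fun s h => runs_loop (by simp [diagBody, qincr, LoopFree])
      (by simp [diagBody, qincr, SampleFree]) hW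
      (by simp [NExpr.eval, skNumV, h.cells, hN])
      (fun t M R => Querying g X W t (A₀ N) (A₁ N) c
        (∑ i ∈ range t, (X i - c) * (X i - c) * (g (4 + i) : ℝ)) 0 M R) (fun t M R h => h.bdd)
      (by simpa using h)
      (fun t ht s h => by
        simp only [sum_range_succ]
        exact h.diagBody (by omega))
  have h4 : ∀ s : State, Querying g X W N (A₀ N) (A₁ N) c d 0 s.nat s.real →
      qreset.Runs s (qreset.kt * B)
        fun M R => Querying g X W 0 (A₀ N) (A₁ N) c d 0 M R :=
    fun s h => runs_of_loopFree (by simp [qreset, LoopFree])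
      (by simp [qreset, SampleFree]) hW h.bdd h.qreset
  have h5 : ∀ s : State, Querying g X W 0 (A₀ N) (A₁ N) c d 0 s.nat s.real →
      (Prog.loop skNumR recBody).Runs s ((headCost skNumR + K * (recBody.kt + 1)) * B)
        fun M R => Querying g X W K (A₀ N) (A₁ N) c d r M R :=
    fun s h => runs_loop (by simp [recBody, qincr, LoopFree])
      (by simp [recBody, qincr, SampleFree]) hW
      (by simp [NExpr.eval, skNumR, h.cells, hK])
      (fun t M R => Querying g X W t (A₀ N) (A₁ N) c d (∑ j ∈ range t, cellTerm g X c j) M R)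
      (fun t M R h => h.bdd) (by simpa using h)
      (fun t ht s h => by
        simp only [sum_range_succ]
        exact h.recBody (by omega))
  have h6 : ∀ s : State, Querying g X W K (A₀ N) (A₁ N) c d r s.nat s.real →
      answerEnd.Runs s (answerEnd.kt * B) fun _ R => R 1 0 = cellValue g X :=
    fun s h => runs_of_loopFree (p := answerEnd) (by simp [answerEnd, LoopFree])
      (by simp [answerEnd, SampleFree]) hW h.bdd (Q := fun _ R => R 1 0 = cellValue g X) (by
        simp [answerEnd, Prog.det, RExpr.eval, NExpr.eval, tick_real, rwrite_real, reg, h.reg₃,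
          h.reg₄, h.cells, cellValue, hN, hK, ← hc, ← hd, ← hr])
  have key := h1.seq fun s hs => (h2 s hs).seq fun s hs => (h3 s hs).seq fun s hs =>
    (h4 s hs).seq fun s hs => (h5 s hs).seq h6
  refine ⟨key.1, key.2.trans (Nat.add_le_add_left ?_ _)⟩
  calc _ = (headCost skNumV + N * (meanBody.kt + 1) + meanEnd.kt +
        (headCost skNumV + N * (diagBody.kt + 1)) + qreset.kt +
        (headCost skNumR + K * (recBody.kt + 1)) + answerEnd.kt) * B := by ring
    _ ≤ _ := by
        refine Nat.mul_le_mul_right _ ?_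
        simp only [queryConst]
        generalize headCost skNumV = c₁
        generalize headCost skNumR = c₂
        generalize meanBody.kt + 1 = c₃
        generalize diagBody.kt + 1 = c₄
        generalize recBody.kt + 1 = c₅
        generalize meanEnd.kt = c₆
        generalize qreset.kt = c₇
        generalize answerEnd.kt = c₈
        have : (2 * c₁ + c₂ + c₃ + c₄ + c₅ + c₆ + c₇ + c₈) * (N + K + 1) =
          (2 * c₁ + c₂ + c₃ + c₄ + c₅ + c₆ + c₇ + c₈) + N * c₃ + N * c₄ + K * c₅ +
          (2 * c₁ + c₂ + c₅ + c₆ + c₇ + c₈) * N + (2 * c₁ + c₂ + c₃ + c₄ + c₆ + c₇ + c₈) * K := by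
          ring
        rw [this]
        omega

theorem queryProg_sampleFree : queryProg.SampleFree := by
  simp [queryProg, meanBody, diagBody, recBody, meanEnd, answerEnd, qreset, qincr, SampleFree]

/-- The cells of a stored sketch. -/
def cellsOf (dat : List ℕ) (i : ℕ) : ℕ := (dat.length :: dat).getD i 0

/-- The entries of a vector, continued by zero. -/
def entries {n : ℕ} (x : Fin n → ℝ) (i : ℕ) : ℝ := if h : i < n then x ⟨i, h⟩ else 0

theorem query_spec {n : ℕ} (dat : List ℕ) (x : Fin n → ℝ) (hW : 1 ≤ W)
    (hdat : ∀ i, cellsOf dat i ≤ W) {s : State} (hs : s ∈ (queryProg.exec (queryInput dat x)).support) :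
    s.answer = cellValue (cellsOf dat) (entries x) ∧
      s.time ≤ queryConst * (cellsOf dat 1 + cellsOf dat 3 + 1) * (W.size + 1) := by
  rw [exec_eq_pure queryProg_sampleFree, PMF.support_pure, Set.mem_singleton_iff] at hs
  subst hs
  have h0 : Querying (cellsOf dat) (entries x) W 0 0 0 0 0 0 (queryInput dat x).nat
      (queryInput dat x).real := by
    refine ⟨fun i => rfl, rfl, ?_, fun i => rfl, rfl, rfl, rfl, rfl, rfl⟩
    intro arr i
    by_cases h : arr = 0
    · subst h
      exact hdat i
    · simp [queryInput, h]
  obtain ⟨h1, h2⟩ := queryProg_runs rfl rfl hW h0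
  exact ⟨h1, h2.trans (by simp [queryInput])⟩

end Query

end ExpanderSketch

namespace ExpanderSketch
open Finset

/-! ### From the queue of the machine to the independent draws -/

section Law

variable {n : ℕ}

/-! ### The darts of a graph -/

/-- `D` lists every ordered pair of adjacent vertices exactly once. -/
structure IsDartList (H : SimpleGraph (Fin n)) (D : List (Fin n × Fin n)) : Prop where
  nodup : D.Nodup
  mem_iff : ∀ u v, (u, v) ∈ D ↔ H.Adj u v

/-- Every edge is listed once, so a reversed pair can coincide with a listed one only if it is a
loop, and there are none. -/
theorem isDartList_darts {H : SimpleGraph (Fin n)} {l : List (Fin n × Fin n)}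
    (hl : IsEdgeList H l) : IsDartList H (darts l) := by
  have hadj : ∀ p ∈ l, H.Adj p.1 p.2 := fun p hp => by
    have := (hl.2 s(p.1, p.2)).1 (List.mem_map.2 ⟨p, hp, rfl⟩)
    simpa using this
  have hinj : ∀ p ∈ l, ∀ p' ∈ l, s(p.1, p.2) = s(p'.1, p'.2) → p = p' := fun p hp p' hp' h =>
    List.inj_on_of_nodup_map hl.1 hp hp' h
  constructor
  · rw [darts, List.nodup_append]
    refine ⟨hl.1.of_map, (List.nodup_map_iff Prod.swap_injective).2 hl.1.of_map, ?_⟩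
    rintro p hp p' hp' rfl
    obtain ⟨p', hp2, rfl⟩ := List.mem_map.1 hp'
    have := hinj _ hp _ hp2 Sym2.eq_swap
    have h1 : p'.2 = p'.1 := congrArg Prod.fst this
    exact H.loopless.irrefl p'.1 (by simpa [h1] using hadj p' hp2)
  · intro u v
    rw [darts, List.mem_append, List.mem_map]
    constructor
    · rintro (h | ⟨p, hp, h⟩)
      · exact hadj _ h
      · have := hadj p hp
        rw [Prod.swap_eq_iff_eq_swap] at h
        subst h
        exact this.symm
    · intro h
      have := (hl.2 s(u, v)).2 (by simpa using h)
      obtain ⟨p, hp, he⟩ := List.mem_map.1 this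
      rw [Sym2.eq_iff] at he
      rcases he with ⟨rfl, rfl⟩ | ⟨rfl, rfl⟩
      · exact Or.inl hp
      · exact Or.inr ⟨p, hp, rfl⟩

theorem length_eq_card_edgeFinset {H : SimpleGraph (Fin n)} [DecidableRel H.Adj]
    {l : List (Fin n × Fin n)} (hl : IsEdgeList H l) : l.length = H.edgeFinset.card := by
  rw [← List.length_map (f := fun p : Fin n × Fin n => s(p.1, p.2)),
    ← List.toFinset_card_of_nodup hl.1]
  congr 1
  ext e
  rw [List.mem_toFinset, hl.2, SimpleGraph.mem_edgeFinset]

theorem countP_eq_sum_map {α : Type*} (p : α → Bool) (l : List α) :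
    l.countP p = (l.map fun d => if p d then 1 else 0).sum := by
  induction l with
  | nil => rfl
  | cons d l ih => rw [List.countP_cons, ih, List.map_cons, List.sum_cons, add_comm]

variable {H : SimpleGraph (Fin n)} [DecidableRel H.Adj] {D : List (Fin n × Fin n)} {a : ℕ}

/-- The bridge from lists to graphs: degrees, the number of exact records and the exact part of the
answer are all read off through it. -/
theorem IsDartList.sum_map (hD : IsDartList H D) {A : Type*} [AddCommMonoid A]
    (F : Fin n × Fin n → A) :
    (D.map F).sum = ∑ u, ∑ v, if H.Adj u v then F (u, v) else 0 := by
  rw [← List.sum_toFinset _ hD.nodup, ← sum_product', ← sum_filter]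
  refine sum_congr ?_ fun _ _ => rfl
  ext ⟨u, v⟩
  simp [hD.mem_iff]

theorem IsDartList.outDeg_eq (hD : IsDartList H D) : outDeg D = fun u => H.degree u := by
  funext u
  have h1 : outDeg D u = (D.map fun d => if d.1 = u then 1 else 0).sum := by
    rw [outDeg, List.count_eq_countP, List.countP_map, countP_eq_sum_map]
    simp
  rw [h1, hD.sum_map, sum_eq_single u]
  · simp only [if_true]
    rw [← card_filter, ← SimpleGraph.card_neighborFinset_eq_degree]
    congr 1
    ext v
    simp
  · intro w _ hw
    simp [hw]
  · simp

theorem IsDartList.nodup_nbrList {H : SimpleGraph (Fin n)} (hD : IsDartList H D) (dg : Fin n → ℕ)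
    (u : Fin n) :
    (nbrList a dg D u).Nodup := by
  rw [nbrList]
  refine (hD.nodup.filter _).map_on ?_
  rintro ⟨p, p'⟩ hp ⟨r, r'⟩ hr h
  simp only [List.mem_filter, decide_eq_true_eq] at hp hr
  exact Prod.ext (hp.2.1.trans hr.2.1.symm) h

theorem IsDartList.mem_nbrList (hD : IsDartList H D) (u v : Fin n) :
    v ∈ nbrList a (fun u => H.degree u) D u ↔ u ∈ highSet H a ∧ v ∈ highNbrs H a u := by
  rw [nbrList, List.mem_map, mem_highSet, mem_highNbrs]
  simp only [List.mem_filter, decide_eq_true_eq]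
  constructor
  · rintro ⟨⟨p, p'⟩, ⟨h1, rfl, h2⟩, rfl⟩
    rw [hD.mem_iff] at h1
    simp only [not_or, not_le] at h2
    exact ⟨h2.1, h2.2, h1⟩
  · rintro ⟨h1, h2, h3⟩
    refine ⟨(u, v), ⟨(hD.mem_iff u v).2 h3, rfl, ?_⟩, rfl⟩
    simp only [not_or, not_le]
    exact ⟨h1, h2⟩

theorem IsDartList.length_nbrList (hD : IsDartList H D) {u : Fin n} (hu : u ∈ highSet H a) :
    (nbrList a (fun u => H.degree u) D u).length = (highNbrs H a u).card := by
  rw [← List.toFinset_card_of_nodup (hD.nodup_nbrList _ u)]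
  congr 1
  ext v
  simp [hD.mem_nbrList, hu]

/-- An exact dart is outgoing or incoming at a low vertex, and each of the at most `n` low vertices
has at most `a` darts of either kind. -/
theorem length_lowRecs_le (hD : IsDartList H D) :
    (lowRecs a (fun u => H.degree u) D).length ≤ 2 * (n * a) := by
  have h1 : (lowRecs a (fun u => H.degree u) D).length =
      (D.map fun d => if H.degree d.1 ≤ a ∨ H.degree d.2 ≤ a then 1 else 0).sum := by
    rw [lowRecs, List.length_map, ← List.countP_eq_length_filter, countP_eq_sum_map]
    simp
  have hcard : ∀ u, (∑ v, if H.Adj u v then 1 else 0) = H.degree u := fun u => by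
    rw [← card_filter, ← SimpleGraph.card_neighborFinset_eq_degree]
    congr 1
    ext v
    simp
  have hle : ∀ u, (if H.degree u ≤ a then H.degree u else 0) ≤ a := fun u => by
    split_ifs with h
    · exact h
    · exact Nat.zero_le _
  have h2 : ∑ u, (if H.degree u ≤ a then H.degree u else 0) ≤ n * a := by
    refine (sum_le_sum fun u _ => hle u).trans ?_
    simp
  rw [h1, hD.sum_map]
  calc _ ≤ ∑ u, ∑ v, ((if H.degree u ≤ a then (if H.Adj u v then 1 else 0) else 0) +
        (if H.degree v ≤ a then (if H.Adj v u then 1 else 0) else 0)) := by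
        refine sum_le_sum fun u _ => sum_le_sum fun v _ => ?_
        by_cases hA : H.Adj u v <;> by_cases hu : H.degree u ≤ a <;>
          by_cases hv : H.degree v ≤ a <;> simp [hA, hu, hv, H.adj_comm v u]
    _ = (∑ u, (if H.degree u ≤ a then H.degree u else 0)) +
        ∑ v, (if H.degree v ≤ a then H.degree v else 0) := by
        simp_rw [sum_add_distrib]
        congr 1
        · refine sum_congr rfl fun u _ => ?_
          split_ifs
          · exact hcard u
          · simp
        · rw [sum_comm]
          refine sum_congr rfl fun u _ => ?_
          split_ifs
          · exact hcard u
          · simp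
    _ ≤ _ := by omega

/-! ### The queue -/

variable {q : List (Fin n)}

theorem QueueSpec.length_le_mul {dg : Fin n → ℕ} (hq : QueueSpec D dg a q) :
    q.length ≤ n * a := by
  have h := Multiset.sum_count_eq_card (s := univ) (m := (q : Multiset (Fin n))) (by simp)
  rw [Multiset.coe_card] at h
  rw [← h]
  refine (sum_le_sum (g := fun _ => a) fun u _ => ?_).trans (by simp)
  rw [Multiset.coe_count, hq.count]
  split_ifs
  · exact Nat.zero_le _
  · exact min_le_left _ _

theorem QueueSpec.drawer (hD : IsDartList H D) (hq : QueueSpec D (fun u => H.degree u) a q)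
    {u : Fin n} (hu : u ∈ q) : u ∈ highSet H a ∧ (highNbrs H a u).Nonempty := by
  obtain ⟨v, hv⟩ := List.exists_mem_of_ne_nil _ (hq.nbrList_ne_nil hu)
  rw [hD.mem_nbrList] at hv
  exact ⟨hv.1, v, hv.2⟩

/-- A drawing vertex has degree above `a`, so its darts suffice to queue it exactly `a` times. -/
theorem QueueSpec.count_drawer (hD : IsDartList H D)
    (hq : QueueSpec D (fun u => H.degree u) a q) (u : Drawer H a) : q.count (u : Fin n) = a := by
  obtain ⟨v, hv⟩ := u.2.2
  have hne : nbrList a (fun u => H.degree u) D u ≠ [] :=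
    List.ne_nil_of_mem ((hD.mem_nbrList _ v).2 ⟨u.2.1, hv⟩)
  rw [hq.count, if_neg hne, hD.outDeg_eq]
  exact min_eq_left ((mem_highSet H a).1 u.2.1).le

/-- The vertex whose turn it is. -/
def turn (hD : IsDartList H D) (hq : QueueSpec D (fun u => H.degree u) a q) (i : Fin q.length) :
    Drawer H a :=
  ⟨q[i], hq.drawer hD (List.getElem_mem i.2)⟩

theorem card_turn (hD : IsDartList H D) (hq : QueueSpec D (fun u => H.degree u) a q)
    (u : Drawer H a) : Fintype.card {i // turn hD hq i = u} = a := by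
  refine Eq.trans ?_ (hq.count_drawer hD u)
  rw [Fintype.card_subtype]
  have := Fin.card_filter_univ_eq_vector_get_eq_count (u : Fin n) (⟨q, rfl⟩ : List.Vector _ q.length)
  rw [List.Vector.toList_mk] at this
  rw [← this]
  congr 1
  ext i
  simp only [mem_filter, mem_univ, true_and, turn, Subtype.ext_iff]
  rfl

/-- The turns are in bijection with the draws of all the vertices. -/
noncomputable def turnEquiv (hD : IsDartList H D) (hq : QueueSpec D (fun u => H.degree u) a q) :
    Fin q.length ≃ (_ : Drawer H a) × Fin a :=
  (Equiv.sigmaFiberEquiv (turn hD hq)).symm.trans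
    (Equiv.sigmaCongrRight fun u => Fintype.equivFinOfCardEq (card_turn hD hq u))

theorem turnEquiv_fst (hD : IsDartList H D) (hq : QueueSpec D (fun u => H.degree u) a q)
    (i : Fin q.length) : (((turnEquiv hD hq i).1 : Drawer H a) : Fin n) = q[i] := rfl

theorem drawBound_eq (dg : Fin n → ℕ) (i : Fin q.length) :
    drawBound a dg D q i = (nbrList a dg D q[i]).length := by
  rw [drawBound, dif_pos i.2]
  rfl

/-- Each neighbour list enumerates the high neighbours without repetition, so position and neighbour
determine each other. Combined with the matching of turns and draws, this identifies outcome lists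
with elements of `Draws H a`. -/
theorem exists_turn_outcomes (hD : IsDartList H D)
    (hq : QueueSpec D (fun u => H.degree u) a q) :
    ∃ E : Draws H a ≃ ((i : Fin q.length) → Fin (drawBound a (fun u => H.degree u) D q i)),
      ∀ ω i (v : Fin n), (nbrList a (fun u => H.degree u) D q[i]).getD (E ω i) v =
        (ω (turnEquiv hD hq i).1 (turnEquiv hD hq i).2 : Fin n) := by
  set σ := turnEquiv hD hq with hσ
  have hmem : ∀ (ω : Draws H a) i,
      (ω (σ i).1 (σ i).2 : Fin n) ∈ nbrList a (fun u => H.degree u) D q[i] := fun ω i =>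
    (hD.mem_nbrList _ _).2 ⟨(σ i).1.2.1, (ω (σ i).1 (σ i).2).2⟩
  let G : Draws H a → ((i : Fin q.length) → Fin (drawBound a (fun u => H.degree u) D q i)) :=
    fun ω i => ⟨(nbrList a (fun u => H.degree u) D q[i]).idxOf (ω (σ i).1 (σ i).2 : Fin n), by
      rw [drawBound_eq]
      exact List.idxOf_lt_length_iff.2 (hmem ω i)⟩
  have hG : ∀ ω i (v : Fin n), (nbrList a (fun u => H.degree u) D q[i]).getD (G ω i) v =
      (ω (σ i).1 (σ i).2 : Fin n) := fun ω i v => by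
    have h := List.idxOf_lt_length_iff.2 (hmem ω i)
    rw [List.getD_eq_getElem _ _ h]
    exact List.getElem_idxOf h
  have hinj : Function.Injective G := by
    intro ω ω' h
    funext u j
    obtain ⟨i, hi⟩ := σ.surjective ⟨u, j⟩
    have h1 : (ω (σ i).1 (σ i).2 : Fin n) = ω' (σ i).1 (σ i).2 := by
      rw [← hG ω i q[i], ← hG ω' i q[i], h]
    rw [hi] at h1
    exact Subtype.ext h1
  have hsurj : Function.Surjective G := by
    intro r
    have hlt : ∀ (u : Drawer H a) (j : Fin a), (r (σ.symm ⟨u, j⟩) : ℕ) <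
        (nbrList a (fun u => H.degree u) D u).length := fun u j => by
      have h2 : drawBound a (fun u => H.degree u) D q (σ.symm ⟨u, j⟩) =
          (nbrList a (fun u => H.degree u) D u).length := by
        rw [drawBound_eq, ← turnEquiv_fst hD hq, ← hσ, Equiv.apply_symm_apply]
      exact (r (σ.symm ⟨u, j⟩)).2.trans_eq h2
    refine ⟨fun u j => ⟨(nbrList a (fun u => H.degree u) D u)[(r (σ.symm ⟨u, j⟩) : ℕ)]'(hlt u j),
      ((hD.mem_nbrList _ _).1 (List.getElem_mem (hlt u j))).2⟩, ?_⟩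
    funext i
    apply Fin.ext
    have hsi : σ.symm ⟨(σ i).1, (σ i).2⟩ = i := by simp
    have hi : (r i : ℕ) < (nbrList a (fun u => H.degree u) D q[i]).length := by
      rw [← drawBound_eq]
      exact (r i).2
    have hv : (r (σ.symm ⟨(σ i).1, (σ i).2⟩) : ℕ) = r i := by rw [hsi]
    change (nbrList a (fun u => H.degree u) D q[i]).idxOf
      ((nbrList a (fun u => H.degree u) D q[i])[(r (σ.symm ⟨(σ i).1, (σ i).2⟩) : ℕ)]'_) = _
    simp only [hv]
    exact (hD.nodup_nbrList _ _).idxOf_getElem _ hi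
  exact ⟨Equiv.ofBijective G ⟨hinj, hsurj⟩, hG⟩

end Law

end ExpanderSketch

namespace ExpanderSketch
open Finset

/-! ### The answer given by a stored sketch -/

section Value

variable {n m a : ℕ} {dg : Fin n → ℕ} {rl : List (ℕ × ℕ × ℕ)} {s : State}

theorem length_stored (s : State) : s.stored.length = s.nat 0 0 := by simp [State.stored]

theorem cellsOf_stored (s : State) {i : ℕ} (hi : i ≤ s.nat 0 0) :
    cellsOf s.stored i = s.nat 0 i := by
  cases i with
  | zero => simp [cellsOf, length_stored]
  | succ i => simp [cellsOf, State.stored, Nat.lt_of_succ_le hi]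

theorem cellsOf_stored_le {W : ℕ} (h : Bdd W s.nat) (i : ℕ) : cellsOf s.stored i ≤ W := by
  rcases le_or_gt i (s.nat 0 0) with hi | hi
  · rw [cellsOf_stored s hi]
    exact h 0 i
  · rw [cellsOf, List.getD_eq_default]
    · exact Nat.zero_le _
    · simp [length_stored]; omega

theorem bitLength_stored_le {W : ℕ} (h : Bdd W s.nat) :
    bitLength s.stored ≤ s.nat 0 0 * (2 * W.size + 2) := by
  rw [bitLength, ← length_stored s]
  refine (List.sum_le_card_nsmul _ (2 * W.size + 2) ?_).trans (by simp)
  intro w hw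
  obtain ⟨v, hv, rfl⟩ := List.mem_map.1 hw
  obtain ⟨i, -, rfl⟩ := List.mem_map.1 hv
  have := Nat.size_le_size (h 0 (i + 1))
  omega

theorem entries_val (x : Fin n → ℝ) (u : Fin n) : entries x u = x u := by simp [entries]

/-- The contribution of a record to the evaluation. -/
noncomputable def recTerm (x : Fin n → ℝ) (c : ℝ) (r : ℕ × ℕ × ℕ) : ℝ :=
  (r.2.2 : ℝ) * ((entries x r.1 - c) * (entries x r.2.1 - c))

/-- The answer that a sketch with the records `rl` gives. -/
theorem Sketch.cellValue_eq (h : Sketch n m a dg rl s.nat) (x : Fin n → ℝ) {c : ℝ}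
    (hc : c = (∑ u, (dg u : ℝ) * x u) / ∑ u, (dg u : ℝ)) :
    cellValue (cellsOf s.stored) (entries x) =
      (∑ u, (x u - c) ^ 2 * (dg u : ℝ)) - (rl.map (recTerm x c)).sum / a := by
  have hlen := h.len
  have g1 : cellsOf s.stored 1 = n := by rw [cellsOf_stored s (by omega), h.numV]
  have g2 : cellsOf s.stored 2 = a := by rw [cellsOf_stored s (by omega), h.thr]
  have g3 : cellsOf s.stored 3 = rl.length := by rw [cellsOf_stored s (by omega), h.recs.1]
  have g4 : ∀ u : Fin n, cellsOf s.stored (4 + u) = dg u := fun u => by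
    have := u.2
    rw [cellsOf_stored s (by omega), h.deg]
  have hmean : cellMean (cellsOf s.stored) (entries x) = c := by
    rw [cellMean, g1, sum_range, sum_range, hc]
    simp_rw [g4, entries_val]
  have hrec : ∀ j : Fin rl.length, cellTerm (cellsOf s.stored) (entries x) c j =
      recTerm x c rl[j] := fun j => by
    have hj := j.2
    obtain ⟨e1, e2, e3⟩ := h.recs.2 j j.2
    rw [cellTerm, g1, cellsOf_stored s (by omega), cellsOf_stored s (by omega),
      cellsOf_stored s (by omega), e1, e2, e3]
    rfl
  rw [cellValue, hmean, g1, g2, g3, sum_range, sum_range]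
  simp_rw [hrec, g4, entries_val]
  congr 1
  · refine sum_congr rfl fun u _ => by ring
  · congr 1
    rw [← List.sum_ofFn]
    congr 1
    refine List.ext_getElem (by simp) fun i h1 h2 => by simp

end Value

/-! ### Equality in law with the mathematical sketch -/

section SketchLaw

variable {n : ℕ} {H : SimpleGraph (Fin n)} [DecidableRel H.Adj] {D : List (Fin n × Fin n)} {a : ℕ}

/-- Exact records carry the weight `a` so that the final division by `a`, meant for the draws,
leaves them with weight one. -/
theorem sum_lowRecs (hD : IsDartList H D) (ha : 1 ≤ a) (x : Fin n → ℝ) (c : ℝ) :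
    ((lowRecs a (fun u => H.degree u) D).map (recTerm x c)).sum / a =
      ∑ u, ∑ v, if H.Adj u v ∧ (H.degree u ≤ a ∨ H.degree v ≤ a) then (x u - c) * (x v - c)
        else 0 := by
  have ha' : (a : ℝ) ≠ 0 := by positivity
  have h1 : ((lowRecs a (fun u => H.degree u) D).map (recTerm x c)).sum =
      (D.map fun d => if H.degree d.1 ≤ a ∨ H.degree d.2 ≤ a then
        (a : ℝ) * ((x d.1 - c) * (x d.2 - c)) else 0).sum := by
    rw [lowRecs, List.map_map]
    clear hD
    induction D with
    | nil => rfl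
    | cons d D ih =>
      rw [List.map_cons, List.sum_cons, ← ih, List.filter_cons]
      by_cases h : H.degree d.1 ≤ a ∨ H.degree d.2 ≤ a
      · simp [h, recTerm, entries_val]
      · simp [h]
  rw [h1, hD.sum_map, sum_div]
  refine sum_congr rfl fun u _ => ?_
  rw [sum_div]
  refine sum_congr rfl fun v _ => ?_
  by_cases hA : H.Adj u v <;> by_cases hB : H.degree u ≤ a ∨ H.degree v ≤ a <;> simp [hA, hB, ha']

theorem zipWith_ofFn {α β γ : Type*} (f : α → β → γ) (q : List α) (r : Fin q.length → β) :
    List.zipWith f q (List.ofFn r) = List.ofFn fun i => f q[i] (r i) :=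
  List.ext_getElem (by simp) fun i h1 h2 => by simp

/-- The answer to a query, as a function of the stored sketch. -/
noncomputable def sketchAnswer (n : ℕ) (dat : List ℕ) (x : Fin n → ℝ) : ℝ :=
  cellValue (cellsOf dat) (entries x)

/-- What the construction program achieves. -/
theorem build_law {l : List (Fin n × Fin n)} (hl : IsEdgeList H l) (ha : 1 ≤ a) :
    (buildProg.storedLaw l a).map (sketchAnswer n) = (sampleSketch H a).map expanderEval ∧
    ∀ s ∈ (buildProg.exec (buildInput l a)).support, ∃ rl : List (ℕ × ℕ × ℕ),
      rl.length ≤ 3 * (n * a) ∧ Sketch n l.length a (fun u => H.degree u) rl s.nat ∧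
      s.time ≤ buildConst * (l.length + 1) * ((cap n l.length a).size + 1) := by
  have hD := isDartList_darts hl
  obtain ⟨q, hq, F, hexec, hF⟩ := build_spec l a
  rw [hD.outDeg_eq] at hq hexec hF
  constructor
  -- A queued vertex has a neighbour to draw, and beyond the queue `drawBound` takes the default
  -- value `1`.
  · have hne : ∀ i, NeZero (drawBound a (fun u => H.degree u) (darts l) q i) := fun i => by
      rw [drawBound]
      split_ifs with h
      · exact ⟨(List.length_pos_iff.2 (hq.nbrList_ne_nil (List.getElem_mem h))).ne'⟩
      · exact ⟨one_ne_zero⟩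
    obtain ⟨E, hE⟩ := exists_turn_outcomes hD hq
    rw [Prog.storedLaw, hexec, PMF.map_comp, PMF.map_comp, sampleSketch, PMF.map_comp]
    have hdl := drawList_eq_map (drawBound a (fun u => H.degree u) (darts l) q) q.length
    have hmem : ∀ ω, (List.ofFn fun i => (E ω i : ℕ)) ∈
        (drawList (drawBound a (fun u => H.degree u) (darts l) q) q.length).support := fun ω => by
      rw [hdl, PMF.support_map]
      exact ⟨E ω, by simp, rfl⟩
    -- Both laws become images of the uniform law on `Draws H a`, so it suffices to compare the
    -- answers for each `ω`.
    rw [hdl, PMF.map_comp, ← uniformOfFintype_map_equiv E, PMF.map_comp]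
    refine congrArg (fun f => PMF.map f _) (funext fun ω => funext fun x => ?_)
    simp only [Function.comp_apply]
    rw [sketchAnswer, (hF _ (hmem ω)).2.1.cellValue_eq x rfl, expanderEval_sketchOf,
      List.map_append, List.sum_append, add_div, sum_lowRecs hD ha, exactPart, sub_sub]
    congr 2
    -- The sum over the queue is reindexed by `turnEquiv` into the sum over drawing vertices and
    -- their draws.
    rw [zipWith_ofFn, List.map_ofFn, List.sum_ofFn, sum_div, ← Fintype.sum_sigma
      (fun p : (_ : Drawer H a) × Fin a => ((highNbrs H a p.1).card : ℝ) / a *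
        (centered H x p.1 * centered H x (ω p.1 p.2))), ← (turnEquiv hD hq).sum_comp]
    refine sum_congr rfl fun i _ => ?_
    have hcard : (nbrList a (fun u => H.degree u) (darts l) q[i]).length = (highNbrs H a q[i]).card :=
      hD.length_nbrList (hq.drawer hD (List.getElem_mem i.2)).1
    rw [Function.comp_apply, recTerm, drawRec, hE, entries_val, entries_val]
    dsimp only
    generalize ((ω (turnEquiv hD hq i).1 (turnEquiv hD hq i).2 : _) : Fin n) = v
    rw [hcard, turnEquiv_fst hD hq i]
    simp only [centered]
    ring
  · intro s hs
    rw [hexec, PMF.support_map] at hs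
    obtain ⟨rs, hrs, rfl⟩ := hs
    obtain ⟨h1, h2, h3⟩ := hF rs hrs
    refine ⟨_, ?_, h2, h3⟩
    have e1 := length_lowRecs_le (a := a) hD
    have e2 := hq.length_le_mul
    rw [List.length_append, List.length_zipWith]
    omega

end SketchLaw

/-! ### Bit length of the numbers in use -/

section Bounds

/-- `cap` is at most a constant times the cube of `x = n + α + 2`, so its bit length is of order
`log x`; since `x ≥ 4`, additive constants are absorbed as well. -/
theorem size_cap_le {n m a : ℕ} {α : ℝ} (hn : 1 ≤ n) (hα : 1 ≤ α) (hm : m ≤ n ^ 2)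
    (ha : (a : ℝ) ≤ α + 1) :
    (((cap n m a).size + 1 : ℕ) : ℝ) ≤ 10 * Real.log ((n : ℝ) + α + 2) := by
  set x : ℝ := (n : ℝ) + α + 2 with hx
  have hn' : (1 : ℝ) ≤ n := by exact_mod_cast hn
  have hm' : (m : ℝ) ≤ (n : ℝ) ^ 2 := by exact_mod_cast hm
  have hx4 : 4 ≤ x := by linarith
  have hcap : (cap n m a : ℝ) ≤ 2 ^ 5 * x ^ 3 := by
    have hnx : (n : ℝ) ≤ x := by linarith
    have hmx : (m : ℝ) ≤ x ^ 2 := hm'.trans (by gcongr)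
    have h1 : (n : ℝ) * m ≤ x * x ^ 2 := by gcongr
    have h2 : x ≤ x ^ 3 := by nlinarith [sq_nonneg x, mul_nonneg (by linarith : 0 ≤ x) (sq_nonneg x)]
    have h3 : x ^ 2 ≤ x ^ 3 := by nlinarith [sq_nonneg x]
    have h4 : (1 : ℝ) ≤ x ^ 3 := by linarith
    simp only [cap]
    push_cast
    nlinarith
  have hlog2 := Real.log_two_gt_d9
  have hlog4 : 2 * Real.log 2 ≤ Real.log x := by
    have : Real.log 4 ≤ Real.log x := Real.log_le_log (by norm_num) hx4
    rwa [show (4 : ℝ) = 2 ^ 2 by norm_num, Real.log_pow] at this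
  have hpos : 0 < (cap n m a).size := Nat.size_pos.2 (one_le_cap n m a)
  obtain ⟨k, hk⟩ := Nat.exists_eq_succ_of_ne_zero hpos.ne'
  have hpow : 2 ^ k ≤ cap n m a := Nat.lt_size.1 (by omega)
  have hpow' : (2 : ℝ) ^ k ≤ 2 ^ 5 * x ^ 3 :=
    le_trans (by exact_mod_cast hpow) hcap
  have hlog := Real.log_le_log (by positivity) hpow'
  rw [Real.log_pow, Real.log_mul (by positivity) (by positivity), Real.log_pow,
    Real.log_pow] at hlog
  rw [hk]
  push_cast at hlog ⊢
  have hlx : 0 < Real.log x := by linarith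
  -- Here `k ≤ 5 + 3 log x / log 2`. As `log x ≥ 2 log 2`, the constant `7` costs less than `5.1 log
  -- x` and the other term less than `4.4 log x`.
  have hkk : (k : ℝ) + 2 ≤ 10 * Real.log x := by
    by_contra hcon
    push Not at hcon
    nlinarith
  linarith

end Bounds

end ExpanderSketch

open ExpanderSketch MeasureTheory ProbabilityTheory Matrix in
theorem lemma4p1 :
    -- one construction program, one query program, and absolute constants
    ∃ (build query : Prog) (C : ℝ) (k : ℕ),
      ∀ (n : ℕ) (_ : 1 ≤ n) (H : SimpleGraph (Fin n)) [DecidableRel H.Adj]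
        (l : List (Fin n × Fin n)) (_ : IsEdgeList H l) (α : ℝ) (_ : 1 ≤ α),
        -- construction time
        (∀ s ∈ (build.exec (buildInput l ⌈α⌉₊)).support,
          (s.time : ℝ) ≤
            C * ((H.edgeFinset.card : ℝ) + 1) * Real.log ((n : ℝ) + α + 2) ^ k) ∧
        -- space
        (∀ dat ∈ (build.storedLaw l ⌈α⌉₊).support,
          (bitLength dat : ℝ) ≤ C * ((n : ℝ) * α) * Real.log ((n : ℝ) + α + 2) ^ k) ∧
        -- `f dat x` is the answer to the query `x` to the stored sketch `dat`
        ∃ f : List ℕ → (Fin n → ℝ) → ℝ,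
          -- query time
          (∀ dat ∈ (build.storedLaw l ⌈α⌉₊).support, ∀ x : Fin n → ℝ,
            ∀ s ∈ (query.exec (queryInput dat x)).support,
              s.answer = f dat x ∧
              (s.time : ℝ) ≤ C * ((n : ℝ) * α) * Real.log ((n : ℝ) + α + 2) ^ k) ∧
          -- the random function `f dat` is `ExpanderEval(SampleSketch(H, α), ·)`
          (build.storedLaw l ⌈α⌉₊).map f = (sampleSketch H ⌈α⌉₊).map expanderEval ∧
          -- expectation
          (∀ x : Fin n → ℝ,
            MemLp (fun r : ℝ => r) 2 (build.valueLaw l ⌈α⌉₊ f x) ∧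
            ∫ r, r ∂(build.valueLaw l ⌈α⌉₊ f x) = x ⬝ᵥ (H.lapMatrix ℝ *ᵥ x)) ∧
          -- variance
          ∀ (n' : ℕ) (T : SimpleGraph (Fin n')) [DecidableRel T.Adj] (φ : H ↪g T)
            (h : ℝ) (_ : 0 < h) (_ : ENNReal.ofReal h ≤ conductance T)
            (x : Fin n → ℝ) (z : Fin n' → ℝ) (_ : ∀ u, x u = z (φ u)),
            Var[fun r : ℝ => r; build.valueLaw l ⌈α⌉₊ f x] ≤
              4 * α ^ (-2 : ℤ) * h ^ (-4 : ℤ) * (z ⬝ᵥ (T.lapMatrix ℝ *ᵥ z)) ^ 2 := by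
  -- All three use `B ≤ 10 Λ`, the last two also `n a ≤ 2 n α`. The sketch has at most `n + 3 + 9 n
  -- a ≤ 13 n a` entries of at most `2 B` bits, and `13 * 2 * 2 * 10 = 520`. A query makes a number
  -- of steps proportional to `n + 3 n a + 1 ≤ 5 n a`, and `5 * 2 * 10 = 100`.
  refine ⟨buildProg, queryProg, 10 * buildConst + 520 + 100 * queryConst, 1, ?_⟩
  have hquery := @query_spec
  have hbuildLaw := @build_law
  generalize buildConst = Kb at hbuildLaw ⊢
  generalize queryConst = Kq at hquery ⊢
  intro n hn H _ l hl α hα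
  have hα0 : 0 < α := by linarith
  have haα : α ≤ ⌈α⌉₊ := Nat.le_ceil α
  have ha1 : 1 ≤ ⌈α⌉₊ := by exact_mod_cast hα.trans haα
  have haα' : (⌈α⌉₊ : ℝ) ≤ α + 1 := (Nat.ceil_lt_add_one hα0.le).le
  set a := ⌈α⌉₊ with ha
  obtain ⟨hlaw, hbuild⟩ := hbuildLaw (H := H) hl ha1
  have hlen := length_eq_card_edgeFinset hl
  have hm : l.length ≤ n ^ 2 := by
    rw [hlen]
    exact SimpleGraph.card_edgeFinset_le_card_choose_two.trans
      (by simpa using Nat.choose_le_pow n 2)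
  have hsize := size_cap_le hn hα hm haα'
  have hW := one_le_cap n l.length a
  set Λ := Real.log ((n : ℝ) + α + 2) with hΛ
  set B := (cap n l.length a).size + 1 with hB
  have hΛ0 : 0 ≤ Λ := Real.log_nonneg (by linarith [(Nat.cast_nonneg n : (0 : ℝ) ≤ n)])
  have hna : ((n * a : ℕ) : ℝ) ≤ 2 * (n * α) := by
    push_cast
    nlinarith [(Nat.cast_nonneg n : (0 : ℝ) ≤ n)]
  have hna1 : n ≤ n * a := Nat.le_mul_of_pos_right n ha1
  have hdat : ∀ dat ∈ (buildProg.storedLaw l a).support,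
      ∃ s ∈ (buildProg.exec (buildInput l a)).support, s.stored = dat := fun dat h => by
    rw [Prog.storedLaw, PMF.support_map] at h
    exact h
  -- Through the equality of laws, the moments computed for the mathematical sketch become those of
  -- the stored one.
  have hval : ∀ x : Fin n → ℝ, buildProg.valueLaw l a (sketchAnswer n) x =
      (((sampleSketch H a).map expanderEval).map fun f => f x).toMeasure := fun x => by
    rw [Prog.valueLaw, ← hlaw, PMF.map_comp]
    rfl
  simp only [pow_one]
  refine ⟨?_, ?_, sketchAnswer n, ?_, hlaw, ?_, ?_⟩
  · intro s hs
    obtain ⟨rl, -, -, ht⟩ := hbuild s hs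
    rw [hlen] at ht
    have ht' : (s.time : ℝ) ≤ Kb * ((H.edgeFinset.card : ℝ) + 1) * (B : ℕ) := by
      exact_mod_cast ht
    calc (s.time : ℝ) ≤ Kb * ((H.edgeFinset.card : ℝ) + 1) * (10 * Λ) :=
          ht'.trans (by gcongr)
      _ = (10 * Kb) * ((H.edgeFinset.card : ℝ) + 1) * Λ := by ring
      _ ≤ _ := by
        gcongr
        have : (0 : ℝ) ≤ Kq := Nat.cast_nonneg _
        linarith
  · intro dat h
    obtain ⟨s, hs, rfl⟩ := hdat dat h
    obtain ⟨rl, hrl, hsk, -⟩ := hbuild s hs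
    have h1 : bitLength s.stored ≤ 13 * (n * a) * (2 * B) := by
      refine (bitLength_stored_le hsk.bdd).trans ?_
      rw [hsk.len]
      exact Nat.mul_le_mul (by omega) (by omega)
    have h2 : (bitLength s.stored : ℝ) ≤ 13 * ((n * a : ℕ) : ℝ) * (2 * (B : ℕ)) := by
      exact_mod_cast h1
    calc (bitLength s.stored : ℝ) ≤ 13 * (2 * (n * α)) * (2 * (10 * Λ)) :=
          h2.trans (by gcongr)
      _ = 520 * (n * α) * Λ := by ring
      _ ≤ _ := by
        gcongr
        have : (0 : ℝ) ≤ Kq := Nat.cast_nonneg _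
        have : (0 : ℝ) ≤ Kb := Nat.cast_nonneg _
        linarith
  · intro dat h x s hs
    obtain ⟨s₀, hs₀, rfl⟩ := hdat dat h
    obtain ⟨rl, hrl, hsk, -⟩ := hbuild s₀ hs₀
    have hl0 := hsk.len
    obtain ⟨h1, h2⟩ := hquery s₀.stored x hW (cellsOf_stored_le hsk.bdd) hs
    refine ⟨h1, ?_⟩
    rw [cellsOf_stored s₀ (by omega), cellsOf_stored s₀ (by omega), hsk.numV, hsk.recs.1] at h2
    have h3 : s.time ≤ Kq * (5 * (n * a)) * B :=
      h2.trans (Nat.mul_le_mul_right _ (Nat.mul_le_mul_left _ (by omega)))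
    have h4 : (s.time : ℝ) ≤ Kq * (5 * ((n * a : ℕ) : ℝ)) * (B : ℕ) := by
      exact_mod_cast h3
    calc (s.time : ℝ) ≤ Kq * (5 * (2 * (n * α))) * (10 * Λ) :=
          h4.trans (by gcongr)
      _ = 100 * Kq * (n * α) * Λ := by ring
      _ ≤ _ := by
        gcongr
        have : (0 : ℝ) ≤ Kb := Nat.cast_nonneg _
        linarith
  · intro x
    rw [hval]
    exact ⟨memLp_expanderEval H a x, mean_expanderEval H a ha1 x⟩
  · intro n' T _ φ h hh hc x z hxz
    have : NeZero n := ⟨by omega⟩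
    rw [hval]
    exact variance_expanderEval_le_of_conductance H a hα haα T φ hh hc x z hxz
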